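/- Let $(M^4,g)$ and $(\overline M^4,\overline g)$ be two oriented and time-oriented four-dimensional spacetimes (smooth Lorentzian metrics of signature $(-,+,+,+)$, Levi-Civita connections $\nabla,\overline\nabla$), let $\iota:S\to M$ be an oriented closed (compact, without boundary) smoothly embedded spacelike surface, and let $N$ be a smooth future-directed timelike vector field of $M$ along $S$. A *reference* is a smooth embedding $\varphi:U\to\overline M$ of an open neighbourhood $U$ of $S$ in $M$ that preserves the orientation and the time-orientation; it is a *4D isometric matching reference* if $\varphi^*\overline g=g$ as forms on $T_pM$ for every $p\in S$. The Chen–Nester–Tung quasi-local energy of $S$ with respect to $N$ and a reference $\varphi$ is, with $\kappa=8\pi$, $$E(S,N,\varphi)=\frac1{2\kappa}\int_S\iota^*\Big[(\omega^a{}_b-\overline\omega^a{}_b)\wedge i_N\eta_a{}^b+\overline D_bN^a\,(\eta_a{}^b-\overline\eta_a{}^b)\Big],\qquad \eta_a{}^b=\tfrac12\sqrt{-\det g}\;g^{b\beta}\epsilon_{a\beta\mu\nu}\,dx^\mu\wedge dx^\nu ,$$ in positively oriented coordinates ($\epsilon_{0123}=1$), summed over $a,b$. Here $\omega^a{}_b$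 are the connection forms of the Levi-Civita connection of $g$, the quantities $\overline\omega^a{}_b$, $\overline\eta_a{}^b$, $\overline D$ are those of $\varphi^*\overline g$ in the same frame, and $\overline D_bN^a$ is formed with an extension of $N$ to a neighbourhood of $S$. Let $N^\perp$ be the orthogonal projection of $N$ to the normal bundle $T^\perp_SM$, $N^\top=N-N^\perp$, and let $X$ be the smooth unit vector field along $S$ that is normal to $S$ and orthogonal to $N$, and for which $N^\perp$, $X$ followed by a positively oriented frame of $S$ is a positively oriented frame of $M$. Let $\varphi$ be a 4D isometric matching reference, and put $\overline S=\varphi(S)$, $\overline X=\varphi_*X$, $\overline N^\perp=\varphi_*N^\perp$, $\overline N^\top=\varphi_*N^\top$. Let $H$ and $\overline H$ be the mean curvature vectors (traces of the second fundamental forms) of $S$ in $M$ and of $\overline S$ in $\overline M$, and $\|v\|=\sqrt{|\langle v,v\rangle|}$. Then, for every extension of $N$, $$E(S,N,\varphi)=\frac1{8\pi}\int_{\overline S}\Big(-\|\overline N^\perp\|\langle\overline H,\overline X\rangle+\frac1{\|\overline N^\perp\|}\langle\overline\nabla_{\overline N^\top}\overline X,\overline N^\perp\rangle\Big)dV_{\overline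 S}-\frac1{8\pi}\int_S\Big(-\|N^\perp\|\langle H,X\rangle+\frac1{\|N^\perp\|}\langle\nabla_{N^\top}X,N^\perp\rangle\Big)dV_S .$$ In particular, if $N$ is orthogonal to $S$, then $$E(S,N,\varphi)=\frac1{8\pi}\int_S\|N\|\big(-\langle\overline H,\overline X\rangle+\langle H,X\rangle\big)\,dV_S ,$$ where $\overline H$ and $\overline X$ at $p\in S$ stand for their values at $\varphi(p)$. -/

import Mathlib

open Set Filter Topology MeasureTheory
open scoped Manifold ContDiff BigOperators

noncomputable section

namespace CNT

/-! ### Coordinates, frames and orientations -/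

section Coordinates

variable {n : ℕ} {M : Type*} [TopologicalSpace M] [ChartedSpace (EuclideanSpace ℝ (Fin n)) M]

/-- The components `(dx⁰(v), …, dxⁿ⁻¹(v))` of a tangent vector `v ∈ T_x M` in the chart `x⁰, …, xⁿ⁻¹`
centred at `c`. Used for `x` in the domain of that chart. -/
def comps (c x : M) : TangentSpace (𝓡 n) x →L[ℝ] EuclideanSpace ℝ (Fin n) :=
  mfderiv (𝓡 n) 𝓘(ℝ, EuclideanSpace ℝ (Fin n)) (extChartAt (𝓡 n) c) x

/-- The coordinate vector `∂_i` at `x` of the chart centred at `c`, that is, the vector with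
`dx^j(∂_i) = δ_i^j`. Used for `x` in the domain of that chart. -/
def coordFrame (c x : M) (i : Fin n) : TangentSpace (𝓡 n) x :=
  (comps c x).inverse (EuclideanSpace.single i (1 : ℝ))

/-- The frame `v` of the vector space `V` is a basis and is positively oriented. -/
def IsPositiveFrame {V : Type*} [AddCommGroup V] [Module ℝ V]
    (o : Orientation ℝ V (Fin n)) (v : Fin n → V) : Prop :=
  ∃ b : Module.Basis (Fin n) ℝ V, (∀ i, b i = v i) ∧ b.orientation = o

variable (n M) in
/-- An orientation of an `n`-manifold: an orientation of every tangent space, such that in every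
chart the property that the coordinate frame is positively oriented is locally constant. -/
structure ManifoldOrientation where
  /-- the orientation of `T_x M` -/
  at' : ∀ x : M, Orientation ℝ (TangentSpace (𝓡 n) x) (Fin n)
  locallyConstant : ∀ c : M, ∀ x ∈ (chartAt (EuclideanSpace ℝ (Fin n)) c).source, ∀ᶠ y in 𝓝 x,
    (IsPositiveFrame (at' y) (coordFrame c y) ↔ IsPositiveFrame (at' x) (coordFrame c x))

open Classical in
/-- `1` if the coordinate frame at `x` of the chart centred at `c` is positively oriented,
`-1` otherwise. -/
def ManifoldOrientation.sign (o : ManifoldOrientation n M) (c x : M) : ℝ :=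
  if IsPositiveFrame (o.at' x) (coordFrame c x) then 1 else -1

variable (n M) in
/-- Fields of (bilinear) forms on the tangent spaces, not necessarily smooth. -/
abbrev FormField := ∀ x : M, TangentSpace (𝓡 n) x → TangentSpace (𝓡 n) x → ℝ

/-- The matrix `(g_ij) = (g(∂_i, ∂_j))` at `x` in the chart centred at `c`. -/
def gram (g : FormField n M) (c x : M) : Matrix (Fin n) (Fin n) ℝ :=
  Matrix.of fun i j => g x (coordFrame c x i) (coordFrame c x j)

/-- The partial derivative `∂_i f` at `x` of a function `f` in the chart centred at `c`. -/
def partialDeriv (c : M) (i : Fin n) (f : M → ℝ) (x : M) : ℝ :=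
  fderiv ℝ (fun y => f ((extChartAt (𝓡 n) c).symm y)) (extChartAt (𝓡 n) c x)
    (EuclideanSpace.single i (1 : ℝ))

/-- The Christoffel symbols `Γ^a_{m b}` of the Levi-Civita connection of `g`, at `x` in the chart
centred at `c`: `∇_{∂_m} ∂_b = Γ^a_{m b} ∂_a`. -/
def christoffel (g : FormField n M) (c x : M) (a m b : Fin n) : ℝ :=
  (1 / 2) * ∑ d, (gram g c x)⁻¹ a d *
    (partialDeriv c m (fun z => gram g c z d b) x
      + partialDeriv c b (fun z => gram g c z d m) x
      - partialDeriv c d (fun z => gram g c z m b) x)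

/-- The connection forms `ω^a_b = Γ^a_{m b} dx^m` of the Levi-Civita connection of `g` with respect
to the coordinate frame of the chart centred at `c`, applied to `u ∈ T_x M`:
`∇_u ∂_b = ω^a_b(u) ∂_a`. -/
def connForm (g : FormField n M) (c x : M) (a b : Fin n) (u : TangentSpace (𝓡 n) x) : ℝ :=
  ∑ m, christoffel g c x a m b * comps c x u m

/-- The components `D_b N^a = ∂_b N^a + Γ^a_{b d} N^d` of the covariant derivative of a vector
field `N` with respect to the Levi-Civita connection of `g`. -/
def covDerivComp (g : FormField n M) (N : ∀ x : M, TangentSpace (𝓡 n) x) (c x : M)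
    (b a : Fin n) : ℝ :=
  partialDeriv c b (fun z => comps c z (N z) a) x
    + ∑ d, christoffel g c x a b d * comps c x (N x) d

end Coordinates

/-! ### Geometry of maps between manifolds -/

section Maps

variable {k n : ℕ} {S : Type*} [TopologicalSpace S] [ChartedSpace (EuclideanSpace ℝ (Fin k)) S]
  {M : Type*} [TopologicalSpace M] [ChartedSpace (EuclideanSpace ℝ (Fin n)) M]

/-- The pullback `F^* g`. -/
def pullback (F : S → M) (g : FormField n M) : FormField k S := fun p u v =>
  g (F p) (mfderiv (𝓡 k) (𝓡 n) F p u) (mfderiv (𝓡 k) (𝓡 n) F p v)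

/-- The covariant derivative `∇_v Y` (Levi-Civita connection of `g`) of a vector field `Y` along
the map `F`, for `v ∈ T_p S`, computed in the chart of `M` centred at `F p`:
`(∇_v Y)^a = v(Y^a) + Γ^a_{m b} dF(v)^m Y^b`. -/
def covAlong (g : FormField n M) (F : S → M) (Y : ∀ q : S, TangentSpace (𝓡 n) (F q)) (p : S)
    (v : TangentSpace (𝓡 k) p) : TangentSpace (𝓡 n) (F p) :=
  ∑ a, (mvfderiv (𝓡 k) (fun q : S => comps (F p) (F q) (Y q) a) p v
      + ∑ b, connForm g (F p) (F p) a b (mfderiv (𝓡 k) (𝓡 n) F p v)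
          * comps (F p) (F p) (Y p) b) • coordFrame (F p) (F p) a

/-- The tangential part of `v ∈ T_{F p} M` along an immersion `F` with non-degenerate induced metric
`h = F^* g`, as a vector of `T_p S`: `h^{ij} g(v, dF ∂_j) ∂_i`. -/
def tangentialPart (g : FormField n M) (F : S → M) (p : S) (v : TangentSpace (𝓡 n) (F p)) :
    TangentSpace (𝓡 k) p :=
  ∑ i, ∑ j, ((gram (pullback (k := k) F g) p p)⁻¹ i j
    * g (F p) v (mfderiv (𝓡 k) (𝓡 n) F p (coordFrame p p j))) • coordFrame p p i

/-- The orthogonal projection `v^⊥` of `v ∈ T_{F p} M` to the normal space of `F` at `p`. -/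
def normalPart (k : ℕ) [ChartedSpace (EuclideanSpace ℝ (Fin k)) S]
    (g : FormField n M) (F : S → M) (p : S) (v : TangentSpace (𝓡 n) (F p)) :
    TangentSpace (𝓡 n) (F p) :=
  v - mfderiv (𝓡 k) (𝓡 n) F p (tangentialPart g F p v)

/-- The mean curvature vector `H = h^{ij} (∇_{∂_i} (dF ∂_j))^⊥`, the trace with respect to the
induced metric `h = F^* g` of the second fundamental form of `F`. -/
def meanCurvature (k : ℕ) [ChartedSpace (EuclideanSpace ℝ (Fin k)) S]
    (g : FormField n M) (F : S → M) (p : S) : TangentSpace (𝓡 n) (F p) :=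
  ∑ i, ∑ j, (gram (pullback (k := k) F g) p p)⁻¹ i j •
    normalPart k g F p
      (covAlong g F (fun q => mfderiv (𝓡 k) (𝓡 n) F q (coordFrame p q j)) p (coordFrame p p i))

/-- `‖v‖ = |g(v, v)|^{1/2}`. -/
def lnorm (g : FormField n M) {x : M} (v : TangentSpace (𝓡 n) x) : ℝ := Real.sqrt |g x v v|

end Maps

/-! ### Integration over surfaces -/

section Integration

variable {S : Type*} [TopologicalSpace S] [ChartedSpace (EuclideanSpace ℝ (Fin 2)) S]
  [IsManifold (𝓡 2) ∞ S] [T2Space S] [SigmaCompactSpace S]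

variable (S) in
/-- A smooth partition of unity subordinate to the cover of the surface `S` by its charts. -/
def chartPartition : SmoothPartitionOfUnity S (𝓡 2) S univ :=
  (SmoothPartitionOfUnity.exists_isSubordinate_chartAt_source (𝓡 2) S).choose

variable (S) in
theorem chartPartition_isSubordinate :
    (chartPartition S).IsSubordinate
      (fun c => (chartAt (EuclideanSpace ℝ (Fin 2)) c).source) :=
  (SmoothPartitionOfUnity.exists_isSubordinate_chartAt_source (𝓡 2) S).choose_spec

/-- The integral `∫_S α` of a (continuous) 2-form `α` over the oriented compact surface `S`: the sum
over the charts of the integrals of `ρ_c α(∂_1, ∂_2) dx¹ dx²`, with a minus sign where the chart is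
negatively oriented. -/
def integralForm (o : ManifoldOrientation 2 S) (α : FormField 2 S) : ℝ :=
  ∑ᶠ c : S, ∫ y in (extChartAt (𝓡 2) c).target,
    chartPartition S c ((extChartAt (𝓡 2) c).symm y)
      * o.sign c ((extChartAt (𝓡 2) c).symm y)
      * α ((extChartAt (𝓡 2) c).symm y) (coordFrame c ((extChartAt (𝓡 2) c).symm y) 0)
          (coordFrame c ((extChartAt (𝓡 2) c).symm y) 1)

/-- The integral `∫_S f dV` of a (continuous) function `f` over the compact surface `S` with respect
to the area element `dV = (det h_ij)^{1/2} dx¹ dx²` of the Riemannian metric `h`. -/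
def integralArea (h : FormField 2 S) (f : S → ℝ) : ℝ :=
  ∑ᶠ c : S, ∫ y in (extChartAt (𝓡 2) c).target,
    chartPartition S c ((extChartAt (𝓡 2) c).symm y)
      * f ((extChartAt (𝓡 2) c).symm y)
      * Real.sqrt (gram h c ((extChartAt (𝓡 2) c).symm y)).det

end Integration

/-! ### Spacetimes -/

section Spacetimes

variable (M : Type*) [TopologicalSpace M] [ChartedSpace (EuclideanSpace ℝ (Fin 4)) M]
  [IsManifold (𝓡 4) ∞ M]

/-- An oriented and time-oriented four-dimensional spacetime structure on the manifold `M`: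
a smooth Lorentzian metric of signature `(-,+,+,+)`, an orientation, and a time-orientation, given
by a continuous timelike vector field `time`. -/
structure Spacetime where
  /-- the Lorentzian metric -/
  metric : ∀ x : M, TangentSpace (𝓡 4) x →L[ℝ] TangentSpace (𝓡 4) x →L[ℝ] ℝ
  smooth : ContMDiff (𝓡 4)
    ((𝓡 4).prod 𝓘(ℝ, EuclideanSpace ℝ (Fin 4) →L[ℝ] EuclideanSpace ℝ (Fin 4) →L[ℝ] ℝ)) ∞
    (fun x => Bundle.TotalSpace.mk'
      (EuclideanSpace ℝ (Fin 4) →L[ℝ] EuclideanSpace ℝ (Fin 4) →L[ℝ] ℝ)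
      (E := fun x : M => TangentSpace (𝓡 4) x →L[ℝ] TangentSpace (𝓡 4) x →L[ℝ] ℝ) x (metric x))
  symm : ∀ (x : M) (u v : TangentSpace (𝓡 4) x), metric x u v = metric x v u
  lorentzian : ∀ x : M, ∃ b : Module.Basis (Fin 4) ℝ (TangentSpace (𝓡 4) x), ∀ i j,
    metric x (b i) (b j) = if i = j then (if i = 0 then -1 else 1) else 0
  /-- the orientation -/
  orientation : ManifoldOrientation 4 M
  /-- the timelike vector field that determines the future -/
  time : ∀ x : M, TangentSpace (𝓡 4) x
  continuous_time : Continuous fun x => (⟨x, time x⟩ : TangentBundle (𝓡 4) M)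
  time_timelike : ∀ x : M, metric x (time x) (time x) < 0

variable {M}

/-- The metric as a field of forms. -/
def Spacetime.g (𝓜 : Spacetime M) : FormField 4 M := fun x u v => 𝓜.metric x u v

/-- The vector `v` is timelike. -/
def Spacetime.IsTimelike (𝓜 : Spacetime M) {x : M} (v : TangentSpace (𝓡 4) x) : Prop :=
  𝓜.g x v v < 0

/-- The vector `v` is timelike and future-directed. -/
def Spacetime.IsFutureTimelike (𝓜 : Spacetime M) {x : M} (v : TangentSpace (𝓡 4) x) : Prop :=
  𝓜.g x v v < 0 ∧ 𝓜.g x v (𝓜.time x) < 0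

/-- The Levi-Civita symbol `ε_{a b m s}`, with `ε_{0123} = 1`. -/
def leviCivita (a b m s : Fin 4) : ℝ :=
  Matrix.det (Matrix.of fun r t : Fin 4 => if ![a, b, m, s] r = t then (1 : ℝ) else 0)

/-- The 2-forms `η_a^b = (1/2) (-det g)^{1/2} g^{b d} ε_{a d m s} dx^m ∧ dx^s` of the metric `g`,
applied to `u, v ∈ T_x M`, in the chart centred at `c`. The formula is the one for a positively
oriented chart; in a negatively oriented chart `ε` changes its sign. -/
def etaForm (o : ManifoldOrientation 4 M) (g : FormField 4 M) (c x : M) (a b : Fin 4)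
    (u v : TangentSpace (𝓡 4) x) : ℝ :=
  (1 / 2) * o.sign c x * Real.sqrt (-(gram g c x).det) *
    ∑ d, ∑ m, ∑ s, (gram g c x)⁻¹ b d * leviCivita a d m s *
      (comps c x u m * comps c x v s - comps c x u s * comps c x v m)

/-- The 2-form `(ω^a_b - ω̄^a_b) ∧ i_N η_a^b + D̄_b N^a (η_a^b - η̄_a^b)` on a neighbourhood of the
surface, applied to `u, v ∈ T_x M`, in the chart centred at `x`. The barred quantities belong to the
metric `gbar`, the others to the metric `g`. -/
def cntForm (o : ManifoldOrientation 4 M) (g gbar : FormField 4 M)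
    (N : ∀ x : M, TangentSpace (𝓡 4) x) : FormField 4 M := fun x u v =>
  ∑ a, ∑ b,
    ((connForm g x x a b u - connForm gbar x x a b u) * etaForm o g x x a b (N x) v
      - (connForm g x x a b v - connForm gbar x x a b v) * etaForm o g x x a b (N x) u
      + covDerivComp gbar N x x b a
          * (etaForm o g x x a b u v - etaForm o gbar x x a b u v))

variable {M' : Type*} [TopologicalSpace M'] [ChartedSpace (EuclideanSpace ℝ (Fin 4)) M']
  [IsManifold (𝓡 4) ∞ M']

/-- `φ`, restricted to `U`, is a reference for the subset `K` of the physical spacetime `𝓜` in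
the reference spacetime `𝓜'`: `U` is an open neighbourhood of `K`, and `φ` is a smooth embedding of
`U` that preserves the orientation and the time-orientation. -/
structure IsReference (𝓜 : Spacetime M) (𝓜' : Spacetime M') (K U : Set M) (φ : M → M') :
    Prop where
  isOpen : IsOpen U
  subset : K ⊆ U
  smooth : ContMDiffOn (𝓡 4) (𝓡 4) ∞ φ U
  immersion : ∀ x ∈ U, Function.Injective (mfderiv (𝓡 4) (𝓡 4) φ x)
  embedding : IsEmbedding (U.domRestrict φ)
  orientation : ∀ x ∈ U, ∀ v : Fin 4 → TangentSpace (𝓡 4) x,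
    IsPositiveFrame (𝓜.orientation.at' x) v →
      IsPositiveFrame (𝓜'.orientation.at' (φ x)) (fun i => mfderiv (𝓡 4) (𝓡 4) φ x (v i))
  time : ∀ x ∈ U, ∀ v : TangentSpace (𝓡 4) x, 𝓜.IsFutureTimelike v →
    𝓜'.IsTimelike (mfderiv (𝓡 4) (𝓡 4) φ x v) →
      𝓜'.IsFutureTimelike (mfderiv (𝓡 4) (𝓡 4) φ x v)

/-- A 4D isometric matching reference: a reference with `φ^* ḡ = g` at the points of `K` (as forms
on the four-dimensional tangent spaces). -/
structure IsIsometricMatching (𝓜 : Spacetime M) (𝓜' : Spacetime M') (K U : Set M) (φ : M → M') :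
    Prop extends IsReference 𝓜 𝓜' K U φ where
  matching : ∀ x ∈ K, ∀ u v : TangentSpace (𝓡 4) x, pullback φ 𝓜'.g x u v = 𝓜.g x u v

variable {S : Type*} [TopologicalSpace S] [ChartedSpace (EuclideanSpace ℝ (Fin 2)) S]
  [IsManifold (𝓡 2) ∞ S] [T2Space S] [SigmaCompactSpace S]

/-- The Chen-Nester-Tung quasi-local energy (with `κ = 8π`)
`E = (1/2κ) ∫_S ι^*[(ω^a_b - ω̄^a_b) ∧ i_N η_a^b + D̄_b N^a (η_a^b - η̄_a^b)]`
of the surface `ι : S → M` with respect to the displacement field `N`, given on `M` (only its germ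
along the surface matters), and the reference `φ`. The barred quantities belong to `φ^* ḡ`. -/
def energy (𝓜 : Spacetime M) (𝓜' : Spacetime M') (o : ManifoldOrientation 2 S) (ι : S → M)
    (N : ∀ x : M, TangentSpace (𝓡 4) x) (φ : M → M') : ℝ :=
  1 / (2 * (8 * Real.pi)) *
    integralForm o
      (pullback ι (cntForm 𝓜.orientation 𝓜.g (pullback φ 𝓜'.g) N))

/-- The integrand `-‖n‖ ⟨H, X⟩ + ‖n‖⁻¹ ⟨∇_w X, n⟩` for the surface `F : S → M` with mean curvature
vector `H`, a tangent vector `w ∈ T_p S`, a normal vector `n` at `p` and a vector field `X` along the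
surface. -/
def boundaryDensity (𝓜 : Spacetime M) (F : S → M) (X : ∀ q : S, TangentSpace (𝓡 4) (F q)) (p : S)
    (n : TangentSpace (𝓡 4) (F p)) (w : TangentSpace (𝓡 2) p) : ℝ :=
  -lnorm 𝓜.g n * 𝓜.g (F p) (meanCurvature 2 𝓜.g F p) (X p)
    + 1 / lnorm 𝓜.g n * 𝓜.g (F p) (covAlong 𝓜.g F X p w) n

end Spacetimes

end CNT

end

/-! Along S the forms g and φ^*ḡ coincide, hence so do η and η̄. The term with D̄N therefore
vanishes pointwise, and with it every dependence on the extension of N. What remains is the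
difference A = ω̄ - ω of the connection matrices, contracted with i_N η, and only A(u) with u
tangent to S enters. It has two properties. It is tensorial: A(u)Y = ∇̄_u Y - ∇_u Y for a field Y
along S (`comps_covAlong_sub`). It is skew with respect to g: two metrics that agree along S have
the same derivatives in the directions tangent to S, and both connections are metric
(`connDiff_skew`).

Let e_1, e_2 be coordinate vectors of S, h the induced metric, and N = N^⊥ + w^i e_i. In the frame
(N^⊥, X, e_1, e_2) the volume form with N and one e_j inserted has components only in the plane
(N^⊥, X) and in the plane spanned by X and the other e_i. Contracted with the skew A(e_i), it sees
only ⟨A(e_i)X, e_j⟩ and ⟨A(e_i)X, N^⊥⟩, while the orientation signs turn (-det g)^{1/2} into ‖N^⊥‖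
times the area density of S. Hence (`volContraction_eq_trace`, `sign_mul_cntForm_pullback`) the
energy form equals 2 (‖N^⊥‖ h^{ij} ⟨A(e_i)X, e_j⟩ + ‖N^⊥‖⁻¹ ⟨A(N^⊤)X, N^⊥⟩) dV, a barred density
minus an unbarred one. Since X is normal, h^{ij} ⟨∇_{e_i}X, e_j⟩ = -⟨H, X⟩
(`meanCurvature_eq_of_normal`), which produces the mean curvature terms.

The barred density is first obtained on M for the metric φ^*ḡ; naturality of the Levi-Civita
connection carries it to the reference spacetime (`christoffelVec_pullback`, `covAlong_pullback`).
Each density is continuous (`continuous_traceDensity`), so the integral of the difference splits.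
The definitions work at every point in the chart centred at that point, whereas continuity and
integration need one fixed chart; `comps_covAlong` and `sum_gram_inv_mul_eq` provide the
independence of the chart. -/

noncomputable section

namespace CNT

/-! ### Components of vectors and derivatives in a chart -/

section CoordinateCalculus

variable {k n : ℕ} {M : Type*} [TopologicalSpace M] [ChartedSpace (EuclideanSpace ℝ (Fin n)) M]
  {S : Type*} [TopologicalSpace S] [ChartedSpace (EuclideanSpace ℝ (Fin k)) S]
  {V : Type*} [NormedAddCommGroup V] [NormedSpace ℝ V]

theorem comps_isInvertible [IsManifold (𝓡 n) ∞ M] {c x : M}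
    (hx : x ∈ (chartAt (EuclideanSpace ℝ (Fin n)) c).source) : (comps (n := n) c x).IsInvertible :=
  isInvertible_mfderiv_extChartAt (by rwa [extChartAt_source])

theorem comps_coordFrame [IsManifold (𝓡 n) ∞ M] {c x : M}
    (hx : x ∈ (chartAt (EuclideanSpace ℝ (Fin n)) c).source) (i : Fin n) :
    comps c x (coordFrame c x i) = EuclideanSpace.single i 1 :=
  (comps_isInvertible hx).self_apply_inverse _

theorem sum_comps_smul_coordFrame [IsManifold (𝓡 n) ∞ M] {c x : M}
    (hx : x ∈ (chartAt (EuclideanSpace ℝ (Fin n)) c).source) (v : TangentSpace (𝓡 n) x) :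
    ∑ a, comps c x v a • coordFrame c x a = v := by
  apply (comps_isInvertible hx).injective
  ext b
  simp [comps_coordFrame hx, Finset.sum_apply, Pi.single_apply]

theorem comps_mfderiv [IsManifold (𝓡 n) ∞ M] {F : S → M} {p : S} {c : M}
    (hF : MDifferentiableAt (𝓡 k) (𝓡 n) F p)
    (hc : F p ∈ (chartAt (EuclideanSpace ℝ (Fin n)) c).source) (v : TangentSpace (𝓡 k) p) :
    comps c (F p) (mfderiv (𝓡 k) (𝓡 n) F p v)
      = mvfderiv (𝓡 k) (fun q => extChartAt (𝓡 n) c (F q)) p v := by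
  exact (mfderiv_comp_apply p (mdifferentiableAt_extChartAt hc) hF v).symm

theorem extChartAt_symm_mdifferentiableAt [IsManifold (𝓡 n) ∞ M] {c x : M}
    (hx : x ∈ (chartAt (EuclideanSpace ℝ (Fin n)) c).source) :
    MDifferentiableAt 𝓘(ℝ, EuclideanSpace ℝ (Fin n)) (𝓡 n) (extChartAt (𝓡 n) c).symm
      (extChartAt (𝓡 n) c x) := by
  have h := mdifferentiableWithinAt_extChartAt_symm (I := 𝓡 n) (x := c)
    ((extChartAt (𝓡 n) c).map_source (by rwa [extChartAt_source]))
  rwa [ModelWithCorners.range_eq_univ, mdifferentiableWithinAt_univ] at h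

/-- Near `x`, `f` is its coordinate expression composed with the chart, so this is the chain rule.
It moves every later differentiation into a fixed Euclidean chart. -/
theorem mvfderiv_eq_fderiv [IsManifold (𝓡 n) ∞ M] {f : M → V} {c x : M}
    (hf : MDifferentiableAt (𝓡 n) 𝓘(ℝ, V) f x)
    (hx : x ∈ (chartAt (EuclideanSpace ℝ (Fin n)) c).source) (v : TangentSpace (𝓡 n) x) :
    mvfderiv (𝓡 n) f x v
      = fderiv ℝ (fun y => f ((extChartAt (𝓡 n) c).symm y)) (extChartAt (𝓡 n) c x)
          (comps c x v) := by
  have hx' : x ∈ (extChartAt (𝓡 n) c).source := by rwa [extChartAt_source]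
  have hl := (extChartAt (𝓡 n) c).left_inv hx'
  have h1 : MDifferentiableAt 𝓘(ℝ, EuclideanSpace ℝ (Fin n)) 𝓘(ℝ, V)
      (fun y => f ((extChartAt (𝓡 n) c).symm y)) (extChartAt (𝓡 n) c x) :=
    MDifferentiableAt.comp (g := f) (extChartAt (𝓡 n) c x) (by rwa [hl]) (extChartAt_symm_mdifferentiableAt hx)
  have h2 := mfderiv_comp_apply x h1 (mdifferentiableAt_extChartAt hx) v
  rw [mfderiv_eq_fderiv] at h2
  refine Eq.trans ?_ h2
  have h3 : f =ᶠ[𝓝 x] (fun y => f ((extChartAt (𝓡 n) c).symm y)) ∘ extChartAt (𝓡 n) c := by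
    filter_upwards [(isOpen_extChartAt_source c).mem_nhds hx'] with z hz
    simp only [Function.comp_apply, (extChartAt (𝓡 n) c).left_inv hz]
  exact congrArg (fun L : TangentSpace (𝓡 n) x →L[ℝ] V => L v) h3.mfderiv_eq

end CoordinateCalculus

/-! ### Product rules at a moving base point -/

section BilinearCalculus

variable {X E F : Type*} [NormedAddCommGroup X] [NormedSpace ℝ X]
  [NormedAddCommGroup E] [NormedSpace ℝ E] [NormedAddCommGroup F] [NormedSpace ℝ F]

theorem fderiv_clm_comp {f : E → E →L[ℝ] F} {c u : X → E} {y w : X}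
    (hf : DifferentiableAt ℝ f (c y)) (hc : DifferentiableAt ℝ c y) (hu : DifferentiableAt ℝ u y) :
    fderiv ℝ (fun y => f (c y) (u y)) y w
      = fderiv ℝ f (c y) (fderiv ℝ c y w) (u y) + f (c y) (fderiv ℝ u y w) := by
  have h1 := (hf.hasFDerivAt.comp y hc.hasFDerivAt).clm_apply hu.hasFDerivAt
  refine (congrArg (fun L => L w) h1.fderiv).trans ?_
  simp
  abel

/-- The product rule for g(Y, Z) along a curve of base points. It serves both for metric
compatibility and for differentiating a pulled-back metric. -/
theorem fderiv_bilin_comp {f : E → E →L[ℝ] E →L[ℝ] F} {c u v : X → E} {y w : X}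
    (hf : DifferentiableAt ℝ f (c y)) (hc : DifferentiableAt ℝ c y)
    (hu : DifferentiableAt ℝ u y) (hv : DifferentiableAt ℝ v y) :
    fderiv ℝ (fun y => f (c y) (u y) (v y)) y w
      = fderiv ℝ f (c y) (fderiv ℝ c y w) (u y) (v y)
        + f (c y) (fderiv ℝ u y w) (v y) + f (c y) (u y) (fderiv ℝ v y w) := by
  have h0 : DifferentiableAt ℝ (fun y => f (c y) (u y)) y := 
    (DifferentiableAt.comp (g := f) (f := c) y hf hc).clm_apply hu
  have h2 := h0.hasFDerivAt.clm_apply hv.hasFDerivAt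
  rw [h2.fderiv]
  simp only [add_apply, ContinuousLinearMap.comp_apply, ContinuousLinearMap.flip_apply]
  rw [fderiv_clm_comp (w := w) hf hc hu, add_apply]
  abel

end BilinearCalculus

/-! ### Metrics in coordinates and the Koszul formula -/

section MetricInCoordinates

variable {n : ℕ} {M : Type*} [TopologicalSpace M] [ChartedSpace (EuclideanSpace ℝ (Fin n)) M]

/-- The form `g` is bilinear at `x`. -/
def IsBilinAt (g : FormField n M) (x : M) : Prop :=
  ∃ B : TangentSpace (𝓡 n) x →ₗ[ℝ] TangentSpace (𝓡 n) x →ₗ[ℝ] ℝ, ∀ u v, g x u v = B u v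

/-- The bilinear form `t dx^i ⊗ dx^j`. -/
def coordBilin (i j : Fin n) (t : ℝ) :
    EuclideanSpace ℝ (Fin n) →L[ℝ] EuclideanSpace ℝ (Fin n) →L[ℝ] ℝ :=
  (t • EuclideanSpace.proj i : EuclideanSpace ℝ (Fin n) →L[ℝ] ℝ).smulRight
    (EuclideanSpace.proj j : EuclideanSpace ℝ (Fin n) →L[ℝ] ℝ)

theorem coordBilin_apply (i j : Fin n) (t : ℝ) (u v : EuclideanSpace ℝ (Fin n)) :
    coordBilin i j t u v = t * (u i * v j) := by
  simp [coordBilin, mul_assoc]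

theorem contDiff_coordBilin {m : WithTop ℕ∞} (i j : Fin n) : ContDiff ℝ m (coordBilin i j) := by
  rw [contDiff_clm_apply_iff]
  intro u
  rw [contDiff_clm_apply_iff]
  intro v
  simp only [coordBilin_apply]
  fun_prop

/-- The coordinate expression of the form field `g` in the chart centred at `c`. -/
def metricIn (g : FormField n M) (c : M) (y : EuclideanSpace ℝ (Fin n)) :
    EuclideanSpace ℝ (Fin n) →L[ℝ] EuclideanSpace ℝ (Fin n) →L[ℝ] ℝ :=
  ∑ i, ∑ j, coordBilin i j (gram g c ((extChartAt (𝓡 n) c).symm y) i j)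

theorem metricIn_apply (g : FormField n M) (c : M) (y u v : EuclideanSpace ℝ (Fin n)) :
    metricIn g c y u v
      = ∑ i, ∑ j, gram g c ((extChartAt (𝓡 n) c).symm y) i j * (u i * v j) := by
  simp [metricIn, coordBilin_apply]

theorem IsBilinAt.eq_metricIn [IsManifold (𝓡 n) ∞ M] {g : FormField n M} {c x : M}
    (hg : IsBilinAt g x) (hx : x ∈ (chartAt (EuclideanSpace ℝ (Fin n)) c).source)
    (u v : TangentSpace (𝓡 n) x) :
    g x u v = metricIn g c (extChartAt (𝓡 n) c x) (comps c x u) (comps c x v) := by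
  obtain ⟨B, hB⟩ := hg
  rw [metricIn_apply, (extChartAt (𝓡 n) c).left_inv (by rwa [extChartAt_source])]
  conv_lhs => rw [hB, ← sum_comps_smul_coordFrame hx u, ← sum_comps_smul_coordFrame hx v]
  simp only [map_sum, map_smul, LinearMap.sum_apply, LinearMap.smul_apply, smul_eq_mul, gram,
    Matrix.of_apply, hB, Finset.mul_sum]
  rw [Finset.sum_comm]
  exact Finset.sum_congr rfl fun i _ => Finset.sum_congr rfl fun j _ => by ring

theorem contDiffAt_metricIn {m : WithTop ℕ∞} {g : FormField n M} {c : M}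
    {y : EuclideanSpace ℝ (Fin n)}
    (h : ∀ i j, ContDiffAt ℝ m (fun y => gram g c ((extChartAt (𝓡 n) c).symm y) i j) y) :
    ContDiffAt ℝ m (metricIn g c) y :=
  ContDiffAt.sum fun i _ => ContDiffAt.sum fun j _ => 
    (contDiff_coordBilin i j).contDiffAt.comp y (h i j)

theorem metricIn_single (g : FormField n M) (c : M) (y : EuclideanSpace ℝ (Fin n)) (i j : Fin n) :
    metricIn g c y (EuclideanSpace.single i 1) (EuclideanSpace.single j 1)
      = gram g c ((extChartAt (𝓡 n) c).symm y) i j := by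
  simp [metricIn_apply]

/-- Near `x`, the form field `g` is a (pseudo-Riemannian) metric of class `C¹`. -/
structure IsMetricAt (g : FormField n M) (x : M) : Prop where
  bilin : ∀ᶠ z in 𝓝 x, IsBilinAt g z
  symm : ∀ᶠ z in 𝓝 x, ∀ u v, g z u v = g z v u
  nondeg : ∀ u, (∀ v, g x u v = 0) → u = 0
  smooth : ∀ c, x ∈ (chartAt (EuclideanSpace ℝ (Fin n)) c).source → ∀ i j,
    ContDiffAt ℝ 1 (fun y => gram g c ((extChartAt (𝓡 n) c).symm y) i j) (extChartAt (𝓡 n) c x)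

section

variable {g : FormField n M} {c x : M}

theorem IsMetricAt.contDiffAt (hg : IsMetricAt g x)
    (hx : x ∈ (chartAt (EuclideanSpace ℝ (Fin n)) c).source) :
    ContDiffAt ℝ 1 (metricIn g c) (extChartAt (𝓡 n) c x) :=
  contDiffAt_metricIn (hg.smooth c hx)

theorem IsMetricAt.differentiableAt (hg : IsMetricAt g x)
    (hx : x ∈ (chartAt (EuclideanSpace ℝ (Fin n)) c).source) :
    DifferentiableAt ℝ (metricIn g c) (extChartAt (𝓡 n) c x) :=
  (hg.contDiffAt hx).differentiableAt one_ne_zero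

theorem tendsto_extChartAt_symm (hx : x ∈ (chartAt (EuclideanSpace ℝ (Fin n)) c).source) :
    Tendsto (extChartAt (𝓡 n) c).symm (𝓝 (extChartAt (𝓡 n) c x)) (𝓝 x) := by
  have hx' : x ∈ (extChartAt (𝓡 n) c).source := by rwa [extChartAt_source]
  have := continuousAt_extChartAt_symm' hx'
  rwa [ContinuousAt, (extChartAt (𝓡 n) c).left_inv hx'] at this

theorem IsMetricAt.metricIn_symm (hg : IsMetricAt g x)
    (hx : x ∈ (chartAt (EuclideanSpace ℝ (Fin n)) c).source) :
    ∀ᶠ y in 𝓝 (extChartAt (𝓡 n) c x), ∀ u v, metricIn g c y u v = metricIn g c y v u := by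
  filter_upwards [(tendsto_extChartAt_symm hx).eventually hg.symm] with y hy u v
  rw [metricIn_apply, metricIn_apply, Finset.sum_comm]
  refine Finset.sum_congr rfl fun i _ => Finset.sum_congr rfl fun j _ => ?_
  simp only [gram, Matrix.of_apply]
  rw [hy]
  ring

theorem IsMetricAt.metricIn_nondeg [IsManifold (𝓡 n) ∞ M] (hg : IsMetricAt g x)
    (hx : x ∈ (chartAt (EuclideanSpace ℝ (Fin n)) c).source) {u : EuclideanSpace ℝ (Fin n)}
    (h : ∀ v, metricIn g c (extChartAt (𝓡 n) c x) u v = 0) : u = 0 := by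
  have h0 := hg.nondeg ((comps c x).inverse u) fun v => by
    rw [hg.bilin.self_of_nhds.eq_metricIn hx, (comps_isInvertible hx).self_apply_inverse]
    exact h _
  rw [← (comps_isInvertible hx).self_apply_inverse u, h0, map_zero]

/-- A row vector annihilated by the Gram matrix consists of the components of a vector orthogonal to
everything. -/
theorem IsMetricAt.isUnit_det_gram [IsManifold (𝓡 n) ∞ M] (hg : IsMetricAt g x)
    (hx : x ∈ (chartAt (EuclideanSpace ℝ (Fin n)) c).source) : IsUnit (gram g c x).det := by
  rw [isUnit_iff_ne_zero]
  intro h0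
  obtain ⟨v, hv, hv0⟩ := Matrix.exists_vecMul_eq_zero_iff.mpr h0
  refine hv ?_
  have : (WithLp.toLp 2 v : EuclideanSpace ℝ (Fin n)) = 0 := by
    refine hg.metricIn_nondeg hx fun w => ?_
    rw [metricIn_apply, Finset.sum_comm, (extChartAt (𝓡 n) c).left_inv (by rwa [extChartAt_source])]
    refine Finset.sum_eq_zero fun j _ => ?_
    have := congrFun hv0 j
    simp only [Matrix.vecMul, dotProduct, Pi.zero_apply] at this
    calc _ = (∑ i, v i * gram g c x i j) * w j := by
          rw [Finset.sum_mul]; exact Finset.sum_congr rfl fun i _ => by simp; ring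
      _ = 0 := by rw [this, zero_mul]
  simpa using congrArg (WithLp.ofLp) this

/-- Links the derivative of the coordinate metric as a map into bilinear forms with the scalar
partial derivatives that occur in the Christoffel symbols. -/
theorem fderiv_metricIn_apply (hx : x ∈ (chartAt (EuclideanSpace ℝ (Fin n)) c).source)
    (hg : IsMetricAt g x) (w u v : EuclideanSpace ℝ (Fin n)) :
    fderiv ℝ (metricIn g c) (extChartAt (𝓡 n) c x) w u v
      = ∑ m, ∑ i, ∑ j, partialDeriv c m (fun z => gram g c z i j) x * (w m * u i * v j) := by
  have hw : w = ∑ m, w m • (EuclideanSpace.single m 1 : EuclideanSpace ℝ (Fin n)) := by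
    ext b; simp [Pi.single_apply]
  have h1 := fderiv_bilin_comp (c := id) (u := fun _ => u) (v := fun _ => v) (w := w)
    (hg.differentiableAt hx) differentiableAt_id (differentiableAt_const u)
    (differentiableAt_const v)
  simp only [id_eq, fderiv_id, fderiv_fun_const, ContinuousLinearMap.id_apply, Pi.zero_apply,
    zero_apply, map_zero, add_zero] at h1
  have h2 : HasFDerivAt (fun y => metricIn g c y u v) (∑ i, ∑ j, (u i * v j) •
      fderiv ℝ (fun y => gram g c ((extChartAt (𝓡 n) c).symm y) i j) (extChartAt (𝓡 n) c x))
      (extChartAt (𝓡 n) c x) := by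
    simp only [metricIn_apply]
    exact HasFDerivAt.fun_sum fun i _ => HasFDerivAt.fun_sum fun j _ =>
      ((hg.smooth c hx i j).differentiableAt one_ne_zero).hasFDerivAt.mul_const (u i * v j)
  rw [← h1, h2.fderiv]
  simp only [sum_apply, smul_apply, smul_eq_mul, partialDeriv]
  rw [eq_comm, Finset.sum_comm]
  refine Finset.sum_congr rfl fun i _ => ?_
  rw [Finset.sum_comm]
  refine Finset.sum_congr rfl fun j _ => ?_
  conv_rhs => rw [hw, map_sum, Finset.mul_sum]
  refine Finset.sum_congr rfl fun m _ => ?_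
  rw [map_smul, smul_eq_mul]
  ring

end

/-- The vector with components `Γ^a_{m b} u^m v^b`. -/
def christoffelVec (g : FormField n M) (c x : M) (u v : EuclideanSpace ℝ (Fin n)) :
    EuclideanSpace ℝ (Fin n) :=
  WithLp.toLp 2 fun a => ∑ m, ∑ b, christoffel g c x a m b * (u m * v b)

/-- Lowering the upper index cancels the inverse Gram matrix in the definition of the Christoffel
symbols. -/
theorem gram_mul_christoffel [IsManifold (𝓡 n) ∞ M] {g : FormField n M} {c x : M}
    (hx : x ∈ (chartAt (EuclideanSpace ℝ (Fin n)) c).source) (hg : IsMetricAt g x)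
    (e m b : Fin n) :
    2 * ∑ a, gram g c x a e * christoffel g c x a m b
      = partialDeriv c m (fun z => gram g c z e b) x
      + partialDeriv c b (fun z => gram g c z e m) x
      - partialDeriv c e (fun z => gram g c z m b) x := by
  have hsym : ∀ a, gram g c x a e = gram g c x e a := fun a => hg.symm.self_of_nhds _ _
  set T : Fin n → ℝ := fun d => partialDeriv c m (fun z => gram g c z d b) x
      + partialDeriv c b (fun z => gram g c z d m) x
      - partialDeriv c d (fun z => gram g c z m b) x with hT
  have h : (gram g c x).mulVec ((gram g c x)⁻¹.mulVec T) e = T e := by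
    rw [Matrix.mulVec_mulVec, Matrix.mul_nonsing_inv _ (hg.isUnit_det_gram hx), Matrix.one_mulVec]
  change _ = T e
  rw [← h, Matrix.mulVec, dotProduct, Finset.mul_sum]
  refine Finset.sum_congr rfl fun a _ => ?_
  rw [christoffel, hsym, Matrix.mulVec, dotProduct]
  ring

/-- This form of the Christoffel symbols contains no inverse matrix and, by nondegeneracy,
determines them. The transformation law and metric compatibility are both read off from it. -/
theorem koszul [IsManifold (𝓡 n) ∞ M] {g : FormField n M} {c x : M}
    (hx : x ∈ (chartAt (EuclideanSpace ℝ (Fin n)) c).source) (hg : IsMetricAt g x)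
    (u v w : EuclideanSpace ℝ (Fin n)) :
    2 * metricIn g c (extChartAt (𝓡 n) c x) (christoffelVec g c x u v) w
      = fderiv ℝ (metricIn g c) (extChartAt (𝓡 n) c x) u w v
        + fderiv ℝ (metricIn g c) (extChartAt (𝓡 n) c x) v w u
        - fderiv ℝ (metricIn g c) (extChartAt (𝓡 n) c x) w u v := by
  simp only [fderiv_metricIn_apply hx hg, metricIn_apply,
    (extChartAt (𝓡 n) c).left_inv (show x ∈ (extChartAt (𝓡 n) c).source by rwa [extChartAt_source])]
  -- The sums are reordered until the contracted index `a` is innermost, so that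
  -- `gram_mul_christoffel` applies.
  have h1 : 2 * ∑ a, ∑ e, gram g c x a e * (christoffelVec g c x u v a * w e)
      = ∑ m, ∑ b, ∑ e, (2 * ∑ a, gram g c x a e * christoffel g c x a m b) * (u m * v b * w e) := by
    simp only [christoffelVec, Finset.mul_sum, Finset.sum_mul]
    calc _ = ∑ e, ∑ a, ∑ m, ∑ b,
          2 * (gram g c x a e * (christoffel g c x a m b * (u m * v b) * w e)) := Finset.sum_comm
      _ = ∑ e, ∑ m, ∑ a, ∑ b,
          2 * (gram g c x a e * (christoffel g c x a m b * (u m * v b) * w e)) :=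
        Finset.sum_congr rfl fun e _ => Finset.sum_comm
      _ = ∑ m, ∑ e, ∑ a, ∑ b,
          2 * (gram g c x a e * (christoffel g c x a m b * (u m * v b) * w e)) := Finset.sum_comm
      _ = ∑ m, ∑ e, ∑ b, ∑ a,
          2 * (gram g c x a e * (christoffel g c x a m b * (u m * v b) * w e)) :=
        Finset.sum_congr rfl fun m _ => Finset.sum_congr rfl fun e _ => Finset.sum_comm
      _ = ∑ m, ∑ b, ∑ e, ∑ a,
          2 * (gram g c x a e * (christoffel g c x a m b * (u m * v b) * w e)) :=
        Finset.sum_congr rfl fun m _ => Finset.sum_comm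
      _ = _ := Finset.sum_congr rfl fun m _ => Finset.sum_congr rfl fun b _ =>
        Finset.sum_congr rfl fun e _ => Finset.sum_congr rfl fun a _ => by ring
  rw [h1]
  simp only [gram_mul_christoffel hx hg, add_mul, sub_mul, Finset.sum_add_distrib,
    Finset.sum_sub_distrib]
  refine congrArg₂ (· - ·) (congrArg₂ (· + ·) ?_ ?_) ?_
  · refine Finset.sum_congr rfl fun m _ => ?_
    rw [Finset.sum_comm]
    exact Finset.sum_congr rfl fun e _ => Finset.sum_congr rfl fun b _ => by ring
  · rw [Finset.sum_comm]
    refine Finset.sum_congr rfl fun b _ => ?_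
    rw [Finset.sum_comm]
    exact Finset.sum_congr rfl fun e _ => Finset.sum_congr rfl fun m _ => by ring
  · calc ∑ m, ∑ b, ∑ e, partialDeriv c e (fun z => gram g c z m b) x * (u m * v b * w e)
        = ∑ m, ∑ e, ∑ b,
          partialDeriv c e (fun z => gram g c z m b) x * (u m * v b * w e) :=
        Finset.sum_congr rfl fun m _ => Finset.sum_comm
      _ = ∑ e, ∑ m, ∑ b,
          partialDeriv c e (fun z => gram g c z m b) x * (u m * v b * w e) := Finset.sum_comm
      _ = _ := Finset.sum_congr rfl fun e _ => Finset.sum_congr rfl fun m _ =>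
        Finset.sum_congr rfl fun b _ => by ring

end MetricInCoordinates

/-! ### Maps between manifolds in charts -/

section LocalRepresentatives

variable {k n : ℕ} {S : Type*} [TopologicalSpace S] [ChartedSpace (EuclideanSpace ℝ (Fin k)) S]
  {M : Type*} [TopologicalSpace M] [ChartedSpace (EuclideanSpace ℝ (Fin n)) M]
  {V : Type*} [NormedAddCommGroup V] [NormedSpace ℝ V]

/-- The map `F` in the charts centred at `s` and `c`. -/
def localRep (s : S) (c : M) (F : S → M) (y : EuclideanSpace ℝ (Fin k)) :
    EuclideanSpace ℝ (Fin n) :=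
  extChartAt (𝓡 n) c (F ((extChartAt (𝓡 k) s).symm y))

theorem localRep_apply {s p : S} (hp : p ∈ (chartAt (EuclideanSpace ℝ (Fin k)) s).source)
    (c : M) (F : S → M) :
    localRep s c F (extChartAt (𝓡 k) s p) = extChartAt (𝓡 n) c (F p) := by
  rw [localRep, (extChartAt (𝓡 k) s).left_inv (by rwa [extChartAt_source])]

theorem contDiffAt_comp_extChartAt_symm [IsManifold (𝓡 k) ∞ S] {m : WithTop ℕ∞} (hm : m ≤ ∞)
    {f : S → V} {s p : S}
    (hp : p ∈ (chartAt (EuclideanSpace ℝ (Fin k)) s).source)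
    (hf : ContMDiffAt (𝓡 k) 𝓘(ℝ, V) m f p) :
    ContDiffAt ℝ m (fun y => f ((extChartAt (𝓡 k) s).symm y)) (extChartAt (𝓡 k) s p) := by
  have hp' : p ∈ (extChartAt (𝓡 k) s).source := by rwa [extChartAt_source]
  rw [← contMDiffAt_iff_contDiffAt]
  have h := (contMDiffOn_extChartAt_symm (I := 𝓡 k) (n := ∞) s).contMDiffAt
    ((isOpen_extChartAt_target s).mem_nhds ((extChartAt (𝓡 k) s).map_source hp'))
  refine ContMDiffAt.comp (g := f) (extChartAt (𝓡 k) s p) ?_ (h.of_le hm)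
  rwa [(extChartAt (𝓡 k) s).left_inv hp']

theorem contMDiffAt_extChartAt_comp [IsManifold (𝓡 n) ∞ M] {m : WithTop ℕ∞} (hm : m ≤ ∞)
    {F : S → M} {p : S} {c : M} (hF : ContMDiffAt (𝓡 k) (𝓡 n) m F p)
    (hc : F p ∈ (chartAt (EuclideanSpace ℝ (Fin n)) c).source) :
    ContMDiffAt (𝓡 k) 𝓘(ℝ, EuclideanSpace ℝ (Fin n)) m (fun q => extChartAt (𝓡 n) c (F q)) p :=
  ((contMDiffAt_extChartAt' (n := ∞) hc).of_le hm).comp p hF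

theorem contDiffAt_localRep [IsManifold (𝓡 k) ∞ S] [IsManifold (𝓡 n) ∞ M]
    {F : S → M} {s p : S} {c : M} (hF : ContMDiffAt (𝓡 k) (𝓡 n) ∞ F p)
    (hp : p ∈ (chartAt (EuclideanSpace ℝ (Fin k)) s).source)
    (hc : F p ∈ (chartAt (EuclideanSpace ℝ (Fin n)) c).source) :
    ContDiffAt ℝ ∞ (localRep (k := k) (n := n) s c F) (extChartAt (𝓡 k) s p) :=
  contDiffAt_comp_extChartAt_symm le_rfl hp (contMDiffAt_extChartAt_comp le_rfl hF hc)

theorem comps_mfderiv_eq_fderiv_localRep [IsManifold (𝓡 k) ∞ S] [IsManifold (𝓡 n) ∞ M]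
    {F : S → M} {s p : S} {c : M} (hF : MDifferentiableAt (𝓡 k) (𝓡 n) F p)
    (hp : p ∈ (chartAt (EuclideanSpace ℝ (Fin k)) s).source)
    (hc : F p ∈ (chartAt (EuclideanSpace ℝ (Fin n)) c).source) (v : TangentSpace (𝓡 k) p) :
    comps c (F p) (mfderiv (𝓡 k) (𝓡 n) F p v)
      = fderiv ℝ (localRep s c F) (extChartAt (𝓡 k) s p) (comps s p v) := by
  rw [comps_mfderiv hF hc]
  exact mvfderiv_eq_fderiv ((mdifferentiableAt_extChartAt hc).comp p hF) hp v

theorem eventually_mem_chart_source {F : S → M} {p : S} {c : M} (hF : ContinuousAt F p)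
    (hc : F p ∈ (chartAt (EuclideanSpace ℝ (Fin n)) c).source) :
    ∀ᶠ q in 𝓝 p, F q ∈ (chartAt (EuclideanSpace ℝ (Fin n)) c).source :=
  hF.eventually_mem ((chartAt (EuclideanSpace ℝ (Fin n)) c).open_source.mem_nhds hc)

theorem eventually_mdifferentiableAt [IsManifold (𝓡 k) ∞ S] [IsManifold (𝓡 n) ∞ M]
    {F : S → M} {p : S} (hF : ContMDiffAt (𝓡 k) (𝓡 n) ∞ F p) :
    ∀ᶠ q in 𝓝 p, MDifferentiableAt (𝓡 k) (𝓡 n) F q := by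
  have h1 : ContMDiffAt (𝓡 k) (𝓡 n) 1 F p := hF.of_le (by exact_mod_cast le_top)
  filter_upwards [contMDiffAt_iff_contMDiffAt_nhds (by simp) |>.mp h1] with q hq
  exact hq.mdifferentiableAt one_ne_zero

theorem eventually_comps_mfderiv [IsManifold (𝓡 k) ∞ S] [IsManifold (𝓡 n) ∞ M]
    {F : S → M} {s p : S} {c : M} (hF : ContMDiffAt (𝓡 k) (𝓡 n) ∞ F p)
    (hp : p ∈ (chartAt (EuclideanSpace ℝ (Fin k)) s).source)
    (hc : F p ∈ (chartAt (EuclideanSpace ℝ (Fin n)) c).source) :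
    ∀ᶠ q in 𝓝 p, ∀ v, comps c (F q) (mfderiv (𝓡 k) (𝓡 n) F q v)
      = fderiv ℝ (localRep s c F) (extChartAt (𝓡 k) s q) (comps s q v) := by
  filter_upwards [eventually_mdifferentiableAt hF, eventually_mem_chart_source hF.continuousAt hc,
    (chartAt (EuclideanSpace ℝ (Fin k)) s).open_source.mem_nhds hp] with q h1 h2 h3 v
  exact comps_mfderiv_eq_fderiv_localRep h1 h3 h2 v

end LocalRepresentatives

/-! ### The pulled-back metric -/

section Pullback

variable {k n : ℕ} {M : Type*} [TopologicalSpace M] [ChartedSpace (EuclideanSpace ℝ (Fin k)) M]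
  {M' : Type*} [TopologicalSpace M'] [ChartedSpace (EuclideanSpace ℝ (Fin n)) M']
  {g : FormField n M'} {φ : M → M'} {c x : M} {c' : M'}

theorem surjective_of_injective_euclidean
    {A : EuclideanSpace ℝ (Fin n) →L[ℝ] EuclideanSpace ℝ (Fin n)} (hA : Function.Injective A) :
    Function.Surjective A :=
  (LinearMap.injective_iff_surjective (f := A.toLinearMap)).mp hA

theorem IsBilinAt.pullback (hg : IsBilinAt g (φ x)) : IsBilinAt (pullback (k := k) φ g) x := by
  obtain ⟨B, hB⟩ := hg
  exact ⟨B.compl₁₂ (mfderiv (𝓡 k) (𝓡 n) φ x).toLinearMap (mfderiv (𝓡 k) (𝓡 n) φ x).toLinearMap,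
    fun u v => hB _ _⟩

variable [IsManifold (𝓡 k) ∞ M] [IsManifold (𝓡 n) ∞ M']

/-- With ψ the map φ in charts, (φ^*g)(u, v) is g at ψ applied to Dψ u and Dψ v. The identity is
needed on a neighbourhood because it gets differentiated. -/
theorem eventually_metricIn_pullback (hφ : ContMDiffAt (𝓡 k) (𝓡 n) ∞ φ x)
    (hg : ∀ᶠ z in 𝓝 (φ x), IsBilinAt g z)
    (hx : x ∈ (chartAt (EuclideanSpace ℝ (Fin k)) c).source)
    (hc : φ x ∈ (chartAt (EuclideanSpace ℝ (Fin n)) c').source) :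
    ∀ᶠ y in 𝓝 (extChartAt (𝓡 k) c x), ∀ u v, metricIn (pullback (k := k) φ g) c y u v
      = metricIn g c' (localRep c c' φ y) (fderiv ℝ (localRep c c' φ) y u)
          (fderiv ℝ (localRep c c' φ) y v) := by
  have h : ∀ᶠ z in 𝓝 x, ∀ u v, metricIn (CNT.pullback (k := k) φ g) c (extChartAt (𝓡 k) c z) u v
      = metricIn g c' (extChartAt (𝓡 n) c' (φ z))
        (fderiv ℝ (localRep c c' φ) (extChartAt (𝓡 k) c z) u)
          (fderiv ℝ (localRep c c' φ) (extChartAt (𝓡 k) c z) v) := by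
    filter_upwards [hφ.continuousAt.eventually hg, eventually_comps_mfderiv hφ hx hc,
      eventually_mem_chart_source hφ.continuousAt hc,
      (chartAt (EuclideanSpace ℝ (Fin k)) c).open_source.mem_nhds hx] with z h1 h2 h3 h4 u v
    obtain ⟨u, rfl⟩ := (comps_isInvertible h4).surjective u
    obtain ⟨v, rfl⟩ := (comps_isInvertible h4).surjective v
    rw [← h1.pullback.eq_metricIn h4, ← h2, ← h2, ← h1.eq_metricIn h3]
    rfl
  have hx' : x ∈ (extChartAt (𝓡 k) c).source := by rwa [extChartAt_source]
  filter_upwards [(tendsto_extChartAt_symm hx).eventually h,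
    (isOpen_extChartAt_target c).mem_nhds ((extChartAt (𝓡 k) c).map_source hx')] with y hy hy2
  rwa [(extChartAt (𝓡 k) c).right_inv hy2] at hy

theorem contDiffAt_metricIn_pullback (hφ : ContMDiffAt (𝓡 k) (𝓡 n) ∞ φ x)
    (hg : IsMetricAt g (φ x))
    (hx : x ∈ (chartAt (EuclideanSpace ℝ (Fin k)) c).source) (u v : EuclideanSpace ℝ (Fin k)) :
    ContDiffAt ℝ 1 (fun y => metricIn (pullback (k := k) φ g) c y u v) (extChartAt (𝓡 k) c x) := by
  have hc := mem_chart_source (EuclideanSpace ℝ (Fin n)) (φ x)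
  have hψ := contDiffAt_localRep hφ hx hc
  have h1 : ContDiffAt ℝ 1 (fun y => metricIn g (φ x) (localRep c (φ x) φ y)
      (fderiv ℝ (localRep c (φ x) φ) y u) (fderiv ℝ (localRep c (φ x) φ) y v))
      (extChartAt (𝓡 k) c x) := by
    have hd : ContDiffAt ℝ 1 (fderiv ℝ (localRep c (φ x) φ)) (extChartAt (𝓡 k) c x) :=
      hψ.fderiv_right (by norm_cast)
    have hm : ContDiffAt ℝ 1 (metricIn g (φ x)) (localRep c (φ x) φ (extChartAt (𝓡 k) c x)) := by
      rw [localRep_apply hx]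
      exact hg.contDiffAt hc
    exact ((ContDiffAt.comp (g := metricIn g (φ x)) _ hm (hψ.of_le (by exact_mod_cast le_top))).clm_apply
      (hd.clm_apply contDiffAt_const)).clm_apply (hd.clm_apply contDiffAt_const)
  refine h1.congr_of_eventuallyEq ?_
  filter_upwards [eventually_metricIn_pullback hφ hg.bilin hx hc] with y hy
  rw [hy]

/-- In equal dimensions an injective differential is bijective, so nondegeneracy is inherited. The
conclusion is local because a reference is controlled only near the surface. -/
theorem IsMetricAt.pullback {M : Type*} [TopologicalSpace M]
    [ChartedSpace (EuclideanSpace ℝ (Fin n)) M] [IsManifold (𝓡 n) ∞ M] {φ : M → M'} {x : M}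
    (hg : IsMetricAt g (φ x)) (hφ : ContMDiffAt (𝓡 n) (𝓡 n) ∞ φ x)
    (hinj : Function.Injective (mfderiv (𝓡 n) (𝓡 n) φ x)) :
    IsMetricAt (pullback (k := n) φ g) x where
  bilin := (hφ.continuousAt.eventually hg.bilin).mono fun _ h => h.pullback
  symm := (hφ.continuousAt.eventually hg.symm).mono fun _ h u v => h _ _
  nondeg u hu := by
    have hsurj : Function.Surjective (mfderiv (𝓡 n) (𝓡 n) φ x) :=
      surjective_of_injective_euclidean hinj
    have h0 := hg.nondeg (mfderiv (𝓡 n) (𝓡 n) φ x u) fun v => by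
      obtain ⟨v, rfl⟩ := hsurj v
      exact hu v
    exact hinj (by rw [h0, map_zero])
  smooth c hx i j := by
    simp only [← metricIn_single]
    exact contDiffAt_metricIn_pullback hφ hg hx _ _

end Pullback

/-! ### Transformation law of the Christoffel symbols -/

section ChristoffelTransformation

variable {n : ℕ} {M : Type*} [TopologicalSpace M] [ChartedSpace (EuclideanSpace ℝ (Fin n)) M]
  [IsManifold (𝓡 n) ∞ M]
  {M' : Type*} [TopologicalSpace M'] [ChartedSpace (EuclideanSpace ℝ (Fin n)) M']
  [IsManifold (𝓡 n) ∞ M'] {g : FormField n M'} {φ : M → M'} {c x : M} {c' : M'}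

theorem fderiv_metricIn_pullback (hφ : ContMDiffAt (𝓡 n) (𝓡 n) ∞ φ x)
    (hinj : Function.Injective (mfderiv (𝓡 n) (𝓡 n) φ x))
    (hg : IsMetricAt g (φ x))
    (hx : x ∈ (chartAt (EuclideanSpace ℝ (Fin n)) c).source)
    (hc : φ x ∈ (chartAt (EuclideanSpace ℝ (Fin n)) c').source)
    (w u v : EuclideanSpace ℝ (Fin n)) :
    fderiv ℝ (metricIn (pullback (k := n) φ g) c) (extChartAt (𝓡 n) c x) w u v
      = fderiv ℝ (metricIn g c') (extChartAt (𝓡 n) c' (φ x))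
          (fderiv ℝ (localRep c c' φ) (extChartAt (𝓡 n) c x) w)
          (fderiv ℝ (localRep c c' φ) (extChartAt (𝓡 n) c x) u)
          (fderiv ℝ (localRep c c' φ) (extChartAt (𝓡 n) c x) v)
        + metricIn g c' (extChartAt (𝓡 n) c' (φ x))
          (fderiv ℝ (fderiv ℝ (localRep c c' φ)) (extChartAt (𝓡 n) c x) w u)
          (fderiv ℝ (localRep c c' φ) (extChartAt (𝓡 n) c x) v)
        + metricIn g c' (extChartAt (𝓡 n) c' (φ x))
          (fderiv ℝ (localRep c c' φ) (extChartAt (𝓡 n) c x) u)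
          (fderiv ℝ (fderiv ℝ (localRep c c' φ)) (extChartAt (𝓡 n) c x) w v) := by
  have hψ := contDiffAt_localRep hφ hx hc
  have hd : DifferentiableAt ℝ (fderiv ℝ (localRep c c' φ)) (extChartAt (𝓡 n) c x) :=
    (hψ.fderiv_right (m := 1) (by norm_cast)).differentiableAt one_ne_zero
  have hψ1 : DifferentiableAt ℝ (localRep c c' φ) (extChartAt (𝓡 n) c x) :=
    hψ.differentiableAt (by simp)
  have hm := hg.differentiableAt hc
  rw [← localRep_apply hx c' φ] at hm ⊢
  have h1 := fderiv_bilin_comp (c := id) (u := fun _ => u) (v := fun _ => v) (w := w)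
    ((hg.pullback hφ hinj).differentiableAt hx) differentiableAt_id (differentiableAt_const u)
    (differentiableAt_const v)
  simp only [id_eq, fderiv_id, fderiv_fun_const, ContinuousLinearMap.id_apply, Pi.zero_apply,
    zero_apply, map_zero, add_zero] at h1
  have h2 : ∀ u, fderiv ℝ (fun y => fderiv ℝ (localRep c c' φ) y u) (extChartAt (𝓡 n) c x) w
      = fderiv ℝ (fderiv ℝ (localRep c c' φ)) (extChartAt (𝓡 n) c x) w u := fun u => by
    have := fderiv_clm_comp (c := id) (u := fun _ => u) (w := w) hd differentiableAt_id
      (differentiableAt_const u)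
    simpa using this
  have h3 : (fun y => metricIn (pullback (k := n) φ g) c y u v) =ᶠ[𝓝 (extChartAt (𝓡 n) c x)]
      fun y => metricIn g c' (localRep c c' φ y) (fderiv ℝ (localRep c c' φ) y u)
          (fderiv ℝ (localRep c c' φ) y v) :=
    (eventually_metricIn_pullback hφ hg.bilin hx hc).mono fun y hy => hy u v
  rw [← h1, h3.fderiv_eq, fderiv_bilin_comp hm hψ1 (hd.clm_apply (differentiableAt_const u))
    (hd.clm_apply (differentiableAt_const v)), h2, h2]

/-- Both sides are tested against Dψ w by the Koszul formula. Of the six terms with second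
derivatives of ψ, the four in which w is differentiated cancel by the symmetry of D²ψ, and the other
two give 2 g(D²ψ(u, v), Dψ w). -/
theorem christoffelVec_pullback (hφ : ContMDiffAt (𝓡 n) (𝓡 n) ∞ φ x)
    (hinj : Function.Injective (mfderiv (𝓡 n) (𝓡 n) φ x))
    (hg : IsMetricAt g (φ x))
    (hx : x ∈ (chartAt (EuclideanSpace ℝ (Fin n)) c).source)
    (hc : φ x ∈ (chartAt (EuclideanSpace ℝ (Fin n)) c').source)
    (u v : EuclideanSpace ℝ (Fin n)) :
    fderiv ℝ (localRep c c' φ) (extChartAt (𝓡 n) c x)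
        (christoffelVec (pullback (k := n) φ g) c x u v)
      = fderiv ℝ (fderiv ℝ (localRep c c' φ)) (extChartAt (𝓡 n) c x) u v
        + christoffelVec g c' (φ x)
          (fderiv ℝ (localRep c c' φ) (extChartAt (𝓡 n) c x) u)
          (fderiv ℝ (localRep c c' φ) (extChartAt (𝓡 n) c x) v) := by
  have hψ := contDiffAt_localRep hφ hx hc
  have hinj' : Function.Injective
      (fderiv ℝ (localRep (k := n) (n := n) c c' φ) (extChartAt (𝓡 n) c x)) := by
    intro a b hab
    obtain ⟨a, rfl⟩ := (comps_isInvertible hx).surjective a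
    obtain ⟨b, rfl⟩ := (comps_isInvertible hx).surjective b
    have hd := hφ.mdifferentiableAt (by simp)
    rw [← comps_mfderiv_eq_fderiv_localRep hd hx hc, ← comps_mfderiv_eq_fderiv_localRep hd hx hc]
      at hab
    rw [hinj ((comps_isInvertible hc).injective hab)]
  rw [← sub_eq_zero]
  -- By nondegeneracy it suffices to pair with every vector, and every vector has the form Dψ w.
  refine hg.metricIn_nondeg hc fun w => ?_
  obtain ⟨w, rfl⟩ := surjective_of_injective_euclidean hinj' w
  have hsym := (hg.metricIn_symm hc).self_of_nhds
  have hD : ∀ a b, fderiv ℝ (fderiv ℝ (localRep c c' φ)) (extChartAt (𝓡 n) c x) a b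
      = fderiv ℝ (fderiv ℝ (localRep c c' φ)) (extChartAt (𝓡 n) c x) b a :=
    (hψ.of_le (m := 2) (by norm_cast)).isSymmSndFDerivAt (by simp)
  have k1 := koszul hx (hg.pullback hφ hinj) u v w
  simp only [fderiv_metricIn_pullback hφ hinj hg hx hc] at k1
  have k2 := koszul hc hg (fderiv ℝ (localRep c c' φ) (extChartAt (𝓡 n) c x) u)
    (fderiv ℝ (localRep c c' φ) (extChartAt (𝓡 n) c x) v)
    (fderiv ℝ (localRep c c' φ) (extChartAt (𝓡 n) c x) w)
  rw [(eventually_metricIn_pullback hφ hg.bilin hx hc).self_of_nhds, localRep_apply hx] at k1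
  simp only [map_sub, map_add, sub_apply, add_apply]
  rw [hD w u, hD w v, hD v u,
    hsym (fderiv ℝ (localRep c c' φ) (extChartAt (𝓡 n) c x) w),
    hsym (fderiv ℝ (localRep c c' φ) (extChartAt (𝓡 n) c x) u)
      (fderiv ℝ (fderiv ℝ (localRep c c' φ)) (extChartAt (𝓡 n) c x) v w)] at k1
  linarith

end ChristoffelTransformation

/-! ### Covariant derivative along a map: naturality and chart independence -/

section CovariantDerivative

variable {k n : ℕ} {S : Type*} [TopologicalSpace S] [ChartedSpace (EuclideanSpace ℝ (Fin k)) S]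
  {M : Type*} [TopologicalSpace M] [ChartedSpace (EuclideanSpace ℝ (Fin n)) M]

/-- The vector field `Y` along `F` is of class `C¹` at `p`. -/
def IsC1Along (F : S → M) (Y : ∀ q : S, TangentSpace (𝓡 n) (F q)) (p : S) : Prop :=
  ∀ c, F p ∈ (chartAt (EuclideanSpace ℝ (Fin n)) c).source →
    ContMDiffAt (𝓡 k) 𝓘(ℝ, EuclideanSpace ℝ (Fin n)) 1 (fun q => comps c (F q) (Y q)) p

theorem IsC1Along.mdifferentiableAt {F : S → M} {Y : ∀ q : S, TangentSpace (𝓡 n) (F q)} {p : S}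
    (hY : IsC1Along (k := k) F Y p) {c : M}
    (hc : F p ∈ (chartAt (EuclideanSpace ℝ (Fin n)) c).source) :
    MDifferentiableAt (𝓡 k) 𝓘(ℝ, EuclideanSpace ℝ (Fin n)) (fun q => comps c (F q) (Y q)) p :=
  (hY c hc).mdifferentiableAt one_ne_zero

/-- The components in the chart centred at `c` of the covariant derivative along `F`. -/
def covIn (g : FormField n M) (c : M) (F : S → M) (Y : ∀ q : S, TangentSpace (𝓡 n) (F q)) (p : S)
    (v : TangentSpace (𝓡 k) p) : EuclideanSpace ℝ (Fin n) :=
  mvfderiv (𝓡 k) (fun q => comps c (F q) (Y q)) p v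
    + christoffelVec g c (F p) (comps c (F p) (mfderiv (𝓡 k) (𝓡 n) F p v)) (comps c (F p) (Y p))

theorem mvfderiv_component {f : S → EuclideanSpace ℝ (Fin n)} {p : S}
    (hf : MDifferentiableAt (𝓡 k) 𝓘(ℝ, EuclideanSpace ℝ (Fin n)) f p) (v : TangentSpace (𝓡 k) p)
    (a : Fin n) :
    mvfderiv (𝓡 k) (fun q => f q a) p v = mvfderiv (𝓡 k) f p v a := by
  have hL : MDifferentiableAt 𝓘(ℝ, EuclideanSpace ℝ (Fin n)) 𝓘(ℝ, ℝ)
      (EuclideanSpace.proj a : EuclideanSpace ℝ (Fin n) →L[ℝ] ℝ) (f p) :=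
    (EuclideanSpace.proj a : EuclideanSpace ℝ (Fin n) →L[ℝ] ℝ).differentiableAt.mdifferentiableAt
  have h := mfderiv_comp_apply p hL hf v
  rw [mfderiv_eq_fderiv, ContinuousLinearMap.fderiv] at h
  exact h

variable [IsManifold (𝓡 n) ∞ M]

theorem comps_covAlong_self (g : FormField n M) {F : S → M}
    {Y : ∀ q : S, TangentSpace (𝓡 n) (F q)} {p : S} (hY : IsC1Along (k := k) F Y p)
    (v : TangentSpace (𝓡 k) p) :
    comps (F p) (F p) (covAlong g F Y p v) = covIn g (F p) F Y p v := by
  have hx := mem_chart_source (EuclideanSpace ℝ (Fin n)) (F p)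
  have h1 := sum_comps_smul_coordFrame hx ((comps (F p) (F p)).inverse (covIn g (F p) F Y p v))
  rw [(comps_isInvertible hx).self_apply_inverse] at h1
  rw [← (comps_isInvertible hx).self_apply_inverse (covIn g (F p) F Y p v), ← h1]
  congr 1
  refine Finset.sum_congr rfl fun a _ => ?_
  rw [mvfderiv_component (hY.mdifferentiableAt hx)]
  congr 1
  simp only [covIn, PiLp.add_apply, christoffelVec, connForm, Finset.sum_mul]
  rw [Finset.sum_comm]
  refine congrArg _ (Finset.sum_congr rfl fun m _ => Finset.sum_congr rfl fun b _ => by ring)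

variable {M' : Type*} [TopologicalSpace M'] [ChartedSpace (EuclideanSpace ℝ (Fin n)) M']
  [IsManifold (𝓡 n) ∞ M']

theorem eventually_comps_mfderiv_along {φ : M → M'} {F : S → M} {p : S}
    (Y : ∀ q : S, TangentSpace (𝓡 n) (F q)) {c : M} {c' : M'}
    (hφ : ContMDiffAt (𝓡 n) (𝓡 n) ∞ φ (F p)) (hF : ContinuousAt F p)
    (hc : F p ∈ (chartAt (EuclideanSpace ℝ (Fin n)) c).source)
    (hc' : φ (F p) ∈ (chartAt (EuclideanSpace ℝ (Fin n)) c').source) :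
    (fun q => comps c' (φ (F q)) (mfderiv (𝓡 n) (𝓡 n) φ (F q) (Y q))) =ᶠ[𝓝 p]
      fun q => fderiv ℝ (localRep c c' φ) (extChartAt (𝓡 n) c (F q)) (comps c (F q) (Y q)) :=
  (hF.eventually (eventually_comps_mfderiv hφ hc hc')).mono fun q hq => hq (Y q)

theorem IsC1Along.mfderiv {φ : M → M'} {F : S → M} {p : S}
    {Y : ∀ q : S, TangentSpace (𝓡 n) (F q)} (hY : IsC1Along (k := k) F Y p)
    (hφ : ContMDiffAt (𝓡 n) (𝓡 n) ∞ φ (F p)) (hF : ContMDiffAt (𝓡 k) (𝓡 n) ∞ F p) :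
    IsC1Along (k := k) (fun q => φ (F q)) (fun q => mfderiv (𝓡 n) (𝓡 n) φ (F q) (Y q)) p := by
  intro c' hc'
  have hc := mem_chart_source (EuclideanSpace ℝ (Fin n)) (F p)
  refine ContMDiffAt.congr_of_eventuallyEq ?_
    (eventually_comps_mfderiv_along Y hφ hF.continuousAt hc hc')
  have h1 : ContDiffAt ℝ 1 (fderiv ℝ (localRep (F p) c' φ)) (extChartAt (𝓡 n) (F p) (F p)) :=
    (contDiffAt_localRep hφ hc hc').fderiv_right (by norm_cast)
  exact (h1.contMDiffAt.comp p ((contMDiffAt_extChartAt_comp le_rfl hF hc).of_le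
    (by exact_mod_cast le_top))).clm_apply (hY _ hc)

variable [IsManifold (𝓡 k) ∞ S]

/-- Differentiating Dψ(Y) along F produces a term D²ψ(dF v, Y); the transformation law of the
Christoffel symbols contains the same term with the opposite sign. -/
theorem covIn_pullback {φ : M → M'} {F : S → M} {p : S} {g : FormField n M'}
    {Y : ∀ q : S, TangentSpace (𝓡 n) (F q)} (hY : IsC1Along (k := k) F Y p)
    (hφ : ContMDiffAt (𝓡 n) (𝓡 n) ∞ φ (F p)) (hF : ContMDiffAt (𝓡 k) (𝓡 n) ∞ F p)
    (hinj : Function.Injective (mfderiv (𝓡 n) (𝓡 n) φ (F p)))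
    (hg : IsMetricAt g (φ (F p))) {c : M} {c' : M'}
    (hc : F p ∈ (chartAt (EuclideanSpace ℝ (Fin n)) c).source)
    (hc' : φ (F p) ∈ (chartAt (EuclideanSpace ℝ (Fin n)) c').source) (v : TangentSpace (𝓡 k) p) :
    covIn g c' (fun q => φ (F q)) (fun q => mfderiv (𝓡 n) (𝓡 n) φ (F q) (Y q)) p v
      = fderiv ℝ (localRep c c' φ) (extChartAt (𝓡 n) c (F p))
          (covIn (pullback (k := n) φ g) c F Y p v) := by
  have hp := mem_chart_source (EuclideanSpace ℝ (Fin k)) p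
  have hFd := hF.mdifferentiableAt (by simp)
  have hφd := hφ.mdifferentiableAt (by simp)
  have h0 := eventually_comps_mfderiv_along Y hφ hF.continuousAt hc hc'
  have h1 : ContDiffAt ℝ 1 (fderiv ℝ (localRep c c' φ)) (extChartAt (𝓡 n) c (F p)) :=
    (contDiffAt_localRep hφ hc hc').fderiv_right (by norm_cast)
  have h2 := contMDiffAt_extChartAt_comp le_rfl hF hc
  have h3 : ContMDiffAt (𝓡 k) 𝓘(ℝ, EuclideanSpace ℝ (Fin n)) 1 (fun q =>
      fderiv ℝ (localRep c c' φ) (extChartAt (𝓡 n) c (F q)) (comps c (F q) (Y q))) p :=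
    (h1.contMDiffAt.comp p (h2.of_le (by exact_mod_cast le_top))).clm_apply (hY _ hc)
  have h4 : mvfderiv (𝓡 k) (fun q => comps c' (φ (F q)) (mfderiv (𝓡 n) (𝓡 n) φ (F q) (Y q))) p v
      = mvfderiv (𝓡 k) (fun q =>
      fderiv ℝ (localRep c c' φ) (extChartAt (𝓡 n) c (F q)) (comps c (F q) (Y q))) p v :=
    congrArg (fun L : TangentSpace (𝓡 k) p →L[ℝ] EuclideanSpace ℝ (Fin n) => L v) h0.mfderiv_eq
  have hl := (extChartAt (𝓡 k) p).left_inv (mem_extChartAt_source (I := 𝓡 k) p)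
  have e1 := (contDiffAt_comp_extChartAt_symm le_rfl hp h2).differentiableAt (by simp)
  have e2 := (contDiffAt_comp_extChartAt_symm (by exact_mod_cast le_top) hp
    (hY _ hc)).differentiableAt one_ne_zero
  have h5 : mvfderiv (𝓡 k) (fun q =>
      fderiv ℝ (localRep (k := n) (n := n) c c' φ) (extChartAt (𝓡 n) c (F q)) (comps c (F q) (Y q))) p v
      = fderiv ℝ (fderiv ℝ (localRep (k := n) (n := n) c c' φ)) (extChartAt (𝓡 n) c (F p))
          (comps c (F p) (mfderiv (𝓡 k) (𝓡 n) F p v)) (comps c (F p) (Y p))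
        + fderiv ℝ (localRep c c' φ) (extChartAt (𝓡 n) c (F p))
          (mvfderiv (𝓡 k) (fun q => comps c (F q) (Y q)) p v) := by
    rw [mvfderiv_eq_fderiv (h3.mdifferentiableAt one_ne_zero) hp, comps_mfderiv hFd hc,
      mvfderiv_eq_fderiv (h2.mdifferentiableAt (by simp)) hp,
      mvfderiv_eq_fderiv (hY.mdifferentiableAt hc) hp]
    have := fderiv_clm_comp (f := fderiv ℝ (localRep (k := n) (n := n) c c' φ)) (w := comps p p v)
      (by rw [hl]; exact h1.differentiableAt one_ne_zero) e1 e2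
    rw [this, hl]
  have h6 : mfderiv (𝓡 k) (𝓡 n) (fun q => φ (F q)) p v
      = mfderiv (𝓡 n) (𝓡 n) φ (F p) (mfderiv (𝓡 k) (𝓡 n) F p v) :=
    mfderiv_comp_apply p hφd hFd v
  rw [covIn, h4, h5, h6, covIn, map_add, comps_mfderiv_eq_fderiv_localRep hφd hc hc',
    comps_mfderiv_eq_fderiv_localRep hφd hc hc', christoffelVec_pullback hφ hinj hg hc hc']
  abel

/-- Naturality of the Levi-Civita connection. It allows the reference geometry to be studied on M
itself, as a second metric φ^*g on the same manifold. -/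
theorem covAlong_pullback {φ : M → M'} {F : S → M} {p : S} {g : FormField n M'}
    {Y : ∀ q : S, TangentSpace (𝓡 n) (F q)} (hY : IsC1Along (k := k) F Y p)
    (hφ : ContMDiffAt (𝓡 n) (𝓡 n) ∞ φ (F p)) (hF : ContMDiffAt (𝓡 k) (𝓡 n) ∞ F p)
    (hinj : Function.Injective (mfderiv (𝓡 n) (𝓡 n) φ (F p)))
    (hg : IsMetricAt g (φ (F p))) (v : TangentSpace (𝓡 k) p) :
    covAlong g (fun q => φ (F q)) (fun q => mfderiv (𝓡 n) (𝓡 n) φ (F q) (Y q)) p v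
      = mfderiv (𝓡 n) (𝓡 n) φ (F p) (covAlong (pullback (k := n) φ g) F Y p v) := by
  have hc := mem_chart_source (EuclideanSpace ℝ (Fin n)) (F p)
  have hc' := mem_chart_source (EuclideanSpace ℝ (Fin n)) (φ (F p))
  refine (comps_isInvertible hc').injective ?_
  refine (comps_covAlong_self g (hY.mfderiv hφ hF) v).trans ?_
  rw [covIn_pullback hY hφ hF hinj hg hc hc',
    comps_mfderiv_eq_fderiv_localRep (hφ.mdifferentiableAt (by simp)) hc hc',
    comps_covAlong_self _ hY]

/-- Independence of the chart is naturality under the identity map, read in two different charts. It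
is needed because `covAlong` uses a chart that moves with the point. -/
theorem comps_covAlong {F : S → M} {p : S} {g : FormField n M}
    {Y : ∀ q : S, TangentSpace (𝓡 n) (F q)} (hY : IsC1Along (k := k) F Y p)
    (hF : ContMDiffAt (𝓡 k) (𝓡 n) ∞ F p) (hg : IsMetricAt g (F p)) {c : M}
    (hc : F p ∈ (chartAt (EuclideanSpace ℝ (Fin n)) c).source) (v : TangentSpace (𝓡 k) p) :
    comps c (F p) (covAlong g F Y p v) = covIn g c F Y p v := by
  have hx := mem_chart_source (EuclideanSpace ℝ (Fin n)) (F p)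
  have hid : ContMDiffAt (𝓡 n) (𝓡 n) ∞ (id : M → M) (F p) := contMDiffAt_id
  have hpull : pullback (k := n) (id : M → M) g = g := by
    funext x u v
    simp [pullback, mfderiv_id]
  have h1 := covIn_pullback (φ := id) (g := g) hY hid hF
    (by rw [mfderiv_id]; exact fun _ _ h => h) hg hx hc v
  have h2 := comps_mfderiv_eq_fderiv_localRep (F := (id : M → M)) (hid.mdifferentiableAt (by simp))
    hx hc (covAlong g F Y p v)
  rw [hpull, ← comps_covAlong_self g hY] at h1
  simp only [mfderiv_id] at h1 h2
  exact h2.trans h1.symm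

end CovariantDerivative

/-! ### Metric compatibility and the mean curvature -/

section MetricCompatibility

variable {k n : ℕ} {S : Type*} [TopologicalSpace S] [ChartedSpace (EuclideanSpace ℝ (Fin k)) S]
  {M : Type*} [TopologicalSpace M] [ChartedSpace (EuclideanSpace ℝ (Fin n)) M]
  [IsManifold (𝓡 n) ∞ M] {g : FormField n M}

/-- The sum of the Koszul formulas for (u, v, w) and (u, w, v): the derivatives along v and w
cancel. -/
theorem metricIn_christoffelVec_add {c x : M} (hg : IsMetricAt g x)
    (hx : x ∈ (chartAt (EuclideanSpace ℝ (Fin n)) c).source) (u v w : EuclideanSpace ℝ (Fin n)) :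
    metricIn g c (extChartAt (𝓡 n) c x) (christoffelVec g c x u v) w
      + metricIn g c (extChartAt (𝓡 n) c x) v (christoffelVec g c x u w)
      = fderiv ℝ (metricIn g c) (extChartAt (𝓡 n) c x) u v w := by
  have hs := hg.metricIn_symm hx
  -- Symmetry of the metric holds on a whole neighbourhood, so it passes to the derivative.
  have hD : ∀ a b d, fderiv ℝ (metricIn g c) (extChartAt (𝓡 n) c x) a b d
      = fderiv ℝ (metricIn g c) (extChartAt (𝓡 n) c x) a d b := by
    intro a b d
    have h1 : ∀ b d, fderiv ℝ (fun y => metricIn g c y b d) (extChartAt (𝓡 n) c x) a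
        = fderiv ℝ (metricIn g c) (extChartAt (𝓡 n) c x) a b d := fun b d => by
      have := fderiv_bilin_comp (c := id) (u := fun _ => b) (v := fun _ => d) (w := a)
        (hg.differentiableAt hx) differentiableAt_id (differentiableAt_const b)
        (differentiableAt_const d)
      simpa using this
    rw [← h1, ← h1]
    have h2 : (fun y => metricIn g c y b d) =ᶠ[𝓝 (extChartAt (𝓡 n) c x)]
        fun y => metricIn g c y d b := hs.mono fun y hy => hy b d
    rw [h2.fderiv_eq]
  have k1 := koszul hx hg u v w
  have k2 := koszul hx hg u w v
  rw [hs.self_of_nhds v]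
  rw [hD u w v, hD v w u] at k1
  rw [hD w v u] at k2
  linarith

variable {F : S → M} {p : S} {Y Z : ∀ q : S, TangentSpace (𝓡 n) (F q)}

variable [IsManifold (𝓡 k) ∞ S]

theorem covAlong_metric_compatible (hF : ContMDiffAt (𝓡 k) (𝓡 n) ∞ F p)
    (hg : IsMetricAt g (F p)) (hY : IsC1Along (k := k) F Y p) (hZ : IsC1Along (k := k) F Z p)
    (v : TangentSpace (𝓡 k) p) :
    g (F p) (covAlong g F Y p v) (Z p) + g (F p) (Y p) (covAlong g F Z p v)
      = mvfderiv (𝓡 k) (fun q => g (F q) (Y q) (Z q)) p v := by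
  have hp := mem_chart_source (EuclideanSpace ℝ (Fin k)) p
  have hc := mem_chart_source (EuclideanSpace ℝ (Fin n)) (F p)
  have hb := hg.bilin.self_of_nhds
  rw [hb.eq_metricIn hc, hb.eq_metricIn hc, comps_covAlong_self _ hY, comps_covAlong_self _ hZ]
  have h0 : (fun q => g (F q) (Y q) (Z q)) =ᶠ[𝓝 p] fun q => metricIn g (F p)
      (extChartAt (𝓡 n) (F p) (F q)) (comps (F p) (F q) (Y q)) (comps (F p) (F q) (Z q)) := by
    filter_upwards [hF.continuousAt.eventually hg.bilin,
      eventually_mem_chart_source hF.continuousAt hc] with q h1 h2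
    exact h1.eq_metricIn h2 _ _
  have h1 : mvfderiv (𝓡 k) (fun q => g (F q) (Y q) (Z q)) p v
      = mvfderiv (𝓡 k) (fun q => metricIn g (F p)
      (extChartAt (𝓡 n) (F p) (F q)) (comps (F p) (F q) (Y q)) (comps (F p) (F q) (Z q))) p v :=
    congrArg (fun L : TangentSpace (𝓡 k) p →L[ℝ] ℝ => L v) h0.mfderiv_eq
  have h2 := contMDiffAt_extChartAt_comp le_rfl hF hc
  have hl := (extChartAt (𝓡 k) p).left_inv (mem_extChartAt_source (I := 𝓡 k) p)
  have e1 := (contDiffAt_comp_extChartAt_symm le_rfl hp h2).differentiableAt (by simp)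
  have e2 := (contDiffAt_comp_extChartAt_symm (by exact_mod_cast le_top) hp
    (hY _ hc)).differentiableAt one_ne_zero
  have e3 := (contDiffAt_comp_extChartAt_symm (by exact_mod_cast le_top) hp
    (hZ _ hc)).differentiableAt one_ne_zero
  have h3 : ContMDiffAt (𝓡 k) 𝓘(ℝ, ℝ) 1 (fun q => metricIn g (F p)
      (extChartAt (𝓡 n) (F p) (F q)) (comps (F p) (F q) (Y q)) (comps (F p) (F q) (Z q))) p :=
    (((hg.contDiffAt hc).contMDiffAt.comp p (h2.of_le (by exact_mod_cast le_top))).clm_apply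
      (hY _ hc)).clm_apply (hZ _ hc)
  rw [h1, mvfderiv_eq_fderiv (h3.mdifferentiableAt one_ne_zero) hp]
  rw [fderiv_bilin_comp (f := metricIn g (F p)) (w := comps p p v)
    (by rw [hl]; exact hg.differentiableAt hc) e1 e2 e3, hl,
    ← mvfderiv_eq_fderiv (h2.mdifferentiableAt (by simp)) hp,
    ← mvfderiv_eq_fderiv (hY.mdifferentiableAt hc) hp,
    ← mvfderiv_eq_fderiv (hZ.mdifferentiableAt hc) hp,
    ← comps_mfderiv (hF.mdifferentiableAt (by simp)) hc,
    ← metricIn_christoffelVec_add hg hc, covIn, covIn, map_add, map_add, add_apply]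
  ring

theorem isC1Along_mfderiv_coordFrame {s : S} (hF : ContMDiffAt (𝓡 k) (𝓡 n) ∞ F p)
    (hp : p ∈ (chartAt (EuclideanSpace ℝ (Fin k)) s).source) (j : Fin k) :
    IsC1Along (k := k) F
      (fun q => mfderiv (𝓡 k) (𝓡 n) F q (coordFrame (n := k) s q j)) p := by
  intro c hc
  have h1 : ContDiffAt ℝ 1 (fderiv ℝ (localRep (k := k) (n := n) s c F)) (extChartAt (𝓡 k) s p) :=
    (contDiffAt_localRep hF hp hc).fderiv_right (by norm_cast)
  have h2 : ContMDiffAt (𝓡 k) 𝓘(ℝ, EuclideanSpace ℝ (Fin k)) 1 (extChartAt (𝓡 k) s) p :=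
    (contMDiffAt_extChartAt' (n := ∞) hp).of_le (by exact_mod_cast le_top)
  have h3 : ContMDiffAt (𝓡 k) 𝓘(ℝ, EuclideanSpace ℝ (Fin n)) 1
      (fun q => fderiv ℝ (localRep (k := k) (n := n) s c F) (extChartAt (𝓡 k) s q)
        (EuclideanSpace.single j 1)) p :=
    (h1.contMDiffAt.comp p h2).clm_apply contMDiffAt_const
  refine h3.congr_of_eventuallyEq ?_
  filter_upwards [eventually_comps_mfderiv hF hp hc,
    (chartAt (EuclideanSpace ℝ (Fin k)) s).open_source.mem_nhds hp] with q h1 h2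
  rw [h1, comps_coordFrame h2]

/-- Differentiating g(Y, dF ∂_j) = 0 along ∂_i moves the derivative from dF ∂_j to Y. The projection
in the second fundamental form does not matter, since it removes a tangential vector and Y is
normal. -/
theorem meanCurvature_eq_of_normal (hF : ContMDiffAt (𝓡 k) (𝓡 n) ∞ F p)
    (hg : IsMetricAt g (F p)) (hY : IsC1Along (k := k) F Y p)
    (hn : ∀ q v, g (F q) (Y q) (mfderiv (𝓡 k) (𝓡 n) F q v) = 0) :
    g (F p) (meanCurvature k g F p) (Y p)
      = -∑ i, ∑ j, (gram (pullback (k := k) F g) p p)⁻¹ i j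
          * g (F p) (covAlong g F Y p (coordFrame (n := k) p p i))
              (mfderiv (𝓡 k) (𝓡 n) F p (coordFrame (n := k) p p j)) := by
  have hp := mem_chart_source (EuclideanSpace ℝ (Fin k)) p
  have hs := hg.symm.self_of_nhds
  have h1 : ∀ i j, g (F p) (covAlong g F
      (fun q => mfderiv (𝓡 k) (𝓡 n) F q (coordFrame (n := k) p q j)) p (coordFrame (n := k) p p i)) (Y p)
      = - g (F p) (covAlong g F Y p (coordFrame (n := k) p p i))
              (mfderiv (𝓡 k) (𝓡 n) F p (coordFrame (n := k) p p j)) := by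
    intro i j
    have h := covAlong_metric_compatible hF hg hY (isC1Along_mfderiv_coordFrame hF hp j)
      (coordFrame (n := k) p p i)
    have h0 : (fun q => g (F q) (Y q) (mfderiv (𝓡 k) (𝓡 n) F q (coordFrame (n := k) p q j)))
        = fun _ => (0 : ℝ) := funext fun q => hn q _
    rw [h0, mvfderiv_const, hs (Y p)] at h
    simp only [zero_apply] at h
    linarith
  obtain ⟨B, hB⟩ := hg.bilin.self_of_nhds
  have h2 : ∀ v, B (normalPart k g F p v) (Y p) = B v (Y p) := by
    intro v
    rw [normalPart, map_sub, LinearMap.sub_apply, ← hB (mfderiv _ _ _ _ _), hs, hn, sub_zero]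
  rw [hB, meanCurvature]
  simp only [map_sum, LinearMap.sum_apply, map_smul, LinearMap.smul_apply, h2, smul_eq_mul]
  rw [← Finset.sum_neg_distrib]
  refine Finset.sum_congr rfl fun i _ => ?_
  rw [← Finset.sum_neg_distrib]
  refine Finset.sum_congr rfl fun j _ => ?_
  rw [← hB, h1, mul_neg]

end MetricCompatibility

/-! ### The boundary density as a trace -/

section TraceDensity

variable {k n : ℕ} {S : Type*} [TopologicalSpace S] [ChartedSpace (EuclideanSpace ℝ (Fin k)) S]
  {M : Type*} [TopologicalSpace M] [ChartedSpace (EuclideanSpace ℝ (Fin n)) M]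

theorem pullback_comp {M' : Type*} [TopologicalSpace M']
    [ChartedSpace (EuclideanSpace ℝ (Fin n)) M'] {F : S → M} {p : S} {φ : M → M'} {g : FormField n M'}
    (hφ : MDifferentiableAt (𝓡 n) (𝓡 n) φ (F p)) (hF : MDifferentiableAt (𝓡 k) (𝓡 n) F p) :
    pullback (k := k) (fun q => φ (F q)) g p = pullback (k := k) F (pullback (k := n) φ g) p := by
  funext u v
  have h6 : ∀ v, mfderiv (𝓡 k) (𝓡 n) (fun q => φ (F q)) p v
      = mfderiv (𝓡 n) (𝓡 n) φ (F p) (mfderiv (𝓡 k) (𝓡 n) F p v) :=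
    mfderiv_comp_apply p hφ hF
  simp only [pullback, h6]

theorem covAlong_add (g : FormField n M) (F : S → M) (Y : ∀ q : S, TangentSpace (𝓡 n) (F q))
    (p : S) (u v : TangentSpace (𝓡 k) p) :
    covAlong g F Y p (u + v) = covAlong g F Y p u + covAlong g F Y p v := by
  rw [covAlong, covAlong, covAlong, ← Finset.sum_add_distrib]
  refine Finset.sum_congr rfl fun a _ => ?_
  rw [← add_smul]
  congr 1
  simp only [connForm, map_add, PiLp.add_apply, mul_add, Finset.sum_add_distrib, add_mul]
  ring

theorem covAlong_smul (g : FormField n M) (F : S → M) (Y : ∀ q : S, TangentSpace (𝓡 n) (F q))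
    (p : S) (r : ℝ) (v : TangentSpace (𝓡 k) p) :
    covAlong g F Y p (r • v) = r • covAlong g F Y p v := by
  rw [covAlong, covAlong, Finset.smul_sum]
  refine Finset.sum_congr rfl fun a _ => ?_
  rw [smul_smul]
  congr 1
  simp only [connForm, map_smul, PiLp.smul_apply, smul_eq_mul, mul_add, Finset.mul_sum,
    Finset.sum_mul]
  congr 1
  exact Finset.sum_congr rfl fun b _ => Finset.sum_congr rfl fun m _ => by ring

/-- The covariant derivative of a vector field along a map, as a linear map. -/
def covAlongLinear (g : FormField n M) (F : S → M) (Y : ∀ q : S, TangentSpace (𝓡 n) (F q))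
    (p : S) : TangentSpace (𝓡 k) p →ₗ[ℝ] TangentSpace (𝓡 n) (F p) where
  toFun := covAlong g F Y p
  map_add' := covAlong_add g F Y p
  map_smul' := covAlong_smul g F Y p

/-- If A expresses one coordinate frame in the other, the Gram matrix and the matrix of T both
change to A(·)Aᵀ, and A cancels in the trace. Thus traces defined in the chart at `p` can be
computed in a chart that does not depend on `p`. -/
theorem sum_gram_inv_mul_eq [IsManifold (𝓡 k) ∞ S] {h : FormField k S} {s p : S}
    (hb : IsBilinAt h p) (hp : p ∈ (chartAt (EuclideanSpace ℝ (Fin k)) s).source)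
    (T : TangentSpace (𝓡 k) p →ₗ[ℝ] TangentSpace (𝓡 k) p →ₗ[ℝ] ℝ) :
    ∑ i, ∑ j, (gram h p p)⁻¹ i j * T (coordFrame p p i) (coordFrame p p j)
      = ∑ i, ∑ j, (gram h s p)⁻¹ i j * T (coordFrame s p i) (coordFrame s p j) := by
  have hp' := mem_chart_source (EuclideanSpace ℝ (Fin k)) p
  obtain ⟨B, hB⟩ := hb
  set A : Matrix (Fin k) (Fin k) ℝ := Matrix.of fun i a => comps p p (coordFrame s p i) a with hA
  set C : Matrix (Fin k) (Fin k) ℝ := Matrix.of fun a i => comps s p (coordFrame p p a) i with hC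
  have hAe : ∀ i, coordFrame s p i = ∑ a, A i a • coordFrame p p a := fun i =>
    (sum_comps_smul_coordFrame hp' _).symm
  -- Reading the expansion `hAe` in the chart at `s` shows that the two transition matrices are
  -- inverse to each other.
  have hAC : A * C = 1 := by
    ext i j
    have := congrArg (fun v => comps s p v j) (hAe i)
    simp only [map_sum, map_smul, comps_coordFrame hp] at this
    rw [Matrix.mul_apply, Matrix.one_apply]
    simpa [hC, Pi.single_apply, eq_comm] using this.symm
  have hAdet : IsUnit A.det := by
    have := congrArg Matrix.det hAC
    rw [Matrix.det_mul, Matrix.det_one] at this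
    exact IsUnit.of_mul_eq_one _ this
  have key : ∀ D : TangentSpace (𝓡 k) p →ₗ[ℝ] TangentSpace (𝓡 k) p →ₗ[ℝ] ℝ,
      (Matrix.of fun i j => D (coordFrame s p i) (coordFrame s p j))
        = A * (Matrix.of fun i j => D (coordFrame p p i) (coordFrame p p j)) * A.transpose := by
    intro D
    ext i j
    simp only [Matrix.mul_apply, Matrix.of_apply, Matrix.transpose_apply]
    rw [hAe i, hAe j]
    simp only [map_sum, LinearMap.sum_apply, map_smul, LinearMap.smul_apply, smul_eq_mul,
      Finset.sum_mul, Finset.mul_sum]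
    exact Finset.sum_congr rfl fun a _ => Finset.sum_congr rfl fun b _ => by ring
  have tr : ∀ K D : Matrix (Fin k) (Fin k) ℝ,
      ∑ i, ∑ j, K i j * D i j = Matrix.trace (K * D.transpose) := fun K D => by
    simp [Matrix.trace, Matrix.mul_apply]
  have e1 : gram h s p = A * gram h p p * A.transpose := by
    have h1 : ∀ c, gram h c p = Matrix.of fun i j => B (coordFrame c p i) (coordFrame c p j) :=
      fun c => by ext i j; exact hB _ _
    rw [h1, h1, key]
  have t1 := tr (gram h p p)⁻¹ (Matrix.of fun i j => T (coordFrame p p i) (coordFrame p p j))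
  have t2 := tr (gram h s p)⁻¹ (Matrix.of fun i j => T (coordFrame s p i) (coordFrame s p j))
  simp only [Matrix.of_apply] at t1 t2
  rw [t1, t2, key T, e1, Matrix.mul_inv_rev, Matrix.mul_inv_rev, Matrix.transpose_mul,
    Matrix.transpose_mul, Matrix.transpose_transpose]
  set Tm := (Matrix.of fun i j => T (coordFrame p p i) (coordFrame p p j)).transpose
  have e2 : (A.transpose)⁻¹ * ((gram h p p)⁻¹ * A⁻¹) * (A * (Tm * A.transpose))
      = (A.transpose)⁻¹ * ((gram h p p)⁻¹ * Tm * A.transpose) := by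
    calc _ = (A.transpose)⁻¹ * ((gram h p p)⁻¹ * (A⁻¹ * A) * (Tm * A.transpose)) := by
          simp only [Matrix.mul_assoc]
      _ = _ := by rw [Matrix.nonsing_inv_mul _ hAdet, Matrix.mul_one, Matrix.mul_assoc]
  rw [e2, Matrix.trace_mul_comm (A.transpose)⁻¹, Matrix.mul_assoc _ A.transpose,
    Matrix.mul_nonsing_inv _ (by rwa [Matrix.det_transpose]), Matrix.mul_one]

/-- The density `-‖ν‖ ⟨H, X⟩ + ‖ν‖⁻¹ ⟨∇_w X, ν⟩`, with the mean curvature of `F` in the normal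
direction `X` expressed through the covariant derivative of `X`. -/
def traceDensity (g : FormField n M) (F : S → M) (X : ∀ q : S, TangentSpace (𝓡 n) (F q)) (p : S)
    (ν : TangentSpace (𝓡 n) (F p)) (w : TangentSpace (𝓡 k) p) : ℝ :=
  lnorm g ν * ∑ i, ∑ j, (gram (pullback (k := k) F g) p p)⁻¹ i j
      * g (F p) (covAlong g F X p (coordFrame (n := k) p p i))
          (mfderiv (𝓡 k) (𝓡 n) F p (coordFrame p p j))
    + 1 / lnorm g ν * g (F p) (covAlong g F X p w) ν

/-- The bilinear form whose trace with respect to the induced metric is `traceDensity`, for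
`w` and `ν` the tangential and the normal part of `N`. -/
def densityForm (g₀ g : FormField n M) (F : S → M) (X : ∀ q : S, TangentSpace (𝓡 n) (F q)) (p : S)
    (N ν : TangentSpace (𝓡 n) (F p)) (u v : TangentSpace (𝓡 k) p) : ℝ :=
  lnorm g ν * g (F p) (covAlong g F X p u) (mfderiv (𝓡 k) (𝓡 n) F p v)
    + 1 / lnorm g ν * (g₀ (F p) N (mfderiv (𝓡 k) (𝓡 n) F p v) * g (F p) (covAlong g F X p u) ν)

variable [IsManifold (𝓡 k) ∞ S] {g₀ g : FormField n M} {F : S → M}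
  {X : ∀ q : S, TangentSpace (𝓡 n) (F q)} {p : S}

/-- The value of `L` on the tangential part is the trace of the form (u, v) ↦ L(u) g(N, dF v), hence
independent of the chart. -/
theorem tangentialPart_eq (hb : IsBilinAt g (F p)) {s : S}
    (hp : p ∈ (chartAt (EuclideanSpace ℝ (Fin k)) s).source) (N : TangentSpace (𝓡 n) (F p))
    (L : TangentSpace (𝓡 k) p →ₗ[ℝ] ℝ) :
    L (tangentialPart g F p N) = ∑ i, ∑ j, (gram (pullback (k := k) F g) s p)⁻¹ i j
      * (L (coordFrame s p i) * g (F p) N (mfderiv (𝓡 k) (𝓡 n) F p (coordFrame s p j))) := by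
  obtain ⟨B, hB⟩ := id hb
  let T : TangentSpace (𝓡 k) p →ₗ[ℝ] TangentSpace (𝓡 k) p →ₗ[ℝ] ℝ :=
    LinearMap.mk₂ ℝ (fun u v => L u * B N (mfderiv (𝓡 k) (𝓡 n) F p v))
      (fun _ _ _ => by simp only [map_add]; ring) (fun _ _ _ => by simp only [map_smul, smul_eq_mul]; ring)
      (fun _ _ _ => by simp only [map_add]; ring) (fun _ _ _ => by simp only [map_smul, smul_eq_mul]; ring)
  have h := sum_gram_inv_mul_eq (h := pullback (k := k) F g) hb.pullback hp T
  simp only [T, LinearMap.mk₂_apply, ← hB] at h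
  rw [← h, tangentialPart]
  simp only [map_sum, map_smul, smul_eq_mul]
  exact Finset.sum_congr rfl fun i _ => Finset.sum_congr rfl fun j _ => by ring

/-- Here `g₀` splits N into its tangential and normal part, and `g` supplies the connection and the
pairings. The roles are separated because the barred density keeps the splitting of the physical
metric; equality of the induced metrics leaves a single Gram matrix. -/
theorem traceDensity_eq (hb₀ : IsBilinAt g₀ (F p)) (hb : IsBilinAt g (F p)) {s : S}
    (hp : p ∈ (chartAt (EuclideanSpace ℝ (Fin k)) s).source)
    (hpull : pullback (k := k) F g p = pullback (k := k) F g₀ p) (N ν : TangentSpace (𝓡 n) (F p)) :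
    traceDensity (k := k) g F X p ν (tangentialPart g₀ F p N)
      = ∑ i, ∑ j, (gram (pullback (k := k) F g₀) s p)⁻¹ i j
        * densityForm g₀ g F X p N ν (coordFrame s p i) (coordFrame s p j) := by
  obtain ⟨B, hB⟩ := id hb
  obtain ⟨B₀, hB₀⟩ := id hb₀
  let L : TangentSpace (𝓡 k) p →ₗ[ℝ] ℝ := (B.flip ν).comp (covAlongLinear g F X p)
  have hL : ∀ v, L v = g (F p) (covAlong g F X p v) ν := fun v => (hB _ _).symm
  have h1 := tangentialPart_eq hb₀ hp N L
  let T : TangentSpace (𝓡 k) p →ₗ[ℝ] TangentSpace (𝓡 k) p →ₗ[ℝ] ℝ :=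
    B.compl₁₂ (covAlongLinear g F X p) (mfderiv (𝓡 k) (𝓡 n) F p).toLinearMap
  have hT : ∀ u v, T u v = g (F p) (covAlong g F X p u) (mfderiv (𝓡 k) (𝓡 n) F p v) :=
    fun u v => (hB _ _).symm
  have h2 := sum_gram_inv_mul_eq (h := pullback (k := k) F g₀) hb₀.pullback hp T
  have h3 : ∀ c, gram (pullback (k := k) F g) c p = gram (pullback (k := k) F g₀) c p := fun c => by
    ext i j; simp only [gram, Matrix.of_apply, hpull]
  simp only [hT, hL] at h1 h2
  rw [traceDensity, h1, h3, h2, Finset.mul_sum, Finset.mul_sum, ← Finset.sum_add_distrib]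
  refine Finset.sum_congr rfl fun i _ => ?_
  rw [Finset.mul_sum, Finset.mul_sum, ← Finset.sum_add_distrib]
  refine Finset.sum_congr rfl fun j _ => ?_
  rw [densityForm]
  ring

variable [IsManifold (𝓡 n) ∞ M] {M' : Type*} [TopologicalSpace M']
  [ChartedSpace (EuclideanSpace ℝ (Fin n)) M'] [IsManifold (𝓡 n) ∞ M']

/-- Every ingredient of the density is built from the metric, the connection and dF, so naturality
of the covariant derivative suffices. -/
theorem traceDensity_pullback {φ : M → M'} {g : FormField n M'}
    (hX : IsC1Along (k := k) F X p)
    (hφ : ContMDiffAt (𝓡 n) (𝓡 n) ∞ φ (F p)) (hF : ContMDiffAt (𝓡 k) (𝓡 n) ∞ F p)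
    (hinj : Function.Injective (mfderiv (𝓡 n) (𝓡 n) φ (F p)))
    (hg : IsMetricAt g (φ (F p))) (ν : TangentSpace (𝓡 n) (F p)) (w : TangentSpace (𝓡 k) p) :
    traceDensity g (fun q => φ (F q)) (fun q => mfderiv (𝓡 n) (𝓡 n) φ (F q) (X q)) p
      (mfderiv (𝓡 n) (𝓡 n) φ (F p) ν) w
      = traceDensity (pullback (k := n) φ g) F X p ν w := by
  have hFd := hF.mdifferentiableAt (by simp)
  have hφd := hφ.mdifferentiableAt (by simp)
  have h6 : ∀ v, mfderiv (𝓡 k) (𝓡 n) (fun q => φ (F q)) p v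
      = mfderiv (𝓡 n) (𝓡 n) φ (F p) (mfderiv (𝓡 k) (𝓡 n) F p v) :=
    mfderiv_comp_apply p hφd hFd
  have h1 : ∀ c, gram (pullback (k := k) (fun q => φ (F q)) g) c p
      = gram (pullback (k := k) F (pullback (k := n) φ g)) c p := fun c => by
    ext i j; simp only [gram, Matrix.of_apply, pullback_comp hφd hFd]
  simp only [traceDensity, covAlong_pullback hX hφ hF hinj hg, h6, h1]
  rfl

end TraceDensity

/-! ### Continuity of the densities -/

theorem ContinuousAt.matrix_inv_apply {T : Type*} [TopologicalSpace T] {k : ℕ}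
    {A : T → Matrix (Fin k) (Fin k) ℝ} {p : T} (hA : ∀ i j, ContinuousAt (fun q => A q i j) p)
    (h : (A p).det ≠ 0) (i j : Fin k) : ContinuousAt (fun q => (A q)⁻¹ i j) p := by
  have hA' : ContinuousAt A p := continuousAt_pi.mpr fun i => continuousAt_pi.mpr fun j => hA i j
  simp only [Matrix.inv_def, Matrix.smul_apply, Ring.inverse_eq_inv', smul_eq_mul]
  have h1 : ContinuousAt (fun q => (A q).det) p :=
    (continuous_id.matrix_det (n := Fin k) (R := ℝ)).continuousAt.comp hA'
  have h2 : ContinuousAt (fun q => (A q).adjugate i j) p :=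
    ((continuous_id.matrix_adjugate (n := Fin k) (R := ℝ)).matrix_elem i j).continuousAt.comp hA'
  exact (h1.inv₀ h).mul h2

section Continuity

variable {k n : ℕ} {S : Type*} [TopologicalSpace S] [ChartedSpace (EuclideanSpace ℝ (Fin k)) S]
  {M : Type*} [TopologicalSpace M] [ChartedSpace (EuclideanSpace ℝ (Fin n)) M]

/-- The vector field `Y` along `F` is continuous at `p`. -/
def IsC0Along (F : S → M) (Y : ∀ q : S, TangentSpace (𝓡 n) (F q)) (p : S) : Prop :=
  ∀ c, F p ∈ (chartAt (EuclideanSpace ℝ (Fin n)) c).source →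
    ContinuousAt (fun q => comps c (F q) (Y q)) p

theorem IsC1Along.isC0Along {F : S → M} {Y : ∀ q : S, TangentSpace (𝓡 n) (F q)} {p : S}
    (hY : IsC1Along (k := k) F Y p) : IsC0Along F Y p :=
  fun c hc => (hY c hc).continuousAt

theorem continuousAt_christoffel [IsManifold (𝓡 n) ∞ M] {g : FormField n M} {c x : M}
    (hg : IsMetricAt g x) (hx : x ∈ (chartAt (EuclideanSpace ℝ (Fin n)) c).source)
    (a m b : Fin n) : ContinuousAt (fun z => christoffel g c z a m b) x := by
  have hx' : x ∈ (extChartAt (𝓡 n) c).source := by rwa [extChartAt_source]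
  have he := continuousAt_extChartAt' (I := 𝓡 n) hx'
  have h1 : ∀ i j : Fin n, ContinuousAt (fun z => gram g c z i j) x := fun i j => by
    have h := ContinuousAt.comp (g := fun y => gram g c ((extChartAt (𝓡 n) c).symm y) i j)
      (f := extChartAt (𝓡 n) c)
      (hg.smooth c hx i j).continuousAt he
    refine h.congr ?_
    filter_upwards [(isOpen_extChartAt_source c).mem_nhds hx'] with z hz
    simp only [Function.comp_apply, (extChartAt (𝓡 n) c).left_inv hz]
  have h2 : ∀ i j l : Fin n, ContinuousAt (fun z => partialDeriv c l (fun z => gram g c z i j) z) x := by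
    intro i j l
    have h := ((hg.smooth c hx i j).fderiv_right (m := 0) (by norm_num)).continuousAt
    exact (ContinuousAt.comp (f := extChartAt (𝓡 n) c) (x := x) h he).clm_apply continuousAt_const
  have h3 := ContinuousAt.matrix_inv_apply h1 (hg.isUnit_det_gram hx).ne_zero
  refine continuousAt_const.mul (tendsto_finsetSum _ fun d _ => ?_)
  exact (h3 a d).mul (((h2 _ _ _).add (h2 _ _ _)).sub (h2 _ _ _))

theorem continuousAt_christoffelVec [IsManifold (𝓡 n) ∞ M] {g : FormField n M} {c : M}
    {F : S → M} {p : S} {u v : S → EuclideanSpace ℝ (Fin n)}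
    (hg : IsMetricAt g (F p)) (hF : ContinuousAt F p)
    (hx : F p ∈ (chartAt (EuclideanSpace ℝ (Fin n)) c).source)
    (hu : ContinuousAt u p) (hv : ContinuousAt v p) :
    ContinuousAt (fun q => christoffelVec g c (F q) (u q) (v q)) p := by
  have hproj : ∀ {f : S → EuclideanSpace ℝ (Fin n)} (_ : ContinuousAt f p) (i : Fin n),
      ContinuousAt (fun q => f q i) p := fun hf i =>
    (EuclideanSpace.proj i : EuclideanSpace ℝ (Fin n) →L[ℝ] ℝ).continuous.continuousAt.comp hf
  refine (PiLp.continuous_toLp 2 _).continuousAt.comp (continuousAt_pi.mpr fun a => ?_)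
  refine tendsto_finsetSum _ fun m _ => tendsto_finsetSum _ fun b _ => ?_
  exact ContinuousAt.mul (ContinuousAt.comp (g := fun z => christoffel g c z a m b)
    (continuousAt_christoffel hg hx a m b) hF) ((hproj hu m).mul (hproj hv b))

theorem IsC0Along.continuousAt_metric [IsManifold (𝓡 n) ∞ M] {g : FormField n M} {F : S → M}
    {p : S} {Y Z : ∀ q : S, TangentSpace (𝓡 n) (F q)} (hY : IsC0Along F Y p)
    (hZ : IsC0Along F Z p) (hg : IsMetricAt g (F p)) (hF : ContinuousAt F p) :
    ContinuousAt (fun q => g (F q) (Y q) (Z q)) p := by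
  have hc := mem_chart_source (EuclideanSpace ℝ (Fin n)) (F p)
  have h1 : ContinuousAt (fun q => metricIn g (F p) (extChartAt (𝓡 n) (F p) (F q))) p :=
    ContinuousAt.comp (g := metricIn g (F p)) (f := fun q => extChartAt (𝓡 n) (F p) (F q))
      (hg.contDiffAt hc).continuousAt (ContinuousAt.comp (g := extChartAt (𝓡 n) (F p)) (f := F) (x := p)
        (continuousAt_extChartAt (F p)) hF)
  refine ((h1.clm_apply (hY _ hc)).clm_apply (hZ _ hc)).congr ?_
  filter_upwards [hF.eventually hg.bilin, eventually_mem_chart_source hF hc] with q h1 h2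
  exact (h1.eq_metricIn h2 _ _).symm

variable [IsManifold (𝓡 k) ∞ S] [IsManifold (𝓡 n) ∞ M] {g₀ g : FormField n M} {F : S → M}
  {X : ∀ q : S, TangentSpace (𝓡 n) (F q)} {p s : S}

/-- The definition at `q` uses the chart centred at `F q`, from which no continuity can be read.
`comps_covAlong` replaces it by the fixed chart `c`, where the components are continuous in `q`. -/
theorem isC0Along_covAlong (hF : ContMDiff (𝓡 k) (𝓡 n) ∞ F) (hg : ∀ q, IsMetricAt g (F q))
    (hX : ∀ q, IsC1Along (k := k) F X q)
    (hp : p ∈ (chartAt (EuclideanSpace ℝ (Fin k)) s).source) (i : Fin k) :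
    IsC0Along F (fun q => covAlong g F X q (coordFrame (n := k) s q i)) p := by
  intro c hc
  have hev := eventually_mem_chart_source hF.continuous.continuousAt hc
  have hJ := (isC1Along_mfderiv_coordFrame hF.contMDiffAt hp i).isC0Along c hc
  have h1 := continuousAt_christoffelVec (hg p) hF.continuous.continuousAt hc hJ
    ((hX p).isC0Along c hc)
  have hp' : p ∈ (extChartAt (𝓡 k) s).source := by rwa [extChartAt_source]
  have h2 := ((contDiffAt_comp_extChartAt_symm (by exact_mod_cast le_top) hp
    (hX p c hc)).fderiv_right (m := 0) (by norm_num)).continuousAt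
  have h3 : ContinuousAt (fun q => fderiv ℝ (fun y => comps c (F ((extChartAt (𝓡 k) s).symm y))
      (X ((extChartAt (𝓡 k) s).symm y))) (extChartAt (𝓡 k) s q) (EuclideanSpace.single i 1)) p :=
    (ContinuousAt.comp (f := extChartAt (𝓡 k) s) h2 (continuousAt_extChartAt' hp')).clm_apply
      continuousAt_const
  refine (h3.add h1).congr ?_
  filter_upwards [hev, (chartAt (EuclideanSpace ℝ (Fin k)) s).open_source.mem_nhds hp]
    with q h4 h5
  rw [comps_covAlong (hX q) hF.contMDiffAt (hg q) h4, covIn,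
    mvfderiv_eq_fderiv ((hX q).mdifferentiableAt h4) h5, comps_coordFrame h5]
  rfl

theorem continuousAt_gram (hF : ContMDiff (𝓡 k) (𝓡 n) ∞ F) (hg : ∀ q, IsMetricAt g (F q))
    (hp : p ∈ (chartAt (EuclideanSpace ℝ (Fin k)) s).source) (i j : Fin k) :
    ContinuousAt (fun q => gram (pullback (k := k) F g) s q i j) p :=
  (isC1Along_mfderiv_coordFrame hF.contMDiffAt hp i).isC0Along.continuousAt_metric
    (isC1Along_mfderiv_coordFrame hF.contMDiffAt hp j).isC0Along (hg p) hF.continuous.continuousAt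

theorem continuousAt_det_gram (hF : ContMDiff (𝓡 k) (𝓡 n) ∞ F) (hg : ∀ q, IsMetricAt g (F q))
    (hp : p ∈ (chartAt (EuclideanSpace ℝ (Fin k)) s).source) :
    ContinuousAt (fun q => (gram (pullback (k := k) F g) s q).det) p :=
  ((continuous_id.matrix_det (n := Fin k) (R := ℝ)).continuousAt).comp
    (continuousAt_pi.mpr fun i => continuousAt_pi.mpr fun j => continuousAt_gram hF hg hp i j)

theorem continuousAt_gram_inv (hF : ContMDiff (𝓡 k) (𝓡 n) ∞ F) (hg : ∀ q, IsMetricAt g (F q))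
    (hdet : (gram (pullback (k := k) F g) s p).det ≠ 0)
    (hp : p ∈ (chartAt (EuclideanSpace ℝ (Fin k)) s).source) (i j : Fin k) :
    ContinuousAt (fun q => (gram (pullback (k := k) F g) s q)⁻¹ i j) p :=
  ContinuousAt.matrix_inv_apply (continuousAt_gram hF hg hp) hdet i j

theorem isC0Along_normalPart {N : ∀ q : S, TangentSpace (𝓡 n) (F q)}
    (hF : ContMDiff (𝓡 k) (𝓡 n) ∞ F) (hg : ∀ q, IsMetricAt g (F q))
    (hdet : ∀ s : S, p ∈ (chartAt (EuclideanSpace ℝ (Fin k)) s).source →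
      (gram (pullback (k := k) F g) s p).det ≠ 0)
    (hN : IsC0Along F N p) :
    IsC0Along F (fun q => normalPart k g F q (N q)) p := by
  intro c hc
  have hp := mem_chart_source (EuclideanSpace ℝ (Fin k)) p
  have hJ := fun j => (isC1Along_mfderiv_coordFrame (F := F) hF.contMDiffAt hp j).isC0Along
  have hG := continuousAt_gram_inv hF hg (hdet p hp) hp
  have hproj : ∀ a : Fin n, Continuous (fun v : EuclideanSpace ℝ (Fin n) => v a) := fun a =>
    (EuclideanSpace.proj a : EuclideanSpace ℝ (Fin n) →L[ℝ] ℝ).continuous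
  have h1 : ContinuousAt (fun q => WithLp.toLp 2 fun a : Fin n => comps c (F q) (N q) a -
      ∑ i, ∑ j, (gram (pullback (k := k) F g) p q)⁻¹ i j
      * (comps c (F q) (mfderiv (𝓡 k) (𝓡 n) F q (coordFrame p q i)) a
        * g (F q) (N q) (mfderiv (𝓡 k) (𝓡 n) F q (coordFrame p q j)))) p := by
    refine (PiLp.continuous_toLp 2 _).continuousAt.comp (continuousAt_pi.mpr fun a => ?_)
    refine ((hproj a).continuousAt.comp (hN c hc)).sub
      (tendsto_finsetSum _ fun i _ => tendsto_finsetSum _ fun j _ => ?_)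
    exact (hG i j).mul (((hproj a).continuousAt.comp (hJ i c hc)).mul
      (hN.continuousAt_metric (hJ j) (hg p) hF.continuous.continuousAt))
  refine h1.congr ?_
  filter_upwards [eventually_mem_chart_source hF.continuous.continuousAt hc,
    (chartAt (EuclideanSpace ℝ (Fin k)) p).open_source.mem_nhds hp] with q h2 h3
  ext a
  rw [normalPart, map_sub, PiLp.sub_apply]
  refine congrArg (fun t => comps c (F q) (N q) a - t) ?_
  exact (tangentialPart_eq (hg q).bilin.self_of_nhds h3 (N q)
    ((EuclideanSpace.proj a : EuclideanSpace ℝ (Fin n) →L[ℝ] ℝ).toLinearMap ∘ₗ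
      ((comps c (F q)).toLinearMap ∘ₗ (mfderiv (𝓡 k) (𝓡 n) F q).toLinearMap))).symm

/-- Needed so that the integrals of the barred and the unbarred density exist separately. Near `p`
the density is rewritten by `traceDensity_eq` in the fixed chart at `p`; there only the Gram
determinant and ‖N^⊥‖ occur as denominators. -/
theorem continuous_traceDensity {N : ∀ q : S, TangentSpace (𝓡 n) (F q)}
    (hF : ContMDiff (𝓡 k) (𝓡 n) ∞ F) (hg₀ : ∀ q, IsMetricAt g₀ (F q))
    (hg : ∀ q, IsMetricAt g (F q))
    (hpull : pullback (k := k) F g = pullback (k := k) F g₀)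
    (hdet : ∀ s q : S, q ∈ (chartAt (EuclideanSpace ℝ (Fin k)) s).source →
      (gram (pullback (k := k) F g₀) s q).det ≠ 0)
    (hX : ∀ q, IsC1Along (k := k) F X q) (hN : ∀ q, IsC0Along F N q)
    (hν : ∀ q, lnorm g (normalPart k g₀ F q (N q)) ≠ 0) :
    Continuous fun q => traceDensity g F X q (normalPart k g₀ F q (N q))
      (tangentialPart (k := k) g₀ F q (N q)) := by
  rw [continuous_iff_continuousAt]
  intro p
  have hp := mem_chart_source (EuclideanSpace ℝ (Fin k)) p
  have hFp : ContinuousAt F p := hF.continuous.continuousAt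
  have hJ := fun j => (isC1Along_mfderiv_coordFrame (F := F) hF.contMDiffAt hp j).isC0Along
  have hD := isC0Along_covAlong (p := p) hF hg hX hp
  have hG := continuousAt_gram_inv hF hg₀ (hdet p p hp) hp
  have hn := isC0Along_normalPart hF hg₀ (fun s hs => hdet s p hs) (hN p)
  have hl : ContinuousAt (fun q => lnorm g (normalPart k g₀ F q (N q))) p :=
    Real.continuous_sqrt.continuousAt.comp (hn.continuousAt_metric hn (hg p) hFp).abs
  have h1 : ContinuousAt (fun q => ∑ i, ∑ j, (gram (pullback (k := k) F g₀) p q)⁻¹ i j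
        * densityForm g₀ g F X q (N q) (normalPart k g₀ F q (N q)) (coordFrame p q i)
          (coordFrame p q j)) p := by
    refine tendsto_finsetSum _ fun i _ => tendsto_finsetSum _ fun j _ => (hG i j).mul ?_
    exact (hl.mul ((hD i).continuousAt_metric (hJ j) (hg p) hFp)).add
      ((continuousAt_const.div hl (hν p)).mul
        (((hN p).continuousAt_metric (hJ j) (hg₀ p) hFp).mul
          ((hD i).continuousAt_metric hn (hg p) hFp)))
  refine h1.congr ?_
  filter_upwards [(chartAt (EuclideanSpace ℝ (Fin k)) p).open_source.mem_nhds hp] with q h2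
  exact (traceDensity_eq (hg₀ q).bilin.self_of_nhds (hg q).bilin.self_of_nhds h2
    (congrFun hpull q) _ _).symm

end Continuity

/-! ### Linear algebra: contracting skew tensors with the volume form -/

section VolumeContraction

open Matrix

/-- The determinant of the matrix with the given rows. -/
def det4 (x y z t : Fin 4 → ℝ) : ℝ := Matrix.det (Matrix.of ![x, y, z, t])

/-- The contraction `B^{ad} ε_{adms} u^m v^s`. -/
def volContraction (B : Matrix (Fin 4) (Fin 4) ℝ) (u v : Fin 4 → ℝ) : ℝ :=
  ∑ a, ∑ d, B a d * det4 (Pi.single a 1) (Pi.single d 1) u v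

theorem map_eq_sum_single (L : (Fin 4 → ℝ) →ₗ[ℝ] ℝ) (x : Fin 4 → ℝ) :
    L x = ∑ a, x a * L (Pi.single a 1) := by
  conv_lhs => rw [pi_eq_sum_univ' x]
  simp [map_sum]

theorem det4_eq_sum_fst (x y z t : Fin 4 → ℝ) :
    det4 x y z t = ∑ a, x a * det4 (Pi.single a 1) y z t := by
  have h : ∀ x, Matrix.detRowAlternating.toMultilinearMap.toLinearMap ![0, y, z, t] 0 x
      = det4 x y z t := fun x => by
    rw [MultilinearMap.toLinearMap_apply]
    exact congrArg Matrix.det (by ext i j; fin_cases i <;> rfl)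
  rw [← h, map_eq_sum_single]
  simp only [h]

theorem det4_eq_sum_snd (x y z t : Fin 4 → ℝ) :
    det4 x y z t = ∑ a, y a * det4 x (Pi.single a 1) z t := by
  have h : ∀ y, Matrix.detRowAlternating.toMultilinearMap.toLinearMap ![x, 0, z, t] 1 y
      = det4 x y z t := fun x => by
    rw [MultilinearMap.toLinearMap_apply]
    exact congrArg Matrix.det (by ext i j; fin_cases i <;> rfl)
  rw [← h, map_eq_sum_single]
  simp only [h]

theorem det4_eq_sum_thd (x y z t : Fin 4 → ℝ) :
    det4 x y z t = ∑ a, z a * det4 x y (Pi.single a 1) t := by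
  have h : ∀ z, Matrix.detRowAlternating.toMultilinearMap.toLinearMap ![x, y, 0, t] 2 z
      = det4 x y z t := fun x => by
    rw [MultilinearMap.toLinearMap_apply]
    exact congrArg Matrix.det (by ext i j; fin_cases i <;> rfl)
  rw [← h, map_eq_sum_single]
  simp only [h]

theorem det4_eq_sum_fth (x y z t : Fin 4 → ℝ) :
    det4 x y z t = ∑ a, t a * det4 x y z (Pi.single a 1) := by
  have h : ∀ t, Matrix.detRowAlternating.toMultilinearMap.toLinearMap ![x, y, z, 0] 3 t
      = det4 x y z t := fun x => by
    rw [MultilinearMap.toLinearMap_apply]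
    exact congrArg Matrix.det (by ext i j; fin_cases i <;> rfl)
  rw [← h, map_eq_sum_single]
  simp only [h]

theorem det4_mulVec (P : Matrix (Fin 4) (Fin 4) ℝ) (x y z t : Fin 4 → ℝ) :
    det4 (P *ᵥ x) (P *ᵥ y) (P *ᵥ z) (P *ᵥ t) = P.det * det4 x y z t := by
  have h : Matrix.of ![P *ᵥ x, P *ᵥ y, P *ᵥ z, P *ᵥ t] = Matrix.of ![x, y, z, t] * Pᵀ := by
    ext i j
    fin_cases i <;> simp [Matrix.mul_apply, Matrix.mulVec, dotProduct, mul_comm]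
  rw [det4, h, Matrix.det_mul, Matrix.det_transpose, det4, mul_comm]

theorem leviCivita_eq_det4 (a b m s : Fin 4) :
    leviCivita a b m s
      = det4 (Pi.single a 1) (Pi.single b 1) (Pi.single m 1) (Pi.single s 1) := by
  refine congrArg Matrix.det ?_
  ext i j
  fin_cases i <;> simp [Pi.single_apply, eq_comm]

/-- By antisymmetry both products contribute equally; the resulting 2 cancels the 1/2 in the
definition of η. -/
theorem sum_leviCivita_mul (a d : Fin 4) (u v : Fin 4 → ℝ) :
    ∑ m, ∑ s, leviCivita a d m s * (u m * v s - u s * v m)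
      = 2 * det4 (Pi.single a 1) (Pi.single d 1) u v := by
  have h1 : ∀ u v : Fin 4 → ℝ, ∑ m, ∑ s, leviCivita a d m s * (u m * v s)
      = det4 (Pi.single a 1) (Pi.single d 1) u v := fun u v => by
    rw [det4_eq_sum_thd]
    refine Finset.sum_congr rfl fun m _ => ?_
    rw [det4_eq_sum_fth, Finset.mul_sum]
    refine Finset.sum_congr rfl fun s _ => ?_
    rw [leviCivita_eq_det4]
    ring
  have h2 : det4 (Pi.single a 1) (Pi.single d 1) v u
      = - det4 (Pi.single a 1) (Pi.single d 1) u v := by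
    have := Matrix.detRowAlternating.map_swap (R := ℝ)
      (v := ![Pi.single a 1, Pi.single d 1, u, v]) (show (2 : Fin 4) ≠ 3 by decide)
    refine Eq.trans (congrArg Matrix.det ?_) this
    ext i j
    fin_cases i <;> rfl
  have h3 : ∑ m, ∑ s, leviCivita a d m s * (u m * v s - u s * v m)
      = ∑ m, ∑ s, leviCivita a d m s * (u m * v s)
        - ∑ m, ∑ s, leviCivita a d m s * (v m * u s) := by
    rw [← Finset.sum_sub_distrib]
    refine Finset.sum_congr rfl fun m _ => ?_
    rw [← Finset.sum_sub_distrib]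
    exact Finset.sum_congr rfl fun s _ => by ring
  rw [h3, h1, h1, h2]
  ring

/-- The contraction is a determinant, so transforming its four slots by P produces the factor det P.
This is what permits passing to an adapted frame. -/
theorem volContraction_congruence (P b : Matrix (Fin 4) (Fin 4) ℝ) (u v : Fin 4 → ℝ) :
    volContraction (P * b * Pᵀ) (P *ᵥ u) (P *ᵥ v) = P.det * volContraction b u v := by
  have h : ∀ i j, det4 (P *ᵥ Pi.single i 1) (P *ᵥ Pi.single j 1) (P *ᵥ u) (P *ᵥ v)
      = ∑ a, ∑ d, P a i * (P d j * det4 (Pi.single a 1) (Pi.single d 1) (P *ᵥ u) (P *ᵥ v)) := by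
    intro i j
    rw [det4_eq_sum_fst]
    refine Finset.sum_congr rfl fun a _ => ?_
    rw [det4_eq_sum_snd, Finset.mul_sum]
    simp
  have h2 : P.det * volContraction b u v = ∑ i, ∑ j, ∑ a, ∑ d, b i j * (P a i *
      (P d j * det4 (Pi.single a 1) (Pi.single d 1) (P *ᵥ u) (P *ᵥ v))) := by
    rw [volContraction, Finset.mul_sum]
    refine Finset.sum_congr rfl fun i _ => ?_
    rw [Finset.mul_sum]
    refine Finset.sum_congr rfl fun j _ => ?_
    rw [mul_left_comm, ← det4_mulVec, h, Finset.mul_sum]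
    exact Finset.sum_congr rfl fun a _ => Finset.mul_sum _ _ _
  rw [h2, volContraction]
  simp only [Matrix.mul_apply, Matrix.transpose_apply, Finset.sum_mul]
  calc _ = ∑ a, ∑ d, ∑ i, ∑ j, b i j * (P a i *
      (P d j * det4 (Pi.single a 1) (Pi.single d 1) (P *ᵥ u) (P *ᵥ v))) := by
        refine Finset.sum_congr rfl fun a _ => Finset.sum_congr rfl fun d _ => ?_
        rw [Finset.sum_comm]
        exact Finset.sum_congr rfl fun i _ => Finset.sum_congr rfl fun j _ => by ring
    _ = ∑ a, ∑ i, ∑ d, ∑ j, b i j * (P a i *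
      (P d j * det4 (Pi.single a 1) (Pi.single d 1) (P *ᵥ u) (P *ᵥ v))) :=
        Finset.sum_congr rfl fun a _ => Finset.sum_comm
    _ = ∑ i, ∑ a, ∑ d, ∑ j, b i j * (P a i *
      (P d j * det4 (Pi.single a 1) (Pi.single d 1) (P *ᵥ u) (P *ᵥ v))) := Finset.sum_comm
    _ = ∑ i, ∑ a, ∑ j, ∑ d, b i j * (P a i *
      (P d j * det4 (Pi.single a 1) (Pi.single d 1) (P *ᵥ u) (P *ᵥ v))) :=
        Finset.sum_congr rfl fun i _ => Finset.sum_congr rfl fun a _ => Finset.sum_comm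
    _ = _ := Finset.sum_congr rfl fun i _ => Finset.sum_comm

theorem det4_single_three (x y z : Fin 4 → ℝ) :
    det4 x y z (Pi.single 3 1) = x 0 * (y 1 * z 2 - y 2 * z 1) - x 1 * (y 0 * z 2 - y 2 * z 0)
      + x 2 * (y 0 * z 1 - y 1 * z 0) := by
  simp [det4, Matrix.det_succ_row_zero, Fin.sum_univ_succ, Fin.succAbove]
  ring

theorem det4_single_two (x y z : Fin 4 → ℝ) :
    det4 x y z (Pi.single 2 1) = -(x 0 * (y 1 * z 3 - y 3 * z 1) - x 1 * (y 0 * z 3 - y 3 * z 0)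
      + x 3 * (y 0 * z 1 - y 1 * z 0)) := by
  simp [det4, Matrix.det_succ_row_zero, Fin.sum_univ_succ, Fin.succAbove]
  ring

theorem volContraction_eq_bilinear (b : Matrix (Fin 4) (Fin 4) ℝ) (u v : Fin 4 → ℝ)
    {m : Fin 4 → Fin 4 → ℝ}
    (h : ∀ x y, det4 x y u v = ∑ a, ∑ d, m a d * (x a * y d)) :
    volContraction b u v = ∑ a, ∑ d, m a d * b a d := by
  simp [volContraction, h, Pi.single_apply, mul_comm]

/-- The indices 0, 1, 2, 3 stand for N^⊥, X, e_1, e_2, and the third slot holds N = N^⊥ + w. After N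
and one e_j are inserted, the determinant is a 2-form with just two independent components, so just
two entries of b survive. -/
theorem volContraction_skew {b : Matrix (Fin 4) (Fin 4) ℝ} (hb : bᵀ = -b) (w : Fin 2 → ℝ) :
    volContraction b ![1, 0, w 0, w 1] (Pi.single 3 1) = 2 * (b 1 2 + w 0 * b 0 1) ∧
    volContraction b ![1, 0, w 0, w 1] (Pi.single 2 1) = -(2 * (b 1 3 + w 1 * b 0 1)) := by
  have h : ∀ i j, b j i = -b i j := fun i j => congrFun (congrFun hb i) j
  have h10 := h 0 1
  have h21 := h 1 2
  have h31 := h 1 3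
  constructor
  · rw [volContraction_eq_bilinear (m := !![0, w 0, 0, 0; -w 0, 0, 1, 0; 0, -1, 0, 0; 0, 0, 0, 0])]
    · simp [Fin.sum_univ_four]
      rw [h21, h10]
      ring
    · intro x y
      rw [det4_single_three]
      simp [Fin.sum_univ_four]
      ring
  · rw [volContraction_eq_bilinear
      (m := !![0, -w 1, 0, 0; w 1, 0, 0, -1; 0, 0, 0, 0; 0, 1, 0, 0])]
    · simp [Fin.sum_univ_four]
      rw [h31, h10]
      ring
    · intro x y
      rw [det4_single_two]
      simp [Fin.sum_univ_four]
      ring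

theorem det_adapted_gram {G P : Matrix (Fin 4) (Fin 4) ℝ} {h : Matrix (Fin 2) (Fin 2) ℝ} {ν : ℝ}
    (hD : Pᵀ * G * P = !![-ν ^ 2, 0, 0, 0; 0, 1, 0, 0; 0, 0, h 0 0, h 0 1; 0, 0, h 1 0, h 1 1]) :
    P.det * G.det * P.det = -ν ^ 2 * h.det := by
  have hdet := congrArg Matrix.det hD
  rw [Matrix.det_mul, Matrix.det_mul, Matrix.det_transpose] at hdet
  rw [hdet, Matrix.det_fin_two h]
  simp [Matrix.det_succ_row_zero, Fin.sum_univ_succ, Fin.succAbove]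
  exact Or.inl (by ring)

/-- Taking determinants in PᵀGP gives -det G (det P)² = ν² det h. The signs σ and τ, which record
the orientations of the charts of M and of S, turn det P into |det P|. -/
theorem sqrt_neg_det_mul_det {G P : Matrix (Fin 4) (Fin 4) ℝ} {h : Matrix (Fin 2) (Fin 2) ℝ}
    {ν σ τ : ℝ} (hν : 0 < ν)
    (hD : Pᵀ * G * P = !![-ν ^ 2, 0, 0, 0; 0, 1, 0, 0; 0, 0, h 0 0, h 0 1; 0, 0, h 1 0, h 1 1])
    (hσ : |σ| = 1) (hτ : |τ| = 1) (hpos : 0 < τ * (σ * P.det)) :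
    τ * (σ * Real.sqrt (-G.det) * P.det) = ν * Real.sqrt h.det := by
  have h1 : τ * (σ * P.det) = |P.det| := by
    rw [← abs_of_pos hpos, abs_mul, abs_mul, hσ, hτ, one_mul, one_mul]
  have h2 : -G.det * (P.det * P.det) = ν ^ 2 * h.det := by
    linear_combination -det_adapted_gram hD
  calc τ * (σ * Real.sqrt (-G.det) * P.det) = Real.sqrt (-G.det) * |P.det| := by
        rw [← h1]; ring
    _ = Real.sqrt (-G.det * (P.det * P.det)) := by
        rw [Real.sqrt_mul' _ (mul_self_nonneg _), Real.sqrt_mul_self_eq_abs]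
    _ = _ := by rw [h2, Real.sqrt_mul (by positivity), Real.sqrt_sq hν.le]

/-- The columns of P form the adapted frame, so the entry (α, β) of PᵀAᵀGP is g(A E_α, E_β), and row
1 belongs to X. In this frame A G⁻¹ becomes a skew matrix b, the contraction picks out the entries
b_{12}, b_{13}, b_{01}, and these are the entries of row 1 with an index raised. -/
theorem volContraction_eq_trace {G P : Matrix (Fin 4) (Fin 4) ℝ}
    {A : Fin 2 → Matrix (Fin 4) (Fin 4) ℝ} {h : Matrix (Fin 2) (Fin 2) ℝ} {ν σ τ : ℝ}
    {w : Fin 2 → ℝ} (hν : 0 < ν) (hh : h 1 0 = h 0 1) (hdet : 0 < h.det) (hG : Gᵀ = G)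
    (hD : Pᵀ * G * P = !![-ν ^ 2, 0, 0, 0; 0, 1, 0, 0; 0, 0, h 0 0, h 0 1; 0, 0, h 1 0, h 1 1])
    (hA : ∀ i, (A i)ᵀ * G + G * A i = 0)
    (hK : τ * (σ * Real.sqrt (-G.det) * P.det) = ν * Real.sqrt h.det) :
    τ * (σ * Real.sqrt (-G.det) *
        (-volContraction (A 0 * G⁻¹) (P *ᵥ ![1, 0, w 0, w 1]) (P *ᵥ Pi.single 3 1)
          + volContraction (A 1 * G⁻¹) (P *ᵥ ![1, 0, w 0, w 1]) (P *ᵥ Pi.single 2 1)))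
      = 2 * Real.sqrt h.det *
        (ν * ∑ i, ∑ j, h⁻¹ i j * (Pᵀ * (A i)ᵀ * G * P) 1 (![2, 3] j)
          + 1 / ν * ∑ i, w i * (Pᵀ * (A i)ᵀ * G * P) 1 0) := by
  set D : Matrix (Fin 4) (Fin 4) ℝ :=
    !![-ν ^ 2, 0, 0, 0; 0, 1, 0, 0; 0, 0, h 0 0, h 0 1; 0, 0, h 1 0, h 1 1] with hDdef
  have hdets : P.det * G.det * P.det ≠ 0 := by
    rw [det_adapted_gram hD]
    have : 0 < ν ^ 2 * h.det := by positivity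
    linarith
  have hP : IsUnit P.det := by
    rw [isUnit_iff_ne_zero]; rintro h0; simp [h0] at hdets
  have hGu : IsUnit G.det := by
    rw [isUnit_iff_ne_zero]; rintro h0; simp [h0] at hdets
  have hPt : IsUnit Pᵀ.det := by rwa [Matrix.det_transpose]
  set b : Fin 2 → Matrix (Fin 4) (Fin 4) ℝ := fun i => P⁻¹ * (A i * G⁻¹) * (Pᵀ)⁻¹ with hb
  have hAb : ∀ i, A i * G⁻¹ = P * b i * Pᵀ := fun i => by
    simp only [hb, Matrix.mul_assoc]
    rw [Matrix.nonsing_inv_mul _ hPt, Matrix.mul_one, Matrix.mul_nonsing_inv_cancel_left _ _ hP]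
  have hAG : ∀ i, A i = P * b i * Pᵀ * G := fun i => by
    rw [← hAb, Matrix.mul_assoc, Matrix.nonsing_inv_mul _ hGu, Matrix.mul_one]
  have hAt : ∀ i, (A i)ᵀ * G = -(G * A i) := fun i => eq_neg_of_add_eq_zero_left (hA i)
  have hskew : ∀ i, (b i)ᵀ = -b i := fun i => by
    have h1 : (A i * G⁻¹)ᵀ = -(A i * G⁻¹) := by
      rw [Matrix.transpose_mul, Matrix.transpose_nonsing_inv, hG]
      calc G⁻¹ * (A i)ᵀ = G⁻¹ * ((A i)ᵀ * G) * G⁻¹ := by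
            rw [Matrix.mul_assoc, Matrix.mul_assoc, Matrix.mul_nonsing_inv _ hGu, Matrix.mul_one]
        _ = _ := by
            rw [hAt, Matrix.mul_neg, Matrix.nonsing_inv_mul_cancel_left _ _ hGu, Matrix.neg_mul]
    simp only [hb]
    rw [Matrix.transpose_mul, Matrix.transpose_mul, h1, Matrix.transpose_nonsing_inv,
      Matrix.transpose_nonsing_inv, Matrix.transpose_transpose]
    simp only [Matrix.mul_neg, Matrix.neg_mul, Matrix.mul_assoc]
  -- Both indices of b are lowered with the adapted Gram matrix D; the minus sign comes from AᵀG =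
  -- -GA.
  have hT : ∀ i, Pᵀ * (A i)ᵀ * G * P = -(D * b i * D) := fun i => by
    rw [Matrix.mul_assoc Pᵀ, hAt, hAG i, ← hD]
    simp only [Matrix.mul_neg, Matrix.neg_mul, Matrix.mul_assoc]
  have e0 := volContraction_skew (hskew 0) w
  have e1 := volContraction_skew (hskew 1) w
  have s0 : b 0 1 0 = -b 0 0 1 := congrFun (congrFun (hskew 0) 0) 1
  have s1 : b 1 1 0 = -b 1 0 1 := congrFun (congrFun (hskew 1) 0) 1
  have entry : ∀ i, (D * b i * D) 1 0 = -ν ^ 2 * b i 1 0 ∧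
      (D * b i * D) 1 2 = b i 1 2 * h 0 0 + b i 1 3 * h 1 0 ∧
      (D * b i * D) 1 3 = b i 1 2 * h 0 1 + b i 1 3 * h 1 1 := fun i => by
    refine ⟨?_, ?_, ?_⟩ <;>
      simp [Matrix.mul_apply, Fin.sum_univ_four, hDdef, Matrix.vecMul, dotProduct, mul_comm]
  have hd2 : h.det = h 0 0 * h 1 1 - h 0 1 * h 1 0 := Matrix.det_fin_two h
  have hd0 : h.det ≠ 0 := hdet.ne'
  have inv00 : h⁻¹ 0 0 = h 1 1 / h.det := by
    rw [Matrix.inv_def, Matrix.adjugate_fin_two, Ring.inverse_eq_inv']; simp; ring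
  have inv01 : h⁻¹ 0 1 = -h 0 1 / h.det := by
    rw [Matrix.inv_def, Matrix.adjugate_fin_two, Ring.inverse_eq_inv']; simp; ring
  have inv10 : h⁻¹ 1 0 = -h 1 0 / h.det := by
    rw [Matrix.inv_def, Matrix.adjugate_fin_two, Ring.inverse_eq_inv']; simp; ring
  have inv11 : h⁻¹ 1 1 = h 0 0 / h.det := by
    rw [Matrix.inv_def, Matrix.adjugate_fin_two, Ring.inverse_eq_inv']; simp; ring
  -- The inverse of h cancels the block h in D, so only b_{12} and b_{13} remain.
  have tr : ∑ i, ∑ j, h⁻¹ i j * (Pᵀ * (A i)ᵀ * G * P) 1 (![2, 3] j)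
      = -(b 0 1 2 + b 1 1 3) := by
    simp only [hT, Fin.sum_univ_two, Matrix.neg_apply, Matrix.cons_val_zero, Matrix.cons_val_one]
    rw [(entry 0).2.1, (entry 0).2.2, (entry 1).2.1, (entry 1).2.2, inv00, inv01, inv10, inv11, hh]
    rw [hh] at hd2
    field_simp
    rw [hd2]
    ring
  -- The entry -ν² of D against the factor 1/ν leaves a single ν, the same power as in the trace
  -- term.
  have tw : 1 / ν * ∑ i, w i * (Pᵀ * (A i)ᵀ * G * P) 1 0
      = -ν * (w 0 * b 0 0 1 + w 1 * b 1 0 1) := by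
    simp only [hT, Fin.sum_univ_two, Matrix.neg_apply]
    rw [(entry 0).1, (entry 1).1, s0, s1]
    field_simp
    ring
  rw [hAb, hAb, volContraction_congruence, volContraction_congruence, e0.1, e1.2, tr, tw]
  linear_combination (-2 * (b 0 1 2 + w 0 * b 0 0 1 + b 1 1 3 + w 1 * b 1 0 1)) * hK

end VolumeContraction

/-! ### The difference of two connections whose metrics agree along a surface -/

section ConnectionDifference

open Matrix

variable {k n : ℕ} {S : Type*} [TopologicalSpace S] [ChartedSpace (EuclideanSpace ℝ (Fin k)) S]
  {M : Type*} [TopologicalSpace M] [ChartedSpace (EuclideanSpace ℝ (Fin n)) M]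

/-- The difference of the connection matrices of `g'` and `g`, in the chart centred at `x`. -/
def connDiff (g g' : FormField n M) (x : M) (u : TangentSpace (𝓡 n) x) :
    Matrix (Fin n) (Fin n) ℝ :=
  Matrix.of fun a b => connForm g' x x a b u - connForm g x x a b u

theorem connForm_eq_christoffelVec (g : FormField n M) (x : M) (a b : Fin n)
    (u : TangentSpace (𝓡 n) x) :
    connForm g x x a b u = christoffelVec g x x (comps x x u) (EuclideanSpace.single b 1) a := by
  simp [connForm, christoffelVec]

variable {g g' : FormField n M} {F : S → M} {p : S}

theorem metricIn_eq_of_eq {x : M} (c : M) {y : EuclideanSpace ℝ (Fin n)}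
    (hy : (extChartAt (𝓡 n) c).symm y = x) (h : ∀ u v, g' x u v = g x u v) :
    metricIn g' c y = metricIn g c y := by
  subst hy
  ext u v
  simp only [metricIn_apply, gram, Matrix.of_apply, h]

variable [IsManifold (𝓡 n) ∞ M]

/-- The derivatives of the components of X cancel, so the difference depends on X only through its
value at p. -/
theorem comps_covAlong_sub (X : ∀ q : S, TangentSpace (𝓡 n) (F q)) (v : TangentSpace (𝓡 k) p) :
    (comps (F p) (F p) (covAlong g' F X p v - covAlong g F X p v)).ofLp
      = connDiff g g' (F p) (mfderiv (𝓡 k) (𝓡 n) F p v) *ᵥ (comps (F p) (F p) (X p)).ofLp := by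
  have hx := mem_chart_source (EuclideanSpace ℝ (Fin n)) (F p)
  have h1 : covAlong g' F X p v - covAlong g F X p v
      = ∑ a, (connDiff g g' (F p) (mfderiv (𝓡 k) (𝓡 n) F p v)
        *ᵥ (comps (F p) (F p) (X p)).ofLp) a • coordFrame (F p) (F p) a := by
    rw [covAlong, covAlong, ← Finset.sum_sub_distrib]
    refine Finset.sum_congr rfl fun a _ => ?_
    rw [← sub_smul]
    congr 1
    simp only [connDiff, mulVec, dotProduct, Matrix.of_apply, sub_mul, Finset.sum_sub_distrib]
    ring
  rw [h1]
  funext b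
  simp [comps_coordFrame hx, Pi.single_apply]

variable [IsManifold (𝓡 k) ∞ S]

/-- The metrics agree only on the image of F, so their derivatives can be compared only in
directions tangent to it: both sides are derivatives of one function on S. -/
theorem fderiv_metricIn_eq_of_agree (hg : IsMetricAt g (F p)) (hg' : IsMetricAt g' (F p))
    (hF : ContMDiffAt (𝓡 k) (𝓡 n) ∞ F p) (heq : ∀ q u v, g' (F q) u v = g (F q) u v)
    (e : TangentSpace (𝓡 k) p) (u v : EuclideanSpace ℝ (Fin n)) :
    fderiv ℝ (metricIn g' (F p)) (extChartAt (𝓡 n) (F p) (F p))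
        (comps (F p) (F p) (mfderiv (𝓡 k) (𝓡 n) F p e)) u v
      = fderiv ℝ (metricIn g (F p)) (extChartAt (𝓡 n) (F p) (F p))
        (comps (F p) (F p) (mfderiv (𝓡 k) (𝓡 n) F p e)) u v := by
  have hp := mem_chart_source (EuclideanSpace ℝ (Fin k)) p
  have hx := mem_chart_source (EuclideanSpace ℝ (Fin n)) (F p)
  have hψ := (contDiffAt_localRep hF hp hx).differentiableAt (by simp)
  rw [comps_mfderiv_eq_fderiv_localRep (hF.mdifferentiableAt (by simp)) hp hx]
  have key : ∀ {γ : FormField n M}, IsMetricAt γ (F p) →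
      fderiv ℝ (fun y => metricIn γ (F p) (localRep p (F p) F y) u v) (extChartAt (𝓡 k) p p)
        (comps p p e) = fderiv ℝ (metricIn γ (F p)) (extChartAt (𝓡 n) (F p) (F p))
        (fderiv ℝ (localRep p (F p) F) (extChartAt (𝓡 k) p p) (comps p p e)) u v := by
    intro γ hγ
    have hd := hγ.differentiableAt hx
    rw [← localRep_apply hp (F p) F] at hd ⊢
    have h := fderiv_bilin_comp (f := metricIn γ (F p)) (u := fun _ => u) (v := fun _ => v)
      (w := comps p p e) hd hψ (differentiableAt_const u) (differentiableAt_const v)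
    simpa using h
  rw [← key hg, ← key hg']
  refine congrArg (fun L : EuclideanSpace ℝ (Fin k) →L[ℝ] ℝ => L (comps p p e))
    (Filter.EventuallyEq.fderiv_eq ?_)
  have hev : ∀ᶠ q in 𝓝 p, F q ∈ (chartAt (EuclideanSpace ℝ (Fin n)) (F p)).source :=
    eventually_mem_chart_source hF.continuousAt hx
  filter_upwards [(tendsto_extChartAt_symm hp).eventually hev] with y hy
  refine congrArg (fun L : EuclideanSpace ℝ (Fin n) →L[ℝ] EuclideanSpace ℝ (Fin n) →L[ℝ] ℝ => L u v)
    (metricIn_eq_of_eq (x := F ((extChartAt (𝓡 k) p).symm y)) _ ?_ (heq _))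
  exact (extChartAt (𝓡 n) (F p)).left_inv (by rwa [extChartAt_source])

/-- Both connections satisfy metric compatibility with the same values and the same tangential
derivatives of the metric; subtracting gives skewness. -/
theorem connDiff_skew (hg : IsMetricAt g (F p)) (hg' : IsMetricAt g' (F p))
    (hF : ContMDiffAt (𝓡 k) (𝓡 n) ∞ F p) (heq : ∀ q u v, g' (F q) u v = g (F q) u v)
    (e : TangentSpace (𝓡 k) p) :
    (connDiff g g' (F p) (mfderiv (𝓡 k) (𝓡 n) F p e))ᵀ * gram g (F p) (F p)
      + gram g (F p) (F p) * connDiff g g' (F p) (mfderiv (𝓡 k) (𝓡 n) F p e) = 0 := by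
  have hx := mem_chart_source (EuclideanSpace ℝ (Fin n)) (F p)
  have hl := (extChartAt (𝓡 n) (F p)).left_inv (mem_extChartAt_source (I := 𝓡 n) (F p))
  ext a b
  have k1 := metricIn_christoffelVec_add hg hx (comps (F p) (F p) (mfderiv (𝓡 k) (𝓡 n) F p e))
    (EuclideanSpace.single a 1) (EuclideanSpace.single b 1)
  have k2 := metricIn_christoffelVec_add hg' hx (comps (F p) (F p) (mfderiv (𝓡 k) (𝓡 n) F p e))
    (EuclideanSpace.single a 1) (EuclideanSpace.single b 1)
  rw [fderiv_metricIn_eq_of_agree hg hg' hF heq, ← k1, metricIn_eq_of_eq _ hl (heq p)] at k2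
  simp only [metricIn_apply, hl, ← connForm_eq_christoffelVec] at k2
  simp only [PiLp.single_apply, mul_ite, mul_one, mul_zero, ite_mul, zero_mul, one_mul,
    Finset.sum_ite_eq', Finset.mem_univ, if_true, Finset.sum_const_zero,
    Finset.sum_ite_irrel] at k2
  simp only [Matrix.add_apply, Matrix.mul_apply, Matrix.transpose_apply, connDiff, Matrix.of_apply,
    Matrix.zero_apply, sub_mul, mul_sub, Finset.sum_sub_distrib]
  simp only [mul_comm (gram g (F p) (F p) _ b)] at k2
  linarith

end ConnectionDifference

/-! ### Frames, Gram matrices and orientation signs -/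

section Frames

open Matrix

variable {n m : ℕ} {M : Type*} [TopologicalSpace M] [ChartedSpace (EuclideanSpace ℝ (Fin n)) M]

theorem abs_sign (o : ManifoldOrientation n M) (c x : M) : |o.sign c x| = 1 := by
  rw [ManifoldOrientation.sign]
  split_ifs <;> simp

theorem gram_transpose {g : FormField n M} {x : M} (hs : ∀ u v, g x u v = g x v u) (c : M) :
    (gram g c x)ᵀ = gram g c x := by
  ext i j
  exact hs _ _

/-- The matrix whose rows are the components of the vectors `E` in the chart centred at `c`. -/
def compsMatrix (c x : M) (E : Fin m → TangentSpace (𝓡 n) x) : Matrix (Fin m) (Fin n) ℝ :=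
  Matrix.of fun α => (comps c x (E α)).ofLp

variable [IsManifold (𝓡 n) ∞ M]

/-- The coordinate frame as a basis. -/
def coordBasis {c x : M} (hx : x ∈ (chartAt (EuclideanSpace ℝ (Fin n)) c).source) :
    Module.Basis (Fin n) ℝ (TangentSpace (𝓡 n) x) :=
  Module.Basis.ofEquivFun
    ((LinearEquiv.ofBijective (comps c x).toLinearMap (comps_isInvertible hx).bijective).trans
      (WithLp.linearEquiv 2 ℝ (Fin n → ℝ)))

theorem coordBasis_repr {c x : M} (hx : x ∈ (chartAt (EuclideanSpace ℝ (Fin n)) c).source)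
    (v : TangentSpace (𝓡 n) x) (a : Fin n) : (coordBasis hx).repr v a = comps c x v a := rfl

theorem coordBasis_apply {c x : M} (hx : x ∈ (chartAt (EuclideanSpace ℝ (Fin n)) c).source)
    (i : Fin n) : coordBasis hx i = coordFrame c x i := by
  apply (coordBasis hx).repr.injective
  ext a
  rw [Module.Basis.repr_self, coordBasis_repr, comps_coordFrame hx]
  simp [Finsupp.single_apply, eq_comm]

theorem isPositiveFrame_coordFrame_iff {c x : M}
    (hx : x ∈ (chartAt (EuclideanSpace ℝ (Fin n)) c).source)
    (o : Orientation ℝ (TangentSpace (𝓡 n) x) (Fin n)) :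
    IsPositiveFrame o (coordFrame c x) ↔ (coordBasis hx).orientation = o := by
  constructor
  · rintro ⟨b, hb, rfl⟩
    have : coordBasis hx = b := Module.Basis.eq_of_apply_eq fun i => by
      rw [coordBasis_apply, hb]
    rw [this]
  · exact fun h => ⟨coordBasis hx, coordBasis_apply hx, h⟩

/-- The determinant is that of a positive basis relative to the coordinate basis, so its sign tells
whether the chart is positively oriented. -/
theorem sign_mul_det_compsMatrix_pos (o : ManifoldOrientation n M) {c x : M}
    (hx : x ∈ (chartAt (EuclideanSpace ℝ (Fin n)) c).source)
    {E : Fin n → TangentSpace (𝓡 n) x} (hE : IsPositiveFrame (o.at' x) E) :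
    0 < o.sign c x * (compsMatrix c x E).det := by
  obtain ⟨b, hb, hbo⟩ := hE
  have hdet : (coordBasis hx).det b = (compsMatrix c x E).det := by
    rw [Module.Basis.det_apply, ← Matrix.det_transpose]
    congr 1
    ext i j
    simp only [Matrix.transpose_apply, Module.Basis.toMatrix_apply, coordBasis_repr, compsMatrix,
      Matrix.of_apply, hb]
  have hiff := (coordBasis hx).orientation_eq_iff_det_pos b
  rw [hdet, hbo, ← isPositiveFrame_coordFrame_iff] at hiff
  have hne : (compsMatrix c x E).det ≠ 0 := by
    rw [← hdet]
    exact ((coordBasis hx).isUnit_det b).ne_zero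
  rw [ManifoldOrientation.sign]
  split_ifs with h
  · simpa using hiff.mp h
  · have := lt_of_le_of_ne (not_lt.mp fun h' => h (hiff.mpr h')) hne
    linarith

/-- The orientation hypothesis on (N^⊥, X, S) speaks only of positive frames of S. For a negatively
oriented chart, reversing the first coordinate vector makes it applicable. -/
theorem isPositiveFrame_neg_zero {c x : M} [NeZero n]
    (hx : x ∈ (chartAt (EuclideanSpace ℝ (Fin n)) c).source)
    {o : Orientation ℝ (TangentSpace (𝓡 n) x) (Fin n)}
    (h : ¬ IsPositiveFrame o (coordFrame c x)) :
    IsPositiveFrame o (Function.update (coordFrame c x) 0 (-coordFrame c x 0)) := by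
  rw [isPositiveFrame_coordFrame_iff hx] at h
  refine ⟨(coordBasis hx).unitsSMul (Function.update 1 0 (-1)), fun i => ?_, ?_⟩
  · rw [Module.Basis.unitsSMul_apply, coordBasis_apply]
    by_cases hi : i = 0
    · subst hi; simp
    · simp [Function.update_of_ne hi]
  · rw [Module.Basis.orientation_neg_single]
    exact (((coordBasis hx).orientation_ne_iff_eq_neg o).mp (Ne.symm h)).symm

theorem compsMatrix_mul_gram_mul {g : FormField n M} {c x : M}
    (hx : x ∈ (chartAt (EuclideanSpace ℝ (Fin n)) c).source) (hb : IsBilinAt g x)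
    (E : Fin m → TangentSpace (𝓡 n) x) (α β : Fin m) :
    (compsMatrix c x E * gram g c x * (compsMatrix c x E)ᵀ) α β = g x (E α) (E β) := by
  rw [hb.eq_metricIn hx, metricIn_apply,
    (extChartAt (𝓡 n) c).left_inv (by rwa [extChartAt_source])]
  simp only [Matrix.mul_apply, compsMatrix, Matrix.of_apply, Matrix.transpose_apply,
    Finset.sum_mul]
  rw [Finset.sum_comm]
  exact Finset.sum_congr rfl fun i _ => Finset.sum_congr rfl fun j _ => by ring

end Frames

/-! ### Orthogonality of the normal part -/

section NormalPart

open Matrix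

variable {k n : ℕ} {S : Type*} [TopologicalSpace S] [ChartedSpace (EuclideanSpace ℝ (Fin k)) S]
  {M : Type*} [TopologicalSpace M] [ChartedSpace (EuclideanSpace ℝ (Fin n)) M]
  [IsManifold (𝓡 k) ∞ S] {g : FormField n M} {F : S → M} {p : S}

/-- The inverse Gram matrix in the tangential part makes its products with the coordinate vectors
equal to those of N; linearity covers all tangent vectors. -/
theorem normalPart_orthogonal (hb : IsBilinAt g (F p)) (hs : ∀ u v, g (F p) u v = g (F p) v u)
    (hdet : IsUnit (gram (pullback (k := k) F g) p p).det) (N : TangentSpace (𝓡 n) (F p))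
    (v : TangentSpace (𝓡 k) p) :
    g (F p) (normalPart k g F p N) (mfderiv (𝓡 k) (𝓡 n) F p v) = 0 := by
  have hp := mem_chart_source (EuclideanSpace ℝ (Fin k)) p
  obtain ⟨B, hB⟩ := id hb
  have h0 : ∀ j, g (F p) (normalPart k g F p N) (mfderiv (𝓡 k) (𝓡 n) F p (coordFrame p p j))
      = 0 := by
    intro j
    have h1 := tangentialPart_eq hb hp N ((B.flip (mfderiv (𝓡 k) (𝓡 n) F p (coordFrame p p j))).comp
      (mfderiv (𝓡 k) (𝓡 n) F p).toLinearMap)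
    set K := gram (pullback (k := k) F g) p p with hK
    have hKsym : ∀ i j, K i j = K j i := fun i j => hs _ _
    have h2 : (fun l => g (F p) N (mfderiv (𝓡 k) (𝓡 n) F p (coordFrame p p l)))
        = K *ᵥ (K⁻¹ *ᵥ fun l => g (F p) N (mfderiv (𝓡 k) (𝓡 n) F p (coordFrame p p l))) := by
      rw [Matrix.mulVec_mulVec, Matrix.mul_nonsing_inv _ hdet, Matrix.one_mulVec]
    have h3 := congrFun h2 j
    have h4 : B (mfderiv (𝓡 k) (𝓡 n) F p (tangentialPart g F p N))
        (mfderiv (𝓡 k) (𝓡 n) F p (coordFrame p p j))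
        = g (F p) N (mfderiv (𝓡 k) (𝓡 n) F p (coordFrame p p j)) := by
      refine Eq.trans h1 (Eq.trans ?_ h3.symm)
      simp only [Matrix.mulVec, dotProduct, Finset.mul_sum]
      refine Finset.sum_congr rfl fun i _ => Finset.sum_congr rfl fun l _ => ?_
      have : K j i = B (mfderiv (𝓡 k) (𝓡 n) F p (coordFrame p p i))
          (mfderiv (𝓡 k) (𝓡 n) F p (coordFrame p p j)) := by
        rw [hKsym, ← hB]; rfl
      rw [this]
      simp only [LinearMap.comp_apply, LinearMap.flip_apply, ContinuousLinearMap.coe_coe]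
      ring
    rw [hB, normalPart, map_sub, LinearMap.sub_apply, h4, ← hB, sub_self]
  rw [← sum_comps_smul_coordFrame hp v, hB]
  have h0' : ∀ j, B (normalPart k g F p N) (mfderiv (𝓡 k) (𝓡 n) F p (coordFrame p p j)) = 0 :=
    fun j => by rw [← hB]; exact h0 j
  simp only [map_sum, map_smul, h0', smul_zero, Finset.sum_const_zero]

end NormalPart

/-! ### Positivity of the area density -/

section SurfaceGram

variable {S : Type*} [TopologicalSpace S] [ChartedSpace (EuclideanSpace ℝ (Fin 2)) S]
  [IsManifold (𝓡 2) ∞ S]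

theorem det_gram_pos {h : FormField 2 S} {s p : S}
    (hp : p ∈ (chartAt (EuclideanSpace ℝ (Fin 2)) s).source) (hb : IsBilinAt h p)
    (hs : ∀ u v, h p u v = h p v u) (hpos : ∀ v, v ≠ 0 → 0 < h p v v) :
    0 < (gram h s p).det := by
  obtain ⟨B, hB⟩ := hb
  have hne : coordFrame (n := 2) s p 0 ≠ 0 := fun h0 => by
    have := comps_coordFrame hp 0
    rw [h0, map_zero] at this
    have := congrArg (fun v : EuclideanSpace ℝ (Fin 2) => v 0) this
    simp at this
  have h00 := hpos _ hne
  -- With this vector h_{01} e_0 - h_{00} e_1, the square length is h_{00} det h.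
  have hne2 : B (coordFrame s p 0) (coordFrame s p 1) • coordFrame (n := 2) s p 0
      - B (coordFrame s p 0) (coordFrame s p 0) • coordFrame (n := 2) s p 1 ≠ 0 := fun h0 => by
    have := congrArg (fun v : TangentSpace (𝓡 2) p => comps (n := 2) s p v 1) h0
    simp only [map_sub, map_smul, comps_coordFrame hp, map_zero] at this
    simp at this
    rw [hB] at h00
    exact h00.ne' this
  have h1 := hpos _ hne2
  rw [Matrix.det_fin_two]
  simp only [gram, Matrix.of_apply, hB] at *
  simp only [map_sub, map_smul, LinearMap.sub_apply, LinearMap.smul_apply, smul_eq_mul] at h1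
  rw [hs (coordFrame s p 1) (coordFrame s p 0)] at h1 ⊢
  have h2 : 0 < B (coordFrame s p 0) (coordFrame s p 0) *
      (B (coordFrame s p 0) (coordFrame s p 0) * B (coordFrame s p 1) (coordFrame s p 1)
        - B (coordFrame s p 0) (coordFrame s p 1) * B (coordFrame s p 0) (coordFrame s p 1)) := by
    linarith
  exact (pos_iff_pos_of_mul_pos h2).mp h00

end SurfaceGram

/-! ### The energy form where the metrics agree, and the adapted frame -/

section EnergyForm

open Matrix

variable {M : Type*} [TopologicalSpace M] [ChartedSpace (EuclideanSpace ℝ (Fin 4)) M]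

theorem sum_mul_etaForm (o : ManifoldOrientation 4 M) (g : FormField 4 M) (x : M)
    (A : Matrix (Fin 4) (Fin 4) ℝ) (u v : TangentSpace (𝓡 4) x) :
    ∑ a, ∑ b, A a b * etaForm o g x x a b u v
      = o.sign x x * Real.sqrt (-(gram g x x).det)
        * volContraction (A * (gram g x x)⁻¹) (comps x x u).ofLp (comps x x v).ofLp := by
  have h : ∀ a b, etaForm o g x x a b u v = o.sign x x * Real.sqrt (-(gram g x x).det)
      * ∑ d, (gram g x x)⁻¹ b d
        * det4 (Pi.single a 1) (Pi.single d 1) (comps x x u).ofLp (comps x x v).ofLp := by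
    intro a b
    rw [etaForm, Finset.mul_sum, Finset.mul_sum]
    refine Finset.sum_congr rfl fun d _ => ?_
    have := sum_leviCivita_mul a d (comps x x u).ofLp (comps x x v).ofLp
    simp only [mul_assoc, ← Finset.mul_sum]
    rw [this]
    ring
  simp only [h, volContraction, Matrix.mul_apply, Finset.mul_sum, Finset.sum_mul]
  refine Finset.sum_congr rfl fun a _ => ?_
  rw [Finset.sum_comm]
  exact Finset.sum_congr rfl fun d _ => Finset.sum_congr rfl fun b _ => by ring

/-- Since η depends on the metric only at the point, the two η coincide and the term with D̄N drops
out, whatever N is off the surface. The signs reflect that `connDiff` is ω̄ - ω, whereas the energy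
contains ω - ω̄. -/
theorem cntForm_eq_of_eq (o : ManifoldOrientation 4 M) {g g' : FormField 4 M} {x : M}
    (heq : ∀ u v, g' x u v = g x u v) (N : ∀ x : M, TangentSpace (𝓡 4) x)
    (u v : TangentSpace (𝓡 4) x) :
    cntForm o g g' N x u v = o.sign x x * Real.sqrt (-(gram g x x).det) *
      (-volContraction (connDiff g g' x u * (gram g x x)⁻¹)
          (comps x x (N x)).ofLp (comps x x v).ofLp
        + volContraction (connDiff g g' x v * (gram g x x)⁻¹)
          (comps x x (N x)).ofLp (comps x x u).ofLp) := by
  have hgram : gram g' x x = gram g x x := by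
    ext i j
    exact heq _ _
  have heta : ∀ a b, etaForm o g' x x a b u v = etaForm o g x x a b u v := fun a b => by
    simp only [etaForm, hgram]
  rw [mul_add, mul_neg, ← sum_mul_etaForm, ← sum_mul_etaForm, cntForm, ← Finset.sum_neg_distrib,
    ← Finset.sum_add_distrib]
  refine Finset.sum_congr rfl fun a _ => ?_
  rw [← Finset.sum_neg_distrib, ← Finset.sum_add_distrib]
  refine Finset.sum_congr rfl fun b _ => ?_
  rw [heta, connDiff, connDiff, Matrix.of_apply, Matrix.of_apply]
  ring

variable {S : Type*} [TopologicalSpace S] [ChartedSpace (EuclideanSpace ℝ (Fin 2)) S]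

/-- The frame consisting of two vectors and the coordinate vectors of a surface. -/
def adaptedFrame (F : S → M) (s p : S) (ν X : TangentSpace (𝓡 4) (F p)) :
    Fin 4 → TangentSpace (𝓡 4) (F p) :=
  ![ν, X, mfderiv (𝓡 2) (𝓡 4) F p (coordFrame s p 0), mfderiv (𝓡 2) (𝓡 4) F p (coordFrame s p 1)]

theorem adaptedFrame_gram {g : FormField 4 M} {F : S → M} {s p : S}
    (hs : ∀ u v, g (F p) u v = g (F p) v u) {ν X : TangentSpace (𝓡 4) (F p)}
    (hν : g (F p) ν ν < 0) (hX : g (F p) X X = 1) (hνX : g (F p) X ν = 0)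
    (hνt : ∀ v, g (F p) ν (mfderiv (𝓡 2) (𝓡 4) F p v) = 0)
    (hXt : ∀ v, g (F p) X (mfderiv (𝓡 2) (𝓡 4) F p v) = 0) :
    (Matrix.of fun α β => g (F p) (adaptedFrame F s p ν X α) (adaptedFrame F s p ν X β))
      = !![-lnorm g ν ^ 2, 0, 0, 0; 0, 1, 0, 0;
          0, 0, gram (pullback (k := 2) F g) s p 0 0, gram (pullback (k := 2) F g) s p 0 1;
          0, 0, gram (pullback (k := 2) F g) s p 1 0, gram (pullback (k := 2) F g) s p 1 1] := by
  have h00 : g (F p) ν ν = -lnorm g ν ^ 2 := by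
    rw [lnorm, Real.sq_sqrt (abs_nonneg _), abs_of_neg hν, neg_neg]
  have hνX' : g (F p) ν X = 0 := by rw [hs, hνX]
  have hνt' : ∀ v, g (F p) (mfderiv (𝓡 2) (𝓡 4) F p v) ν = 0 := fun v => by rw [hs, hνt]
  have hXt' : ∀ v, g (F p) (mfderiv (𝓡 2) (𝓡 4) F p v) X = 0 := fun v => by rw [hs, hXt]
  ext i j
  fin_cases i <;> fin_cases j <;>
    simp [adaptedFrame, h00, hX, hνX, hνX', hνt, hνt', hXt, hXt', gram, pullback]

variable [IsManifold (𝓡 4) ∞ M] [IsManifold (𝓡 2) ∞ S]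

/-- In a negatively oriented chart of S the reversal of the first coordinate vector negates row 2 of
the determinant, and the sign of the chart compensates for it. -/
theorem sign_mul_sign_mul_det_adaptedFrame_pos (o : ManifoldOrientation 2 S)
    (oM : ManifoldOrientation 4 M) {F : S → M} {s p : S}
    (hp : p ∈ (chartAt (EuclideanSpace ℝ (Fin 2)) s).source) {ν X : TangentSpace (𝓡 4) (F p)}
    (hor : ∀ e : Fin 2 → TangentSpace (𝓡 2) p, IsPositiveFrame (o.at' p) e →
      IsPositiveFrame (oM.at' (F p))
        ![ν, X, mfderiv (𝓡 2) (𝓡 4) F p (e 0), mfderiv (𝓡 2) (𝓡 4) F p (e 1)]) :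
    0 < o.sign s p * (oM.sign (F p) (F p)
      * (compsMatrix (F p) (F p) (adaptedFrame F s p ν X)).det) := by
  have hx := mem_chart_source (EuclideanSpace ℝ (Fin 4)) (F p)
  by_cases h : IsPositiveFrame (o.at' p) (coordFrame s p)
  · have h1 := sign_mul_det_compsMatrix_pos oM hx (hor _ h)
    rw [ManifoldOrientation.sign, if_pos h, one_mul]
    exact h1
  · have h1 := sign_mul_det_compsMatrix_pos oM hx (hor _ (isPositiveFrame_neg_zero hp h))
    rw [ManifoldOrientation.sign, if_neg h]
    have h2 : compsMatrix (F p) (F p) ![ν, X,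
        mfderiv (𝓡 2) (𝓡 4) F p (Function.update (coordFrame s p) 0 (-coordFrame s p 0) 0),
        mfderiv (𝓡 2) (𝓡 4) F p (Function.update (coordFrame s p) 0 (-coordFrame s p 0) 1)]
        = (compsMatrix (F p) (F p) (adaptedFrame F s p ν X)).updateRow 2
          ((-1 : ℝ) • compsMatrix (F p) (F p) (adaptedFrame F s p ν X) 2) := by
      ext i j
      fin_cases i <;> simp [compsMatrix, adaptedFrame, Matrix.updateRow_apply]
    rw [h2, Matrix.det_updateRow_smul, Matrix.updateRow_eq_self] at h1
    linarith

end EnergyForm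

/-! ### The difference of the barred and the unbarred density -/

section DensityDifference

open Matrix

variable {k n : ℕ} {S : Type*} [TopologicalSpace S] [ChartedSpace (EuclideanSpace ℝ (Fin k)) S]
  {M : Type*} [TopologicalSpace M] [ChartedSpace (EuclideanSpace ℝ (Fin n)) M]
  {g g' : FormField n M} {F : S → M}
  {X : ∀ q : S, TangentSpace (𝓡 n) (F q)} {s p : S}

theorem metric_covAlong_sub [IsManifold (𝓡 n) ∞ M] {m : ℕ} (hb : IsBilinAt g (F p))
    (E : Fin m → TangentSpace (𝓡 n) (F p)) {α : Fin m} (hα : E α = X p) (β : Fin m)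
    (v : TangentSpace (𝓡 k) p) :
    g (F p) (covAlong g' F X p v - covAlong g F X p v) (E β)
      = (compsMatrix (F p) (F p) E * (connDiff g g' (F p) (mfderiv (𝓡 k) (𝓡 n) F p v))ᵀ
        * gram g (F p) (F p) * (compsMatrix (F p) (F p) E)ᵀ) α β := by
  have hx := mem_chart_source (EuclideanSpace ℝ (Fin n)) (F p)
  set Δ := covAlong g' F X p v - covAlong g F X p v with hΔ
  have h1 := compsMatrix_mul_gram_mul hx hb (m := 2) ![Δ, E β] 0 1
  have h2 := comps_covAlong_sub (g := g) (g' := g') X v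
  rw [← hΔ, ← hα] at h2
  have h3 : compsMatrix (F p) (F p) ![Δ, E β] 0 = (compsMatrix (F p) (F p) E
      * (connDiff g g' (F p) (mfderiv (𝓡 k) (𝓡 n) F p v))ᵀ) α := by
    refine Eq.trans h2 ?_
    ext a
    simp [Matrix.mul_apply, mulVec, dotProduct, compsMatrix, mul_comm]
  have h4 : compsMatrix (F p) (F p) ![Δ, E β] 1 = compsMatrix (F p) (F p) E β := rfl
  refine Eq.trans h1.symm ?_
  generalize compsMatrix (F p) (F p) E * (connDiff g g' (F p) (mfderiv (𝓡 k) (𝓡 n) F p v))ᵀ = Q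
    at h3 ⊢
  simp only [Matrix.mul_apply, Matrix.transpose_apply, h3, h4]

variable [IsManifold (𝓡 k) ∞ S]

/-- At `p` the two metrics are equal, so norms, pairings and the induced metric agree and only the
covariant derivatives of X differ. The chart `s` is arbitrary because both terms are traces or
linear in `w`. -/
theorem traceDensity_sub (hb : IsBilinAt g (F p)) (heq : ∀ u v, g' (F p) u v = g (F p) u v)
    (hp : p ∈ (chartAt (EuclideanSpace ℝ (Fin k)) s).source)
    (ν : TangentSpace (𝓡 n) (F p)) (w : TangentSpace (𝓡 k) p) :
    traceDensity g' F X p ν w - traceDensity g F X p ν w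
      = lnorm g ν * ∑ i, ∑ j, (gram (pullback (k := k) F g) s p)⁻¹ i j
          * g (F p) (covAlong g' F X p (coordFrame s p i) - covAlong g F X p (coordFrame s p i))
            (mfderiv (𝓡 k) (𝓡 n) F p (coordFrame s p j))
        + 1 / lnorm g ν * ∑ i, comps s p w i
          * g (F p) (covAlong g' F X p (coordFrame s p i) - covAlong g F X p (coordFrame s p i))
            ν := by
  obtain ⟨B, hB⟩ := id hb
  let D := covAlongLinear (k := k) g' F X p - covAlongLinear g F X p
  have hD : ∀ v, D v = covAlong g' F X p v - covAlong g F X p v := fun v => rfl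
  let T := B.compl₁₂ D (mfderiv (𝓡 k) (𝓡 n) F p).toLinearMap
  have h2 := sum_gram_inv_mul_eq (h := pullback (k := k) F g) hb.pullback hp T
  have hT : ∀ u v, T u v = B (D u) (mfderiv (𝓡 k) (𝓡 n) F p v) := fun u v => rfl
  have hgram : gram (pullback (k := k) F g') p p = gram (pullback (k := k) F g) p p := by
    ext i j
    exact heq _ _
  have hln : lnorm g' ν = lnorm g ν := by rw [lnorm, lnorm, heq]
  have h3 : B (D w) ν = ∑ i, comps s p w i * B (D (coordFrame s p i)) ν := by
    conv_lhs => rw [← sum_comps_smul_coordFrame hp w]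
    simp only [map_sum, map_smul, LinearMap.sum_apply, LinearMap.smul_apply, smul_eq_mul]
  simp only [hT, hD] at h2 h3
  simp only [traceDensity, hgram, hln, heq, hB, ← h2, ← h3]
  simp only [map_sub, LinearMap.sub_apply, mul_sub, Finset.sum_sub_distrib]
  ring

end DensityDifference

/-! ### The pointwise identity for the energy form -/

section EnergyDensity

open Matrix

variable {M : Type*} [TopologicalSpace M] [ChartedSpace (EuclideanSpace ℝ (Fin 4)) M]
  [IsManifold (𝓡 4) ∞ M]
  {S : Type*} [TopologicalSpace S] [ChartedSpace (EuclideanSpace ℝ (Fin 2)) S]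
  [IsManifold (𝓡 2) ∞ S]

/-- By Pythagoras g(N, N) is g(N^⊥, N^⊥) plus the square of the tangential part, which is
nonnegative. In particular N^⊥ is timelike when N is. -/
theorem metric_normalPart_self {k n : ℕ} {S : Type*} [TopologicalSpace S]
    [ChartedSpace (EuclideanSpace ℝ (Fin k)) S]
    {M : Type*} [TopologicalSpace M] [ChartedSpace (EuclideanSpace ℝ (Fin n)) M]
    [IsManifold (𝓡 k) ∞ S] {g : FormField n M} {F : S → M} {p : S}
    (hb : IsBilinAt g (F p)) (hs : ∀ u v, g (F p) u v = g (F p) v u)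
    (hdet : IsUnit (gram (pullback (k := k) F g) p p).det)
    (hpos : ∀ v, 0 ≤ pullback (k := k) F g p v v) (N : TangentSpace (𝓡 n) (F p)) :
    g (F p) (normalPart k g F p N) (normalPart k g F p N) ≤ g (F p) N N := by
  have h0 := normalPart_orthogonal hb hs hdet N
  have h1 := hpos (tangentialPart g F p N)
  have h2 : N = normalPart k g F p N + mfderiv (𝓡 k) (𝓡 n) F p (tangentialPart g F p N) := by
    rw [normalPart, sub_add_cancel]
  obtain ⟨B, hB⟩ := hb
  have h3 := h0 (tangentialPart g F p N)
  have h4 := hs (normalPart k g F p N) (mfderiv (𝓡 k) (𝓡 n) F p (tangentialPart g F p N))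
  rw [pullback] at h1
  have h5 : g (F p) N N = g (F p) (normalPart k g F p N) (normalPart k g F p N)
      + g (F p) (mfderiv (𝓡 k) (𝓡 n) F p (tangentialPart g F p N))
        (mfderiv (𝓡 k) (𝓡 n) F p (tangentialPart g F p N)) := by
    conv_lhs => rw [h2]
    rw [hB] at h3 h4 ⊢
    rw [hB] at h4
    simp only [map_add, LinearMap.add_apply]
    rw [← h4, h3, hB, hB]
    ring
  linarith

/-- The central identity, between densities in an arbitrary chart of S: the abstract contraction
formula is applied to the adapted frame (N^⊥, X, e_1, e_2) and to the skew matrices ω̄ - ω on e_1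
and e_2. -/
theorem sign_mul_cntForm_pullback (o : ManifoldOrientation 2 S) (oM : ManifoldOrientation 4 M)
    {g g' : FormField 4 M} {F : S → M} {s p : S} (hg : IsMetricAt g (F p))
    (hg' : IsMetricAt g' (F p)) (hF : ContMDiffAt (𝓡 2) (𝓡 4) ∞ F p)
    (heq : ∀ q u v, g' (F q) u v = g (F q) u v)
    (hp : p ∈ (chartAt (EuclideanSpace ℝ (Fin 2)) s).source)
    (hpos : ∀ v, v ≠ 0 → 0 < pullback (k := 2) F g p v v)
    (N : ∀ x : M, TangentSpace (𝓡 4) x) (hN : g (F p) (N (F p)) (N (F p)) < 0)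
    {X : ∀ q : S, TangentSpace (𝓡 4) (F q)} (hX : g (F p) (X p) (X p) = 1)
    (hXt : ∀ v, g (F p) (X p) (mfderiv (𝓡 2) (𝓡 4) F p v) = 0) (hXN : g (F p) (X p) (N (F p)) = 0)
    (hor : ∀ e : Fin 2 → TangentSpace (𝓡 2) p, IsPositiveFrame (o.at' p) e →
      IsPositiveFrame (oM.at' (F p)) ![normalPart 2 g F p (N (F p)), X p,
        mfderiv (𝓡 2) (𝓡 4) F p (e 0), mfderiv (𝓡 2) (𝓡 4) F p (e 1)]) :
    o.sign s p * pullback F (cntForm oM g g' N) p (coordFrame (n := 2) s p 0)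
        (coordFrame (n := 2) s p 1)
      = 2 * Real.sqrt (gram (pullback (k := 2) F g) s p).det
        * (traceDensity (k := 2) g' F X p (normalPart 2 g F p (N (F p))) (tangentialPart g F p (N (F p)))
          - traceDensity (k := 2) g F X p (normalPart 2 g F p (N (F p)))
            (tangentialPart g F p (N (F p)))) := by
  have hx := mem_chart_source (EuclideanSpace ℝ (Fin 4)) (F p)
  have hp' := mem_chart_source (EuclideanSpace ℝ (Fin 2)) p
  have hb := hg.bilin.self_of_nhds
  have hs := hg.symm.self_of_nhds
  have hdets : ∀ c, p ∈ (chartAt (EuclideanSpace ℝ (Fin 2)) c).source →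
      0 < (gram (pullback (k := 2) F g) c p).det := fun c hc =>
    det_gram_pos hc hb.pullback (fun _ _ => hs _ _) hpos
  have hunit := isUnit_iff_ne_zero.mpr (hdets p hp').ne'
  have hνt := normalPart_orthogonal hb hs hunit (N (F p))
  have hνν : g (F p) (normalPart 2 g F p (N (F p))) (normalPart 2 g F p (N (F p))) < 0 := by
    refine (metric_normalPart_self hb hs hunit (fun v => ?_) (N (F p))).trans_lt hN
    by_cases hv : v = 0
    · obtain ⟨B, hB⟩ := hb
      rw [hv, pullback, hB, map_zero, map_zero]
    · exact (hpos v hv).le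
  have hνX : g (F p) (X p) (normalPart 2 g F p (N (F p))) = 0 := by
    obtain ⟨B, hB⟩ := id hb
    rw [normalPart, hB, map_sub, ← hB, ← hB, hXN, hXt, sub_zero]
  have hNsum : N (F p) = normalPart 2 g F p (N (F p))
      + mfderiv (𝓡 2) (𝓡 4) F p (tangentialPart g F p (N (F p))) := by
    rw [normalPart, sub_add_cancel]
  set ν := normalPart 2 g F p (N (F p)) with hνdef
  set w : TangentSpace (𝓡 2) p := tangentialPart g F p (N (F p)) with hwdef
  have hlν : 0 < lnorm g ν := Real.sqrt_pos.mpr (abs_pos.mpr hνν.ne)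
  set E := adaptedFrame F s p ν (X p) with hE
  set P := (compsMatrix (F p) (F p) E)ᵀ with hP
  have hPcol : ∀ α, P *ᵥ Pi.single α 1 = (comps (F p) (F p) (E α)).ofLp := fun α => by
    rw [Matrix.mulVec_single_one]; rfl
  have hD : Pᵀ * gram g (F p) (F p) * P = _ :=
    (Matrix.ext fun α β => compsMatrix_mul_gram_mul hx hb E α β).trans
      (adaptedFrame_gram (s := s) hs hνν hX hνX hνt hXt)
  -- N is N^⊥ plus a combination of the coordinate vectors of S, so its component along X is zero.
  have hNcol : P *ᵥ ![1, 0, comps (n := 2) s p w 0, comps (n := 2) s p w 1]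
      = (comps (F p) (F p) (N (F p))).ofLp := by
    have h1 : (![1, 0, comps (n := 2) s p w 0, comps (n := 2) s p w 1] : Fin 4 → ℝ)
        = Pi.single 0 1 + (comps (n := 2) s p w 0 • Pi.single 2 1 + comps (n := 2) s p w 1 • Pi.single 3 1) := by
      ext i
      fin_cases i <;> simp
    have h2 : N (F p) = E 0 + (comps (n := 2) s p w 0 • E 2 + comps (n := 2) s p w 1 • E 3) := by
      conv_lhs => rw [hNsum, ← sum_comps_smul_coordFrame hp w]
      rw [map_sum, Fin.sum_univ_two, map_smul, map_smul]
      rfl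
    rw [h1, Matrix.mulVec_add, Matrix.mulVec_add, Matrix.mulVec_smul, Matrix.mulVec_smul, hPcol,
      hPcol, hPcol, h2, map_add, map_add, map_smul, map_smul]
    rfl
  have hsgn := sign_mul_sign_mul_det_adaptedFrame_pos o oM hp hor
  have hK := sqrt_neg_det_mul_det hlν hD (abs_sign oM (F p) (F p)) (abs_sign o s p)
    (by rw [hP, Matrix.det_transpose]; exact hsgn)
  have key := volContraction_eq_trace (w := fun i => comps (n := 2) s p w i) (A := fun i =>
      connDiff g g' (F p) (mfderiv (𝓡 2) (𝓡 4) F p (coordFrame (n := 2) s p i))) hlν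
    (hs _ _)
    (hdets s hp) (gram_transpose hs (F p)) hD (fun i => connDiff_skew hg hg' hF heq _) hK
  rw [hNcol, hPcol, hPcol] at key
  rw [pullback, cntForm_eq_of_eq oM (heq p)]
  refine Eq.trans key ?_
  rw [traceDensity_sub hb (heq p) hp]
  -- Index 1 of the adapted frame is X, so row 1 of the matrix product holds the pairings with (∇̄ -
  -- ∇)X.
  have hent : ∀ i β, g (F p) (covAlong g' F X p (coordFrame (n := 2) s p i)
      - covAlong g F X p (coordFrame (n := 2) s p i)) (E β) = _ := fun i β =>
    metric_covAlong_sub (g' := g') (X := X) hb E (α := 1) rfl β (coordFrame (n := 2) s p i)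
  congr 2
  · congr 1
    refine Finset.sum_congr rfl fun i _ => Finset.sum_congr rfl fun j _ => ?_
    congr 1
    rw [hP, Matrix.transpose_transpose, ← hent]
    fin_cases j <;> rfl
  · congr 1
    refine Finset.sum_congr rfl fun i _ => ?_
    congr 1
    rw [hP, Matrix.transpose_transpose, ← hent]
    rfl

end EnergyDensity

/-! ### Smooth fields along a map in components -/

section TangentBundle

variable {k n : ℕ} {S : Type*} [TopologicalSpace S] [ChartedSpace (EuclideanSpace ℝ (Fin k)) S]
  {M : Type*} [TopologicalSpace M] [ChartedSpace (EuclideanSpace ℝ (Fin n)) M]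
  [IsManifold (𝓡 n) ∞ M]

/-- On the domain of the chart at `c`, the fibre part of the tangent bundle trivialization is the
differential of the chart, that is, `comps c`. -/
theorem contMDiffAt_tangentBundle_iff {F : S → M} {Y : ∀ q : S, TangentSpace (𝓡 n) (F q)}
    {p : S} {c : M} (hc : F p ∈ (chartAt (EuclideanSpace ℝ (Fin n)) c).source) :
    ContMDiffAt (𝓡 k) (𝓡 n).tangent 1 (fun q => (⟨F q, Y q⟩ : TangentBundle (𝓡 n) M)) p ↔
      ContMDiffAt (𝓡 k) (𝓡 n) 1 F p ∧
        ContMDiffAt (𝓡 k) 𝓘(ℝ, EuclideanSpace ℝ (Fin n)) 1 (fun q => comps c (F q) (Y q)) p := by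
  have : IsManifold (𝓡 n) (1 + 1) M := IsManifold.of_le (n := ∞) (by norm_cast)
  have : IsManifold (𝓡 n) 1 M := IsManifold.of_le (n := ∞) (by exact_mod_cast le_top)
  have h := (trivializationAt (EuclideanSpace ℝ (Fin n)) (TangentSpace (𝓡 n)) c).contMDiffAt_iff
    (n := 1) (IB := 𝓡 n) (IM := 𝓡 k)
    (f := fun q => (⟨F q, Y q⟩ : TangentBundle (𝓡 n) M)) (x₀ := p) (by
      rw [Bundle.Trivialization.mem_source]; exact hc)
  refine h.trans (and_congr_right fun hF => ?_)
  refine Filter.EventuallyEq.contMDiffAt_iff ?_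
  filter_upwards [eventually_mem_chart_source hF.continuousAt hc] with q hq
  have h1 := TangentBundle.continuousLinearMapAt_trivializationAt (I := 𝓡 n) hq
  rw [comps, ← h1]
  rw [Bundle.Trivialization.continuousLinearMapAt_apply_of_mem]
  exact hq

theorem isC1Along_of_contMDiffAt {F : S → M} {Y : ∀ q : S, TangentSpace (𝓡 n) (F q)} {p : S}
    (h : ContMDiffAt (𝓡 k) (𝓡 n).tangent 1 (fun q => (⟨F q, Y q⟩ : TangentBundle (𝓡 n) M)) p) :
    IsC1Along (k := k) F Y p :=
  fun _ hc => ((contMDiffAt_tangentBundle_iff hc).mp h).2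

theorem contMDiffAt_coordFrame {c x : M}
    (hx : x ∈ (chartAt (EuclideanSpace ℝ (Fin n)) c).source) (i : Fin n) :
    ContMDiffAt (𝓡 n) (𝓡 n).tangent 1
      (fun z => (⟨z, coordFrame c z i⟩ : TangentBundle (𝓡 n) M)) x := by
  refine (contMDiffAt_tangentBundle_iff (F := id) hx).mpr ⟨contMDiffAt_id, ?_⟩
  refine (contMDiffAt_const (c := EuclideanSpace.single i (1 : ℝ))).congr_of_eventuallyEq ?_
  filter_upwards [(chartAt (EuclideanSpace ℝ (Fin n)) c).open_source.mem_nhds hx] with z hz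
  exact comps_coordFrame hz i

end TangentBundle

/-! ### Regularity and nondegeneracy of a spacetime metric -/

section SpacetimeMetric

variable {M : Type*} [TopologicalSpace M] [ChartedSpace (EuclideanSpace ℝ (Fin 4)) M]
  [IsManifold (𝓡 4) ∞ M] (𝓜 : Spacetime M)

theorem Spacetime.isBilinAt (x : M) : IsBilinAt 𝓜.g x :=
  ⟨LinearMap.mk₂ ℝ (fun u v => 𝓜.metric x u v) (fun _ _ _ => by simp) (fun _ _ _ => by simp)
    (fun _ _ _ => by simp) (fun _ _ _ => by simp), fun _ _ => rfl⟩

theorem Spacetime.eq_zero_of_forall {x : M} {u : TangentSpace (𝓡 4) x}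
    (h : ∀ v, 𝓜.g x u v = 0) : u = 0 := by
  obtain ⟨b, hb⟩ := 𝓜.lorentzian x
  obtain ⟨B, hB⟩ := 𝓜.isBilinAt x
  have hb' : ∀ i j, B (b i) (b j) = if i = j then (if i = 0 then -1 else 1) else 0 := fun i j =>
    (hB _ _).symm.trans (hb i j)
  rw [← b.sum_repr u]
  refine Finset.sum_eq_zero fun j _ => ?_
  have h1 := h (b j)
  rw [hB, ← b.sum_repr u] at h1
  simp only [map_sum, map_smul, LinearMap.sum_apply, LinearMap.smul_apply, smul_eq_mul, hb',
    mul_ite, mul_zero, Finset.sum_ite_eq', Finset.mem_univ, if_true] at h1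
  have h2 : b.repr u j = 0 := by
    split_ifs at h1 <;> linarith
  rw [h2, zero_smul]

theorem Spacetime.isMetricAt (x : M) : IsMetricAt 𝓜.g x where
  bilin := Eventually.of_forall 𝓜.isBilinAt
  symm := Eventually.of_forall 𝓜.symm
  nondeg _ := 𝓜.eq_zero_of_forall
  smooth c hx i j := by
    have h := ContMDiffAt.clm_bundle_apply₂ (F₁ := EuclideanSpace ℝ (Fin 4))
      (F₂ := EuclideanSpace ℝ (Fin 4)) (F₃ := ℝ) (IB := 𝓡 4) (IM := 𝓡 4) (n := 1)
      (E₁ := fun x : M => TangentSpace (𝓡 4) x) (E₂ := fun x : M => TangentSpace (𝓡 4) x)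
      (E₃ := fun _ : M => ℝ) (b := fun x : M => x) (ψ := fun x => 𝓜.metric x)
      (v := fun z => coordFrame c z i) (w := fun z => coordFrame c z j) (x := x)
      ((𝓜.smooth x).of_le (by exact_mod_cast le_top))
      (contMDiffAt_coordFrame hx i) (contMDiffAt_coordFrame hx j)
    have h' := (Bundle.contMDiffAt_totalSpace.mp h).2
    have h2 : ContMDiffAt (𝓡 4) 𝓘(ℝ, ℝ) 1 (fun z => gram 𝓜.g c z i j) x := h'
    exact contDiffAt_comp_extChartAt_symm (by exact_mod_cast le_top) hx h2

end SpacetimeMetric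

/-! ### Integrals over the surface -/

section SurfaceIntegrals

variable {S : Type*} [TopologicalSpace S] [ChartedSpace (EuclideanSpace ℝ (Fin 2)) S]

theorem measurableSet_extChartAt_target (c : S) :
    MeasurableSet (extChartAt (𝓡 2) c).target := (isOpen_extChartAt_target c).measurableSet

theorem symm_mem_chart_source {c : S} {y : EuclideanSpace ℝ (Fin 2)}
    (hy : y ∈ (extChartAt (𝓡 2) c).target) :
    (extChartAt (𝓡 2) c).symm y ∈ (chartAt (EuclideanSpace ℝ (Fin 2)) c).source := by
  rw [← extChartAt_source (𝓡 2) c]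
  exact (extChartAt (𝓡 2) c).map_target hy

variable [IsManifold (𝓡 2) ∞ S] [T2Space S] [SigmaCompactSpace S]

theorem integralArea_const_mul (h : FormField 2 S) (r : ℝ) (f : S → ℝ) :
    integralArea h (fun p => r * f p) = r * integralArea h f := by
  rw [integralArea, integralArea, mul_finsum]
  congr 1
  funext c
  rw [← integral_const_mul]
  congr 1
  funext y
  ring

theorem integralForm_eq_integralArea {o : ManifoldOrientation 2 S} {α h : FormField 2 S}
    {f : S → ℝ}
    (hα : ∀ s p : S, p ∈ (chartAt (EuclideanSpace ℝ (Fin 2)) s).source →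
      o.sign s p * α p (coordFrame s p 0) (coordFrame s p 1)
        = f p * Real.sqrt (gram h s p).det) :
    integralForm o α = integralArea h f := by
  rw [integralForm, integralArea]
  congr 1
  funext c
  refine setIntegral_congr_fun (measurableSet_extChartAt_target c) fun y hy => ?_
  simp only [mul_assoc]
  rw [hα c _ (symm_mem_chart_source hy)]

theorem integralArea_congr {h : FormField 2 S} {f f' : S → ℝ} (hf : ∀ p, f p = f' p) :
    integralArea h f = integralArea h f' := by rw [funext hf]

variable [CompactSpace S]

/-- The partition function has compact support inside the chart domain; on its image the integrand
is continuous, and elsewhere in the chart it vanishes. -/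
theorem integrableOn_partition_mul {h : FormField 2 S} {f : S → ℝ} (hf : Continuous f) (c : S)
    (hh : ∀ p ∈ (chartAt (EuclideanSpace ℝ (Fin 2)) c).source,
      ContinuousAt (fun q => (gram h c q).det) p) :
    IntegrableOn (fun y => chartPartition S c ((extChartAt (𝓡 2) c).symm y)
      * f ((extChartAt (𝓡 2) c).symm y)
      * Real.sqrt (gram h c ((extChartAt (𝓡 2) c).symm y)).det) (extChartAt (𝓡 2) c).target := by
  set K := extChartAt (𝓡 2) c '' tsupport (chartPartition S c) with hK
  have hsub : tsupport (chartPartition S c) ⊆ (extChartAt (𝓡 2) c).source := by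
    rw [extChartAt_source]
    exact chartPartition_isSubordinate S c
  have hKc : IsCompact K :=
    (isClosed_tsupport _).isCompact.image_of_continuousOn ((continuousOn_extChartAt c).mono hsub)
  have hKt : K ⊆ (extChartAt (𝓡 2) c).target := by
    rintro _ ⟨p, hp, rfl⟩
    exact (extChartAt (𝓡 2) c).map_source (hsub hp)
  have hcont : ContinuousOn (fun y => chartPartition S c ((extChartAt (𝓡 2) c).symm y)
      * f ((extChartAt (𝓡 2) c).symm y)
      * Real.sqrt (gram h c ((extChartAt (𝓡 2) c).symm y)).det) (extChartAt (𝓡 2) c).target := by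
    have hs := continuousOn_extChartAt_symm (I := 𝓡 2) c
    have hρ : Continuous (chartPartition S c) := (chartPartition S c).contMDiff.continuous
    have hd : ContinuousOn (fun q => (gram h c q).det)
        (chartAt (EuclideanSpace ℝ (Fin 2)) c).source :=
      fun p hp => (hh p hp).continuousWithinAt
    refine ((hρ.comp_continuousOn hs).mul
      (hf.comp_continuousOn hs)).mul (Real.continuous_sqrt.comp_continuousOn ?_)
    exact hd.comp hs fun y hy => symm_mem_chart_source hy
  refine ((hcont.mono hKt).integrableOn_compact hKc).of_forall_sdiff_eq_zero
    (measurableSet_extChartAt_target c) fun y hy => ?_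
  have h0 : chartPartition S c ((extChartAt (𝓡 2) c).symm y) = 0 := by
    by_contra hne
    exact hy.2 ⟨_, subset_tsupport _ hne, (extChartAt (𝓡 2) c).right_inv hy.1⟩
  rw [h0, zero_mul, zero_mul]

theorem hasFiniteSupport_integral_partition (h : FormField 2 S) (f : S → ℝ) :
    Function.HasFiniteSupport fun c : S => ∫ y in (extChartAt (𝓡 2) c).target,
      chartPartition S c ((extChartAt (𝓡 2) c).symm y) * f ((extChartAt (𝓡 2) c).symm y)
        * Real.sqrt (gram h c ((extChartAt (𝓡 2) c).symm y)).det := by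
  refine ((chartPartition S).locallyFinite.finite_nonempty_of_compact).subset fun c hc => ?_
  by_contra hne
  refine hc ?_
  have h0 : ∀ p, chartPartition S c p = 0 := fun p => by
    by_contra hp
    exact hne ⟨p, hp⟩
  simp [h0]

/-- Additivity has to be justified twice, since `∑ᶠ` and the integral both default to 0: compactness
leaves finitely many nonzero charts, and continuity gives integrability in each of them. -/
theorem integralArea_sub {h : FormField 2 S} {f f' : S → ℝ} (hf : Continuous f)
    (hf' : Continuous f')
    (hh : ∀ c, ∀ p ∈ (chartAt (EuclideanSpace ℝ (Fin 2)) c).source,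
      ContinuousAt (fun q => (gram h c q).det) p) :
    integralArea h (fun p => f p - f' p) = integralArea h f - integralArea h f' := by
  rw [integralArea, integralArea, integralArea, ← finsum_sub_distrib
    (hasFiniteSupport_integral_partition h f) (hasFiniteSupport_integral_partition h f')]
  congr 1
  funext c
  rw [← integral_sub (integrableOn_partition_mul hf c (hh c))
    (integrableOn_partition_mul hf' c (hh c))]
  congr 1
  funext y
  ring

end SurfaceIntegrals

/-! ### The boundary density and its trace form -/

section BoundaryDensity

variable {M : Type*} [TopologicalSpace M] [ChartedSpace (EuclideanSpace ℝ (Fin 4)) M]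
  [IsManifold (𝓡 4) ∞ M] (𝓜 : Spacetime M)
  {S : Type*} [TopologicalSpace S] [ChartedSpace (EuclideanSpace ℝ (Fin 2)) S]
  {F : S → M} {X : ∀ q : S, TangentSpace (𝓡 4) (F q)} {p : S}

theorem boundaryDensity_zero (ν : TangentSpace (𝓡 4) (F p)) :
    boundaryDensity 𝓜 F X p ν (0 : TangentSpace (𝓡 2) p)
      = -lnorm 𝓜.g ν * 𝓜.g (F p) (meanCurvature 2 𝓜.g F p) (X p) := by
  obtain ⟨B, hB⟩ := 𝓜.isBilinAt (F p)
  have h : covAlong 𝓜.g F X p (0 : TangentSpace (𝓡 2) p) = 0 :=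
    (covAlongLinear 𝓜.g F X p).map_zero
  rw [boundaryDensity, h, hB _ ν, map_zero, LinearMap.zero_apply, mul_zero, add_zero]

variable [IsManifold (𝓡 2) ∞ S]

theorem boundaryDensity_eq_traceDensity (hF : ContMDiffAt (𝓡 2) (𝓡 4) ∞ F p)
    (hX : IsC1Along (k := 2) F X p)
    (hn : ∀ q v, 𝓜.g (F q) (X q) (mfderiv (𝓡 2) (𝓡 4) F q v) = 0)
    (ν : TangentSpace (𝓡 4) (F p)) (w : TangentSpace (𝓡 2) p) :
    boundaryDensity 𝓜 F X p ν w = traceDensity 𝓜.g F X p ν w := by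
  rw [boundaryDensity, traceDensity, meanCurvature_eq_of_normal hF (𝓜.isMetricAt _) hX hn]
  ring

end BoundaryDensity

/-! ### Isometric matching references -/

section Matching

variable {M : Type*} [TopologicalSpace M] [ChartedSpace (EuclideanSpace ℝ (Fin 4)) M]
  [IsManifold (𝓡 4) ∞ M]
  {M' : Type*} [TopologicalSpace M'] [ChartedSpace (EuclideanSpace ℝ (Fin 4)) M']
  [IsManifold (𝓡 4) ∞ M']
  {S : Type*} [TopologicalSpace S] [ChartedSpace (EuclideanSpace ℝ (Fin 2)) S]
  {𝓜 : Spacetime M} {𝓜' : Spacetime M'} {ι : S → M} {U : Set M} {φ : M → M'}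

theorem IsIsometricMatching.contMDiffAt {K : Set M} (hφ : IsIsometricMatching 𝓜 𝓜' K U φ) {x : M}
    (hx : x ∈ K) : ContMDiffAt (𝓡 4) (𝓡 4) ∞ φ x :=
  (hφ.smooth x (hφ.subset hx)).contMDiffAt (hφ.isOpen.mem_nhds (hφ.subset hx))

theorem IsIsometricMatching.isMetricAt_pullback {K : Set M} (hφ : IsIsometricMatching 𝓜 𝓜' K U φ)
    {x : M} (hx : x ∈ K) : IsMetricAt (pullback (k := 4) φ 𝓜'.g) x :=
  (𝓜'.isMetricAt _).pullback (hφ.contMDiffAt hx) (hφ.immersion x (hφ.subset hx))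

theorem IsIsometricMatching.pullback_comp_eq (hφ : IsIsometricMatching 𝓜 𝓜' (range ι) U φ)
    (hι : ContMDiff (𝓡 2) (𝓡 4) ∞ ι) :
    pullback (k := 2) (fun q => φ (ι q)) 𝓜'.g = pullback (k := 2) ι 𝓜.g := by
  funext p
  rw [pullback_comp ((hφ.contMDiffAt (mem_range_self p)).mdifferentiableAt (by simp))
    ((hι p).mdifferentiableAt (by simp))]
  funext u v
  exact hφ.matching _ (mem_range_self p) _ _

variable [IsManifold (𝓡 2) ∞ S] {X : ∀ q : S, TangentSpace (𝓡 4) (ι q)}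

/-- Matching makes φ_*X normal to the image surface, so the mean curvature formula applies in the
reference spacetime; naturality then brings the density back to M. -/
theorem IsIsometricMatching.boundaryDensity_eq (hφ : IsIsometricMatching 𝓜 𝓜' (range ι) U φ)
    (hι : ContMDiff (𝓡 2) (𝓡 4) ∞ ι) {p : S} (hX : IsC1Along (k := 2) ι X p)
    (hn : ∀ q v, 𝓜.g (ι q) (X q) (mfderiv (𝓡 2) (𝓡 4) ι q v) = 0)
    (ν : TangentSpace (𝓡 4) (ι p)) (w : TangentSpace (𝓡 2) p) :
    boundaryDensity 𝓜' (fun q => φ (ι q)) (fun q => mfderiv (𝓡 4) (𝓡 4) φ (ι q) (X q)) p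
        (mfderiv (𝓡 4) (𝓡 4) φ (ι p) ν) w
      = traceDensity (pullback (k := 4) φ 𝓜'.g) ι X p ν w := by
  have hφs := fun q : S => hφ.contMDiffAt (mem_range_self q)
  rw [← traceDensity_pullback hX (hφs p) (hι p)
    (hφ.immersion _ (hφ.subset (mem_range_self p))) (𝓜'.isMetricAt _)]
  refine boundaryDensity_eq_traceDensity (F := fun q => φ (ι q)) 𝓜' ((hφs p).comp p (hι p)) (hX.mfderiv (hφs p) (hι p))
    (fun q v => ?_) _ w
  have h : mfderiv (𝓡 2) (𝓡 4) (fun q => φ (ι q)) q v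
      = mfderiv (𝓡 4) (𝓡 4) φ (ι q) (mfderiv (𝓡 2) (𝓡 4) ι q v) :=
    mfderiv_comp_apply q ((hφs q).mdifferentiableAt (by simp)) ((hι q).mdifferentiableAt (by simp)) v
  rw [h, ← hn q v]
  exact hφ.matching _ (mem_range_self q) _ _

variable [T2Space S] [SigmaCompactSpace S]

/-- The factor 2 of the pointwise identity turns 1/(16π) into 1/(8π). The two densities still stand
under one integral, so no integrability is involved. -/
theorem IsIsometricMatching.energy_eq (hφ : IsIsometricMatching 𝓜 𝓜' (range ι) U φ)
    (o : ManifoldOrientation 2 S) (hι : ContMDiff (𝓡 2) (𝓡 4) ∞ ι)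
    (hpos : ∀ (p : S) (v : TangentSpace (𝓡 2) p), v ≠ 0 → 0 < pullback ι 𝓜.g p v v)
    {N : ∀ p : S, TangentSpace (𝓡 4) (ι p)} (hN : ∀ p, 𝓜.g (ι p) (N p) (N p) < 0)
    (hX1 : ∀ p, 𝓜.g (ι p) (X p) (X p) = 1)
    (hXt : ∀ (p : S) (v : TangentSpace (𝓡 2) p),
      𝓜.g (ι p) (X p) (mfderiv (𝓡 2) (𝓡 4) ι p v) = 0)
    (hXN : ∀ p, 𝓜.g (ι p) (X p) (N p) = 0)
    (hor : ∀ (p : S) (e : Fin 2 → TangentSpace (𝓡 2) p), IsPositiveFrame (o.at' p) e →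
      IsPositiveFrame (𝓜.orientation.at' (ι p)) ![normalPart 2 𝓜.g ι p (N p), X p,
        mfderiv (𝓡 2) (𝓡 4) ι p (e 0), mfderiv (𝓡 2) (𝓡 4) ι p (e 1)])
    {Next : ∀ x : M, TangentSpace (𝓡 4) x} (hNext : ∀ p, Next (ι p) = N p) :
    energy 𝓜 𝓜' o ι Next φ = 1 / (8 * Real.pi) * integralArea (pullback ι 𝓜.g) fun p =>
      traceDensity (pullback (k := 4) φ 𝓜'.g) ι X p (normalPart 2 𝓜.g ι p (N p))
          (tangentialPart (k := 2) 𝓜.g ι p (N p))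
        - traceDensity 𝓜.g ι X p (normalPart 2 𝓜.g ι p (N p))
          (tangentialPart (k := 2) 𝓜.g ι p (N p)) := by
  have key : ∀ s p : S, p ∈ (chartAt (EuclideanSpace ℝ (Fin 2)) s).source → _ := fun s p hp =>
    sign_mul_cntForm_pullback o 𝓜.orientation (𝓜.isMetricAt (ι p))
      (hφ.isMetricAt_pullback (mem_range_self p)) (hι p)
      (fun q => hφ.matching _ (mem_range_self q)) hp (hpos p) Next (by rw [hNext]; exact hN p)
      (X := X) (hX1 p) (hXt p) (by rw [hNext]; exact hXN p) (by rw [hNext]; exact hor p)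
  simp only [hNext] at key
  rw [energy, integralForm_eq_integralArea (h := pullback ι 𝓜.g) (f := fun p => 2 *
      (traceDensity (pullback (k := 4) φ 𝓜'.g) ι X p (normalPart 2 𝓜.g ι p (N p))
          (tangentialPart (k := 2) 𝓜.g ι p (N p))
        - traceDensity 𝓜.g ι X p (normalPart 2 𝓜.g ι p (N p))
          (tangentialPart (k := 2) 𝓜.g ι p (N p)))), integralArea_const_mul, ← mul_assoc]
  · congr 1
    field_simp
  · intro s p hp
    rw [key s p hp]
    ring

end Matching

end CNT

end

/-! ### The energy formula -/

theorem theorem1p1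
    {M : Type*} [TopologicalSpace M] [T2Space M] [SecondCountableTopology M]
    [ChartedSpace (EuclideanSpace ℝ (Fin 4)) M] [IsManifold (𝓡 4) ∞ M]
    {M' : Type*} [TopologicalSpace M'] [T2Space M'] [SecondCountableTopology M']
    [ChartedSpace (EuclideanSpace ℝ (Fin 4)) M'] [IsManifold (𝓡 4) ∞ M']
    {S : Type*} [TopologicalSpace S] [T2Space S] [CompactSpace S]
    [ChartedSpace (EuclideanSpace ℝ (Fin 2)) S] [IsManifold (𝓡 2) ∞ S]
    -- the physical and the reference spacetime, the oriented closed spacelike surface `ι : S → M`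
    (𝓜 : CNT.Spacetime M) (𝓜' : CNT.Spacetime M') (o : CNT.ManifoldOrientation 2 S)
    (ι : S → M) (hι : Manifold.IsSmoothEmbedding (𝓡 2) (𝓡 4) ∞ ι)
    (hspacelike : ∀ (p : S) (v : TangentSpace (𝓡 2) p), v ≠ 0 →
      0 < CNT.pullback ι 𝓜.g p v v)
    -- the future-directed timelike vector field `N` on the surface
    (N : ∀ p : S, TangentSpace (𝓡 4) (ι p))
    (hN : ContMDiff (𝓡 2) (𝓡 4).tangent ∞ (fun p => (⟨ι p, N p⟩ : TangentBundle (𝓡 4) M)))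
    (hNfuture : ∀ p : S, 𝓜.IsFutureTimelike (N p))
    -- the unit normal vector field `X`, orthogonal to `N`, with `(N^⊥, X, S)` positively oriented
    (X : ∀ p : S, TangentSpace (𝓡 4) (ι p))
    (hX : ContMDiff (𝓡 2) (𝓡 4).tangent ∞ (fun p => (⟨ι p, X p⟩ : TangentBundle (𝓡 4) M)))
    (hXunit : ∀ p : S, 𝓜.g (ι p) (X p) (X p) = 1)
    (hXnormal : ∀ (p : S) (v : TangentSpace (𝓡 2) p),
      𝓜.g (ι p) (X p) (mfderiv (𝓡 2) (𝓡 4) ι p v) = 0)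
    (hXN : ∀ p : S, 𝓜.g (ι p) (X p) (N p) = 0)
    (hXor : ∀ (p : S) (e : Fin 2 → TangentSpace (𝓡 2) p),
      CNT.IsPositiveFrame (o.at' p) e →
      CNT.IsPositiveFrame (𝓜.orientation.at' (ι p))
        ![CNT.normalPart 2 𝓜.g ι p (N p), X p,
          mfderiv (𝓡 2) (𝓡 4) ι p (e 0), mfderiv (𝓡 2) (𝓡 4) ι p (e 1)])
    -- the 4D isometric matching reference `φ`, defined on the neighbourhood `U` of the surface
    (U : Set M) (φ : M → M') (hφ : CNT.IsIsometricMatching 𝓜 𝓜' (Set.range ι) U φ)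
    -- any extension of `N`, used to form `D̄_b N^a` in the definition of the energy
    (Next : ∀ x : M, TangentSpace (𝓡 4) x) (hNext : ∀ p : S, Next (ι p) = N p) :
    CNT.energy 𝓜 𝓜' o ι Next φ
      = 1 / (8 * Real.pi) * CNT.integralArea (CNT.pullback (fun q => φ (ι q)) 𝓜'.g)
          (fun p => CNT.boundaryDensity 𝓜' (fun q => φ (ι q))
            (fun q => mfderiv (𝓡 4) (𝓡 4) φ (ι q) (X q)) p
            (mfderiv (𝓡 4) (𝓡 4) φ (ι p) (CNT.normalPart 2 𝓜.g ι p (N p)))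
            (CNT.tangentialPart 𝓜.g ι p (N p)))
        - 1 / (8 * Real.pi) * CNT.integralArea (CNT.pullback ι 𝓜.g)
          (fun p => CNT.boundaryDensity 𝓜 ι X p
            (CNT.normalPart 2 𝓜.g ι p (N p)) (CNT.tangentialPart 𝓜.g ι p (N p)))
    ∧ ((∀ (p : S) (v : TangentSpace (𝓡 2) p),
          𝓜.g (ι p) (N p) (mfderiv (𝓡 2) (𝓡 4) ι p v) = 0) →
        CNT.energy 𝓜 𝓜' o ι Next φ
          = 1 / (8 * Real.pi) * CNT.integralArea (CNT.pullback ι 𝓜.g)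
            (fun p => CNT.lnorm 𝓜.g (N p) *
              (-𝓜'.g (φ (ι p)) (CNT.meanCurvature 2 𝓜'.g (fun q => φ (ι q)) p)
                  (mfderiv (𝓡 4) (𝓡 4) φ (ι p) (X p))
                + 𝓜.g (ι p) (CNT.meanCurvature 2 𝓜.g ι p) (X p)))) := by

  have hιs : ContMDiff (𝓡 2) (𝓡 4) ∞ ι := hι.contMDiff
  have hXC : ∀ p, CNT.IsC1Along (k := 2) ι X p := fun p =>
    CNT.isC1Along_of_contMDiffAt ((hX p).of_le (by exact_mod_cast le_top))
  have hNC : ∀ p, CNT.IsC0Along ι N p := fun p =>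
    (CNT.isC1Along_of_contMDiffAt ((hN p).of_le (by exact_mod_cast le_top))).isC0Along
  have hb := 𝓜.isBilinAt
  have hdet : ∀ s p : S, p ∈ (chartAt (EuclideanSpace ℝ (Fin 2)) s).source →
      (CNT.gram (CNT.pullback (k := 2) ι 𝓜.g) s p).det ≠ 0 := fun s p hp =>
    (CNT.det_gram_pos hp (hb _).pullback (fun _ _ => 𝓜.symm _ _ _) (hspacelike p)).ne'
  have henergy := hφ.energy_eq o hιs hspacelike (fun p => (hNfuture p).1) hXunit hXnormal hXN
    hXor hNext
  have hD := fun p w => CNT.boundaryDensity_eq_traceDensity 𝓜 (hιs p) (hXC p) hXnormal w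
  have hD' := fun p w => hφ.boundaryDensity_eq hιs (hXC p) hXnormal w
  refine ⟨?_, fun hNt => ?_⟩
  -- N^⊥ is timelike, so ‖N^⊥‖ has no zero and the densities are continuous.
  · have hν : ∀ p, 𝓜.g (ι p) (CNT.normalPart 2 𝓜.g ι p (N p)) (CNT.normalPart 2 𝓜.g ι p (N p))
        < 0 := fun p => by
      refine (CNT.metric_normalPart_self (hb _) (𝓜.symm _) (isUnit_iff_ne_zero.mpr
        (hdet p p (mem_chart_source _ p))) (fun v => ?_) (N p)).trans_lt (hNfuture p).1
      by_cases hv : v = 0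
      · obtain ⟨B, hB⟩ := hb (ι p)
        rw [hv, CNT.pullback, hB, map_zero, map_zero]
      · exact (hspacelike p v hv).le
    have hln : ∀ p, CNT.lnorm 𝓜.g (CNT.normalPart 2 𝓜.g ι p (N p)) ≠ 0 := fun p =>
      (Real.sqrt_pos.mpr (abs_pos.mpr (hν p).ne)).ne'
    have hmatch : ∀ (p : S) (u v : TangentSpace (𝓡 4) (ι p)),
        CNT.pullback (k := 4) φ 𝓜'.g (ι p) u v = 𝓜.g (ι p) u v := fun p =>
      hφ.matching _ (mem_range_self p)
    have hcont := CNT.continuous_traceDensity hιs (fun q => 𝓜.isMetricAt (ι q))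
      (fun q => 𝓜.isMetricAt (ι q)) rfl hdet hXC hNC hln
    have hcont' := CNT.continuous_traceDensity (g := CNT.pullback (k := 4) φ 𝓜'.g) hιs
      (fun q => 𝓜.isMetricAt (ι q)) (fun q => hφ.isMetricAt_pullback (mem_range_self q))
      (by funext p u v; exact hmatch p _ _) hdet hXC hNC
      (fun p => by rw [CNT.lnorm, hmatch]; exact hln p)
    -- The area elements of the two surfaces coincide by matching, and continuity of both densities
    -- permits splitting the integral.
    rw [henergy, hφ.pullback_comp_eq hιs, CNT.integralArea_sub hcont' hcont
      fun c p hp => CNT.continuousAt_det_gram hιs (fun q => 𝓜.isMetricAt (ι q)) hp, mul_sub]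
    simp only [hD, hD']
  -- For N normal to S the second term of each density vanishes, and the integrands agree pointwise
  -- without splitting the integral.
  · have hw : ∀ p, CNT.tangentialPart (k := 2) 𝓜.g ι p (N p) = 0 := fun p => by
      simp [CNT.tangentialPart, hNt]
    have hn : ∀ p, CNT.normalPart 2 𝓜.g ι p (N p) = N p := fun p => by
      rw [CNT.normalPart, hw, map_zero, sub_zero]
    rw [henergy]
    congr 1
    refine CNT.integralArea_congr fun p => ?_
    have hlnorm : CNT.lnorm 𝓜'.g (mfderiv (𝓡 4) (𝓡 4) φ (ι p) (N p)) = CNT.lnorm 𝓜.g (N p) :=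
      congrArg (fun t => Real.sqrt |t|) (hφ.matching _ (mem_range_self p) _ _)
    rw [hw, hn, ← hD, ← hD', CNT.boundaryDensity_zero, CNT.boundaryDensity_zero, hlnorm]
    ring
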